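/- For complex numbers $A,B,C,D$ let $S=S_{(A,B,C,D)}\subset\mathbf{C}^3$ be the cubic surface $x^2+y^2+z^2+xyz=Ax+By+Cz+D$. The group $\Gamma_2^*=\{M\in \mathrm{PGL}(2,\mathbf{Z}) : M\equiv \mathrm{Id} \bmod 2\}$ is the free product of three groups of order two, whose generators act on $S$ by the involutions $$s_x(x,y,z)=(A-x-yz,\,y,\,z),\quad s_y(x,y,z)=(x,\,B-y-xz,\,z),\quad s_z(x,y,z)=(x,\,y,\,C-z-xy);$$ thus $\Gamma_2^*$-orbits are the orbits of the group generated by $s_x,s_y,s_z$. Let $p\in S$ have a bounded $\Gamma_2^*$-orbit $\mathrm{Orb}(p)$ with more than $4$ points. Then: (1) $A,B,C,D$ are real, and $\mathrm{Orb}(p)$ is contained in the set $S(\mathbf{R})$ of real points of $S$. (2) If $\mathrm{Orb}(p)$ is finite, there is a number field $K\subset\mathbf{R}$ containing $A,B,C,D$ and the coordinates of all points of $\mathrm{Orb}(p)$; in particular these are all real algebraic numbers. (3) If $\mathrm{Orb}(p)$ is infinite, then (a) $\mathrm{Orb}(p)\subset[-2,2]^3$; (b) there are $a,b,c,d$ with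 $A=ab+cd$, $B=bc+ad$, $C=ac+bd$, $D=4-a^2-b^2-c^2-d^2-abcd$ such that every point $(x,y,z)$ of $\mathrm{Orb}(p)$ comes from an $\mathrm{SU}(2)$-representation with these parameters: there is a representation $\rho$ of $\langle\alpha,\beta,\gamma,\delta\mid\alpha\beta\gamma\delta=1\rangle$ (the fundamental group of the four-punctured sphere) into $\mathrm{SU}(2)\subset\mathrm{SL}(2,\mathbf{C})$ such that $\rho(\alpha),\rho(\beta),\rho(\gamma),\rho(\delta)$ have traces $a,b,c,d$ and $\rho(\alpha\beta),\rho(\beta\gamma),\rho(\gamma\alpha)$ have traces $x,y,z$; (c) the smooth part $S(\mathbf{R})\setminus\mathrm{Sing}(S)$ of $S(\mathbf{R})$ has exactly one bounded connected component, and $\mathrm{Orb}(p)$ is contained and dense in it. -/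

import Mathlib

namespace CantatLoray

/-! ### The cubic surfaces -/

/-- The `R`-points of the affine cubic surface
`x ^ 2 + y ^ 2 + z ^ 2 + x * y * z = A * x + B * y + C * z + D`. -/
def surface {R : Type*} [CommRing R] (A B C D : R) : Set (R × R × R) :=
  {q | q.1 ^ 2 + q.2.1 ^ 2 + q.2.2 ^ 2 + q.1 * q.2.1 * q.2.2
        = A * q.1 + B * q.2.1 + C * q.2.2 + D}

/-- The singular points: the points of the surface where the three partial derivatives of
`x ^ 2 + y ^ 2 + z ^ 2 + x * y * z - A * x - B * y - C * z - D` vanish. -/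
def singularLocus {R : Type*} [CommRing R] (A B C D : R) : Set (R × R × R) :=
  {q | q ∈ surface A B C D ∧ 2 * q.1 + q.2.1 * q.2.2 - A = 0 ∧
        2 * q.2.1 + q.1 * q.2.2 - B = 0 ∧ 2 * q.2.2 + q.1 * q.2.1 - C = 0}

/-- The smooth part of the surface. -/
def smoothPart {R : Type*} [CommRing R] (A B C D : R) : Set (R × R × R) :=
  surface A B C D \ singularLocus A B C D

/-- The inclusion of real points into complex points. -/
def toComplex (q : ℝ × ℝ × ℝ) : ℂ × ℂ × ℂ := ((q.1 : ℂ), (q.2.1 : ℂ), (q.2.2 : ℂ))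

/-- `U` is a bounded connected component of the set `E`. -/
def IsBoundedComponent (E U : Set (ℝ × ℝ × ℝ)) : Prop :=
  (∃ q ∈ E, U = connectedComponentIn E q) ∧ Bornology.IsBounded U

/-! ### The action of the group `Γ₂*` -/

/-- The involution `(x, y, z) ↦ (A - x - y * z, y, z)`. -/
def sx {R : Type*} [CommRing R] (A : R) : Equiv.Perm (R × R × R) where
  toFun q := (A - q.1 - q.2.1 * q.2.2, q.2.1, q.2.2)
  invFun q := (A - q.1 - q.2.1 * q.2.2, q.2.1, q.2.2)
  left_inv q := by ext <;> ring
  right_inv q := by ext <;> ring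

/-- The involution `(x, y, z) ↦ (x, B - y - x * z, z)`. -/
def sy {R : Type*} [CommRing R] (B : R) : Equiv.Perm (R × R × R) where
  toFun q := (q.1, B - q.2.1 - q.1 * q.2.2, q.2.2)
  invFun q := (q.1, B - q.2.1 - q.1 * q.2.2, q.2.2)
  left_inv q := by ext <;> ring
  right_inv q := by ext <;> ring

/-- The involution `(x, y, z) ↦ (x, y, C - z - x * y)`. -/
def sz {R : Type*} [CommRing R] (C : R) : Equiv.Perm (R × R × R) where
  toFun q := (q.1, q.2.1, C - q.2.2 - q.1 * q.2.1)
  invFun q := (q.1, q.2.1, C - q.2.2 - q.1 * q.2.1)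
  left_inv q := by ext <;> ring
  right_inv q := by ext <;> ring

/-- The group `Γ₂*` is the free product of three groups of order two; its generators act by
`sx`, `sy` and `sz`. This is the resulting group of polynomial automorphisms. Each of them
preserves every surface `surface A B C D`. -/
def gammaTwoStar {R : Type*} [CommRing R] (A B C : R) : Subgroup (Equiv.Perm (R × R × R)) :=
  Subgroup.closure {sx A, sy B, sz C}

/-- The `Γ₂*`-orbit of a point of `surface A B C D` (for any `D`). -/
def orb {R : Type*} [CommRing R] (A B C : R) (p : R × R × R) : Set (R × R × R) :=
  MulAction.orbit (gammaTwoStar A B C) p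

/-- The action of `Γ₂*` preserves the surface. -/
theorem orb_subset_surface {R : Type*} [CommRing R] (A B C D : R) (p : R × R × R)
    (hp : p ∈ surface A B C D) : orb A B C p ⊆ surface A B C D := by
  have key : ∀ g ∈ gammaTwoStar A B C, ∀ q, g q ∈ surface A B C D ↔ q ∈ surface A B C D := by
    intro g hg
    induction hg using Subgroup.closure_induction with
    | mem g hg =>
      intro q
      rcases hg with rfl | rfl | rfl
      · simp only [sx, surface, Equiv.coe_fn_mk, Set.mem_ofPred_eq]
        constructor <;> intro h <;> linear_combination h
      · simp only [sy, surface, Equiv.coe_fn_mk, Set.mem_ofPred_eq]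
        constructor <;> intro h <;> linear_combination h
      · simp only [sz, surface, Equiv.coe_fn_mk, Set.mem_ofPred_eq]
        constructor <;> intro h <;> linear_combination h
    | one => intro q; rfl
    | mul g h _ _ hg hh => intro q; exact (hg (h q)).trans (hh q)
    | inv g _ hg =>
      intro q
      have := hg (g⁻¹ q)
      rw [show g (g⁻¹ q) = q from g.apply_symm_apply q] at this
      exact this.symm
  rintro _ ⟨g, rfl⟩
  exact (key g.1 g.2 p).2 hp

/-! ### Representations of the fundamental group of the four punctured sphere -/

/-- The fundamental group `⟨α, β, γ, δ | α β γ δ = 1⟩` of the four punctured sphere. -/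
abbrev FourPuncturedSphereGroup : Type :=
  PresentedGroup ({FreeGroup.of 0 * FreeGroup.of 1 * FreeGroup.of 2 * FreeGroup.of 3} :
    Set (FreeGroup (Fin 4)))

/-- The generators `α, β, γ, δ` (with indices `0, 1, 2, 3`). -/
def loop (i : Fin 4) : FourPuncturedSphereGroup := PresentedGroup.of i

/-- Representations into `SL(2, ℂ)`. -/
abbrev Rep : Type := FourPuncturedSphereGroup →* Matrix.SpecialLinearGroup (Fin 2) ℂ

/-- The trace of `ρ(g)`. -/
def tr (ρ : Rep) (g : FourPuncturedSphereGroup) : ℂ :=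
  (ρ g : Matrix (Fin 2) (Fin 2) ℂ).trace

/-- `ρ` takes its values in `SU(2)`. -/
def IsSU2 (ρ : Rep) : Prop :=
  ∀ g, (ρ g : Matrix (Fin 2) (Fin 2) ℂ) ∈ Matrix.specialUnitaryGroup (Fin 2) ℂ

/-- The traces `a, b, c, d` of `ρ` at the four loops `α, β, γ, δ`. -/
def boundaryTraces (ρ : Rep) : ℂ × ℂ × ℂ × ℂ :=
  (tr ρ (loop 0), tr ρ (loop 1), tr ρ (loop 2), tr ρ (loop 3))

/-- The traces `x, y, z` of `ρ` at `α β`, `β γ`, `γ α`. -/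
def interiorTraces (ρ : Rep) : ℂ × ℂ × ℂ :=
  (tr ρ (loop 0 * loop 1), tr ρ (loop 1 * loop 2), tr ρ (loop 2 * loop 0))

/-- The trace parameters `(a, b, c, d)` fit to the parameters `(A, B, C, D)` of the surface. -/
def Fits (a b c d A B C D : ℂ) : Prop :=
  A = a * b + c * d ∧ B = b * c + a * d ∧ C = a * c + b * d ∧
    D = 4 - a ^ 2 - b ^ 2 - c ^ 2 - d ^ 2 - a * b * c * d

end CantatLoray

/-! Fix x = l + l⁻¹. The slice of S at x is a conic, on which `sz ∘ sy` acts as an affine map whose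
linear part has eigenvalues l² and l⁻². If the orbit is bounded, each of its points either has x in
(-2, 2) or is fixed by both `sy` and `sz` (`IsInvariant.isElliptic_or_fixed`); the same holds for y
and z. If a subfield of ℂ contains every elliptic value but misses a coordinate of some orbit point,
the orbit closes up after at most four points (`IsLong.fst_mem`). With the subfield ℝ this gives
reality. In a finite orbit the relevant rotations have finite order, so the elliptic values are sums
ζ + ζ⁻¹ with ζ a root of unity, and the subfield of algebraic numbers gives the number field.

For an infinite orbit the crux is to find a slice that rotates with infinite order
(`not_controlled_of_infinite`). Suppose there is none. Finitely many values ζ + ζ⁻¹ would leave only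
finitely many points, so the orders of the ζ are unbounded. Averaging over a rotation bounds the
discriminant P(x) of the slice by a multiple of |4 - x²|². Conjugated orbits satisfy the same kind
of bound, uniformly enough, and a conjugation can carry ζ to exp(2πi/m), so that x tends to 2 or to
-2. Hence P vanishes doubly at both points, which forces A = B = C = 0 and D = 4. On this Cayley
cubic the points in question are torsion points of a quotient of a torus and have finite orbits, a
contradiction.

On a slice of irrational rotation the closure of the orbit contains the whole ellipse. Using slices
in another coordinate direction, it then contains all neighbouring ellipses, up to the ends of a
maximal interval (r, s) on which P > 0 (`IsInvariant.slab_subset`). Boundedness of this slab makes r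
and s roots of P, with multiplicity at least two at ±2. A quartic has room for only one such
interval (`IsCompactInterval.unique`). The closure of the slab is open and closed in the smooth
part, and every bounded component contains a slab of this kind, so there is exactly one bounded
component. By uniqueness it is invariant; it therefore contains the orbit, which is dense in it.

Finally P = (x - r)(x - s)(x² + βx + γ), and the traces come from writing the two quadratics as x² -
cdx + c² + d² - 4 and x² - abx + a² + b² - 4. The points of the slab are then realized by explicit
unit quaternions (`mem_unitaryTraces`), and those of its closure by compactness of SU(2). -/

namespace CantatLoray

open Set Filter Topology

/-! ### Invariant sets -/

/-- A set that is mapped into itself by the three involutions. -/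
structure IsInvariant {R : Type*} [CommRing R] (A B C : R) (T : Set (R × R × R)) : Prop where
  sx_mem : ∀ q ∈ T, sx A q ∈ T
  sy_mem : ∀ q ∈ T, sy B q ∈ T
  sz_mem : ∀ q ∈ T, sz C q ∈ T

section Basic

set_option linter.unusedSectionVars false

variable {R : Type*} [CommRing R]

theorem sx_apply (A : R) (q : R × R × R) : sx A q = (A - q.1 - q.2.1 * q.2.2, q.2.1, q.2.2) := rfl
theorem sy_apply (B : R) (q : R × R × R) : sy B q = (q.1, B - q.2.1 - q.1 * q.2.2, q.2.2) := rfl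
theorem sz_apply (C : R) (q : R × R × R) : sz C q = (q.1, q.2.1, C - q.2.2 - q.1 * q.2.1) := rfl

theorem sx_sx (A : R) (q : R × R × R) : sx A (sx A q) = q := (sx A).left_inv q
theorem sy_sy (B : R) (q : R × R × R) : sy B (sy B q) = q := (sy B).left_inv q
theorem sz_sz (C : R) (q : R × R × R) : sz C (sz C q) = q := (sz C).left_inv q

theorem mem_orb_self (A B C : R) (p : R × R × R) : p ∈ orb A B C p := MulAction.mem_orbit_self p

theorem orb_isInvariant (A B C : R) (p : R × R × R) : IsInvariant A B C (orb A B C p) := by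
  have key : ∀ g : Equiv.Perm (R × R × R), g ∈ gammaTwoStar A B C →
      ∀ q ∈ orb A B C p, g q ∈ orb A B C p := by
    rintro g hg _ ⟨h, rfl⟩
    exact ⟨⟨g, hg⟩ * h, rfl⟩
  refine ⟨key _ ?_, key _ ?_, key _ ?_⟩ <;> exact Subgroup.subset_closure (by simp)

theorem IsInvariant.orb_subset {A B C : R} {T : Set (R × R × R)} (hT : IsInvariant A B C T)
    {p : R × R × R} (hp : p ∈ T) : orb A B C p ⊆ T := by
  have key : ∀ g ∈ gammaTwoStar A B C, ∀ q, g q ∈ T ↔ q ∈ T := by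
    intro g hg
    induction hg using Subgroup.closure_induction with
    | mem g hg =>
      intro q
      rcases hg with rfl | rfl | rfl
      · exact ⟨fun h => sx_sx A q ▸ hT.sx_mem _ h, hT.sx_mem q⟩
      · exact ⟨fun h => sy_sy B q ▸ hT.sy_mem _ h, hT.sy_mem q⟩
      · exact ⟨fun h => sz_sz C q ▸ hT.sz_mem _ h, hT.sz_mem q⟩
    | one => intro q; rfl
    | mul g h _ _ hg hh => intro q; exact (hg (h q)).trans (hh q)
    | inv g _ hg =>
      intro q
      have := hg (g⁻¹ q)
      rw [show g (g⁻¹ q) = q from g.apply_symm_apply q] at this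
      exact this.symm
  rintro _ ⟨g, rfl⟩
  exact (key g.1 g.2 p).2 hp

/-- The cyclic permutation of coordinates, from the coordinates `(y, z, x)` to `(x, y, z)`. -/
def rot (q : R × R × R) : R × R × R := (q.2.2, q.1, q.2.1)

theorem rot_rot_rot (q : R × R × R) : rot (rot (rot q)) = q := rfl

theorem rot_sx (A : R) (q : R × R × R) : rot (sz A q) = sx A (rot q) := by
  simp [rot, sz_apply, sx_apply]
theorem rot_sy (B : R) (q : R × R × R) : rot (sx B q) = sy B (rot q) := by
  simp only [rot, sx_apply, sy_apply, Prod.mk.injEq, true_and, and_true]; ring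
theorem rot_sz (C : R) (q : R × R × R) : rot (sy C q) = sz C (rot q) := by
  simp only [rot, sy_apply, sz_apply, Prod.mk.injEq, true_and]; ring

theorem rot_mem_surface {A B C D : R} {q : R × R × R} :
    rot q ∈ surface A B C D ↔ q ∈ surface B C A D := by
  simp only [rot, surface, mem_ofPred_eq]
  constructor <;> intro h <;> linear_combination h

theorem IsInvariant.rot {A B C : R} {T : Set (R × R × R)} (h : IsInvariant A B C T) :
    IsInvariant B C A (rot ⁻¹' T) where
  sx_mem q hq := by rw [mem_preimage, rot_sy]; exact h.sy_mem _ hq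
  sy_mem q hq := by rw [mem_preimage, rot_sz]; exact h.sz_mem _ hq
  sz_mem q hq := by rw [mem_preimage, rot_sx]; exact h.sx_mem _ hq

theorem rot_injective : Function.Injective (rot : R × R × R → R × R × R) := fun q q' h => by
  have := congrArg (fun t => CantatLoray.rot (CantatLoray.rot t)) h
  simpa [rot_rot_rot] using this

end Basic

/-! ### The dichotomy for points of a bounded invariant set -/

theorem eq_zero_of_norm_add_mul_le {a b : ℂ} {M : ℝ} (h : ∀ k : ℕ, ‖a + k * b‖ ≤ M) : b = 0 := by
  by_contra hb
  have hb' : 0 < ‖b‖ := norm_pos_iff.2 hb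
  obtain ⟨k, hk⟩ := exists_nat_gt ((M + ‖a‖) / ‖b‖)
  rw [div_lt_iff₀ hb'] at hk
  have h1 : ‖(k : ℂ) * b‖ ≤ ‖a + k * b‖ + ‖a‖ := by
    simpa using norm_sub_le (a + k * b) a
  rw [norm_mul, Complex.norm_natCast] at h1
  linarith [h k]

theorem eq_zero_of_norm_pow_mul_le {l p : ℂ} {M : ℝ} (hl : 1 < ‖l‖)
    (h : ∀ k : ℕ, ‖l ^ (2 * k) * p‖ ≤ M) : p = 0 := by
  by_contra hp
  have hp' : 0 < ‖p‖ := norm_pos_iff.2 hp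
  obtain ⟨k, hk⟩ := pow_unbounded_of_one_lt (M / ‖p‖) hl
  rw [div_lt_iff₀ hp'] at hk
  have h1 := h k
  rw [norm_mul, norm_pow] at h1
  have h2 : ‖l‖ ^ k ≤ ‖l‖ ^ (2 * k) := pow_le_pow_right₀ hl.le (by omega)
  nlinarith

/-- The point (u, v) is the centre of the slice, and (y - u) + l(z - v) and (y - u) + l⁻¹(z - v) are
eigenforms of `sz ∘ sy` for l² and l⁻². The second claim iterates the inverse `sy ∘ sz`, so that
both forms are multiplied by l², the factor that grows when |l| > 1. -/
theorem exists_mem_sz_sy_iterate {A B C : ℂ} {T : Set (ℂ × ℂ × ℂ)} (hT : IsInvariant A B C T)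
    {x y z l u v : ℂ} (hl : l ≠ 0) (hx : x = l + l⁻¹) (hu : 2 * u + x * v = B)
    (hv : 2 * v + x * u = C) (hq : (x, y, z) ∈ T) (k : ℕ) :
    (∃ y' z', (x, y', z') ∈ T ∧
      (y' - u) + l * (z' - v) = l ^ (2 * k) * ((y - u) + l * (z - v))) ∧
    (∃ y' z', (x, y', z') ∈ T ∧
      (y' - u) + l⁻¹ * (z' - v) = l ^ (2 * k) * ((y - u) + l⁻¹ * (z - v))) := by
  have hll : l * l⁻¹ = 1 := mul_inv_cancel₀ hl
  subst hx
  generalize l⁻¹ = m at *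
  induction k with
  | zero => exact ⟨⟨y, z, hq, by simp⟩, ⟨y, z, hq, by simp⟩⟩
  | succ k ih =>
    obtain ⟨⟨y1, z1, h1, e1⟩, ⟨y2, z2, h2, e2⟩⟩ := ih
    refine ⟨⟨_, _, hT.sz_mem _ (hT.sy_mem _ h1), ?_⟩, ⟨_, _, hT.sy_mem _ (hT.sz_mem _ h2), ?_⟩⟩
    · simp only [← hu, ← hv, sy_apply]
      rw [show l ^ (2 * (k + 1)) * ((y - u) + l * (z - v))
        = l ^ 2 * (l ^ (2 * k) * ((y - u) + l * (z - v))) by ring, ← e1]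
      linear_combination ((y1 - u) + (l + m) * (z1 - v) + l * (z1 - v)) * hll
    · simp only [← hu, ← hv, sz_apply]
      rw [show l ^ (2 * (k + 1)) * ((y - u) + m * (z - v))
        = l ^ 2 * (l ^ (2 * k) * ((y - u) + m * (z - v))) by ring, ← e2]
      linear_combination ((y2 - u) - l * (z2 - v)) * hll

/-- At x = ±2 the linear part of `sz ∘ sy` is unipotent, so iterates grow polynomially: y + ez
drifts by eC - B, and once this drift is zero, y itself drifts by a constant. Both drifts vanish in
a bounded set. -/
theorem exists_mem_sz_sy_iterate_of_sq_eq_one {A B C : ℂ} {T : Set (ℂ × ℂ × ℂ)}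
    (hT : IsInvariant A B C T) {e y z : ℂ} (he : e ^ 2 = 1) (hq : (2 * e, y, z) ∈ T) (k : ℕ) :
    ∃ y' z', (2 * e, y', z') ∈ T ∧ y' + e * z' = (y + e * z) + k * (e * C - B) ∧
      (e * C = B → y' = y + k * (B - 2 * (y + e * z))) := by
  induction k with
  | zero => exact ⟨y, z, hq, by simp, by simp⟩
  | succ k ih =>
    obtain ⟨y1, z1, h1, e1, f1⟩ := ih
    refine ⟨_, _, hT.sz_mem _ (hT.sy_mem _ h1), ?_, ?_⟩
    · simp only [sy_apply]
      push_cast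
      linear_combination e1 + (2 * y1 + 4 * e * z1 - 2 * B) * he
    · intro h
      simp only [sy_apply]
      push_cast
      have := f1 h
      rw [h] at e1
      linear_combination this - 2 * e1

theorem exists_add_inv_eq (x : ℂ) : ∃ l : ℂ, l ≠ 0 ∧ 1 ≤ ‖l‖ ∧ x = l + l⁻¹ := by
  obtain ⟨l, hl0, hl⟩ : ∃ l : ℂ, l ≠ 0 ∧ x = l + l⁻¹ := by
    obtain ⟨d, hd⟩ := IsAlgClosed.exists_pow_nat_eq (x ^ 2 - 4) (n := 2) (by norm_num)
    have hp : ((x + d) / 2) * ((x - d) / 2) = 1 := by linear_combination -hd / 4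
    refine ⟨(x + d) / 2, left_ne_zero_of_mul_eq_one hp, ?_⟩
    rw [← eq_inv_of_mul_eq_one_right hp]; ring
  rcases le_total 1 ‖l‖ with h | h
  · exact ⟨l, hl0, h, hl⟩
  · refine ⟨l⁻¹, inv_ne_zero hl0, ?_, by rw [inv_inv, hl, add_comm]⟩
    rw [norm_inv]
    exact (one_le_inv₀ (norm_pos_iff.2 hl0)).2 h

/-- The open interval `(-2, 2)`, as a predicate on complex numbers. -/
def IsElliptic (w : ℂ) : Prop := ∃ t : ℝ, t ∈ Ioo (-2) 2 ∧ w = t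

/-- For x = ±2 the two drifts of the parabolic map vanish, and this says that the point is fixed.
For |l| > 1 both eigenforms must vanish, so the point is the centre of its slice. For |l| = 1 the
inverse of l is its conjugate, and x = 2 Re l is real. -/
theorem IsInvariant.isElliptic_or_fixed {A B C : ℂ} {T : Set (ℂ × ℂ × ℂ)}
    (hT : IsInvariant A B C T) (hb : Bornology.IsBounded T) {q : ℂ × ℂ × ℂ} (hq : q ∈ T) :
    IsElliptic q.1 ∨ (sy B q = q ∧ sz C q = q) := by
  obtain ⟨x, y, z⟩ := q
  obtain ⟨M, hM⟩ := hb.exists_norm_le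
  have hy : ∀ {y' z'}, (x, y', z') ∈ T → ‖y'‖ ≤ M := fun h =>
    (norm_fst_le _).trans ((norm_snd_le _).trans (hM _ h))
  have hz : ∀ {y' z'}, (x, y', z') ∈ T → ‖z'‖ ≤ M := fun h =>
    (norm_snd_le _).trans ((norm_snd_le _).trans (hM _ h))
  by_cases hx2 : x ^ 2 = 4
  · right
    obtain ⟨e, rfl⟩ : ∃ e, x = 2 * e := ⟨x / 2, by ring⟩
    have he : e ^ 2 = 1 := by linear_combination hx2 / 4
    have hen : ‖e‖ = 1 := by
      have := congrArg norm he
      rw [norm_pow, norm_one] at this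
      exact (pow_eq_one_iff_of_nonneg (norm_nonneg _) (by norm_num)).1 this
    have h1 : e * C - B = 0 := by
      refine eq_zero_of_norm_add_mul_le (a := y + e * z) (M := M + M) fun k => ?_
      obtain ⟨y', z', hm, h, -⟩ := exists_mem_sz_sy_iterate_of_sq_eq_one hT he hq k
      rw [← h]
      refine (norm_add_le _ _).trans (add_le_add (hy hm) ?_)
      rw [norm_mul, hen, one_mul]
      exact hz hm
    have h2 : B - 2 * (y + e * z) = 0 := by
      refine eq_zero_of_norm_add_mul_le (a := y) (M := M) fun k => ?_
      obtain ⟨y', z', hm, -, h⟩ := exists_mem_sz_sy_iterate_of_sq_eq_one hT he hq k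
      rw [← h (by linear_combination h1)]
      exact hy hm
    constructor
    · simp only [sy_apply, Prod.mk.injEq, true_and, and_true]
      linear_combination h2
    · simp only [sz_apply, Prod.mk.injEq, true_and]
      linear_combination e * h2 + e * h1 - (C - 2 * z) * he
  · obtain ⟨l, hl0, hl1, hxl⟩ := exists_add_inv_eq x
    have hll : l * l⁻¹ = 1 := mul_inv_cancel₀ hl0
    have hx4 : 4 - x ^ 2 ≠ 0 := fun h => hx2 (by linear_combination -h)
    rcases hl1.eq_or_lt with h | h
    · left
      have hre : x = ((2 * l.re : ℝ) : ℂ) := by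
        rw [hxl, Complex.inv_def, Complex.normSq_eq_norm_sq, ← h]
        simp [Complex.add_conj]
      refine ⟨2 * l.re, ?_, hre⟩
      have h3 : |l.re| ≤ 1 := h ▸ Complex.abs_re_le_norm l
      rw [hre] at hx2
      norm_cast at hx2
      rw [abs_le] at h3
      constructor
      · refine lt_of_le_of_ne (by linarith) fun h' => hx2 (by rw [← h']; norm_num)
      · refine lt_of_le_of_ne (by linarith) fun h' => hx2 (by rw [h']; norm_num)
    · right
      set u := (2 * B - x * C) / (4 - x ^ 2) with hu'
      set v := (2 * C - x * B) / (4 - x ^ 2) with hv'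
      have hu : 2 * u + x * v = B := by rw [hu', hv']; field_simp; ring
      have hv : 2 * v + x * u = C := by rw [hu', hv']; field_simp; ring
      have key := exists_mem_sz_sy_iterate hT hl0 hxl hu hv hq
      have bd : ∀ w : ℂ, ∀ {y' z'}, (x, y', z') ∈ T →
          ‖(y' - u) + w * (z' - v)‖ ≤ (M + ‖u‖) + ‖w‖ * (M + ‖v‖) := by
        intro w y' z' hm
        refine (norm_add_le _ _).trans (add_le_add ?_ ?_)
        · exact (norm_sub_le _ _).trans (by linarith [hy hm])
        · rw [norm_mul]
          exact mul_le_mul_of_nonneg_left ((norm_sub_le _ _).trans (by linarith [hz hm]))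
            (norm_nonneg _)
      have p1 : (y - u) + l * (z - v) = 0 := by
        refine eq_zero_of_norm_pow_mul_le h (M := (M + ‖u‖) + ‖l‖ * (M + ‖v‖)) fun k => ?_
        obtain ⟨⟨y', z', hm, e⟩, -⟩ := key k
        rw [← e]
        exact bd _ hm
      have p2 : (y - u) + l⁻¹ * (z - v) = 0 := by
        refine eq_zero_of_norm_pow_mul_le h (M := (M + ‖u‖) + ‖l⁻¹‖ * (M + ‖v‖)) fun k => ?_
        obtain ⟨-, ⟨y', z', hm, e⟩⟩ := key k
        rw [← e]
        exact bd _ hm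
      have p3 : (l - l⁻¹) * (z - v) = 0 := by linear_combination p1 - p2
      have hne : l - l⁻¹ ≠ 0 := by
        intro h0
        apply hx2
        rw [hxl]
        linear_combination (l - l⁻¹) * h0 + 4 * hll
      have hz0 : z - v = 0 := (mul_eq_zero.1 p3).resolve_left hne
      have hy0 : y - u = 0 := by linear_combination p1 - l * hz0
      constructor
      · simp only [sy_apply, Prod.mk.injEq, true_and, and_true]
        linear_combination -hu - 2 * hy0 - x * hz0
      · simp only [sz_apply, Prod.mk.injEq, true_and]
        linear_combination -hv - 2 * hz0 - x * hy0

/-! ### Orbits of length more than four -/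

/-- Wherever a coordinate fails to satisfy `good`, the two involutions that preserve this
coordinate fix the point. -/
structure Controlled (A B C : ℂ) (good : ℂ → Prop) (T : Set (ℂ × ℂ × ℂ)) : Prop where
  fst : ∀ q ∈ T, ¬ good q.1 → sy B q = q ∧ sz C q = q
  snd : ∀ q ∈ T, ¬ good q.2.1 → sx A q = q ∧ sz C q = q
  thd : ∀ q ∈ T, ¬ good q.2.2 → sx A q = q ∧ sy B q = q

theorem Controlled.rot {A B C : ℂ} {good : ℂ → Prop} {T : Set (ℂ × ℂ × ℂ)}
    (h : Controlled A B C good T) : Controlled B C A good (rot ⁻¹' T) where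
  fst q hq hg := by
    have := h.snd _ hq hg
    exact ⟨rot_injective (by rw [rot_sz]; exact this.2), rot_injective (by rw [rot_sx]; exact this.1)⟩
  snd q hq hg := by
    have := h.thd _ hq hg
    exact ⟨rot_injective (by rw [rot_sy]; exact this.2), rot_injective (by rw [rot_sx]; exact this.1)⟩
  thd q hq hg := by
    have := h.fst _ hq hg
    exact ⟨rot_injective (by rw [rot_sy]; exact this.1), rot_injective (by rw [rot_sz]; exact this.2)⟩

/-- An invariant set is long if it has no invariant subset of at most four points. -/
structure IsLong (A B C : ℂ) (T : Set (ℂ × ℂ × ℂ)) : Prop extends IsInvariant A B C T where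
  long : ∀ T' : Set (ℂ × ℂ × ℂ), T' ⊆ T → T'.Nonempty → IsInvariant A B C T' → 4 < T'.encard

theorem IsLong.rot {A B C : ℂ} {T : Set (ℂ × ℂ × ℂ)} (h : IsLong A B C T) :
    IsLong B C A (rot ⁻¹' T) where
  toIsInvariant := h.toIsInvariant.rot
  long T' hT' hne hinv := by
    have h2 := h.long (CantatLoray.rot ⁻¹' (CantatLoray.rot ⁻¹' T'))
      (fun q hq => hT' hq) (by obtain ⟨q, hq⟩ := hne; exact ⟨CantatLoray.rot q, hq⟩) hinv.rot.rot
    rwa [← preimage_comp, Set.encard_preimage_of_bijective] at h2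
    exact Function.bijective_iff_has_inverse.2 ⟨CantatLoray.rot, fun q => rfl, fun q => rfl⟩

theorem IsLong.orb {A B C : ℂ} {p : ℂ × ℂ × ℂ} (h : 4 < (orb A B C p).encard) :
    IsLong A B C (orb A B C p) where
  toIsInvariant := orb_isInvariant A B C p
  long T' hT' hne hinv := by
    obtain ⟨q, hq⟩ := hne
    obtain ⟨g, rfl⟩ := hT' hq
    have : CantatLoray.orb A B C p ⊆ T' := by
      have h1 := hinv.orb_subset hq
      have h2 : CantatLoray.orb A B C (g • p) = CantatLoray.orb A B C p :=
        MulAction.orbit_smul g p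
      exact h2 ▸ h1
    exact h.trans_le (Set.encard_le_encard this)

theorem encard_four_le {α : Type*} (a b c d : α) : ({a, b, c, d} : Set α).encard ≤ 4 := by
  refine (Set.encard_insert_le _ _).trans ?_
  have h2 : ({b, c, d} : Set α).encard ≤ 3 := by
    refine (Set.encard_insert_le _ _).trans ?_
    have h3 : ({c, d} : Set α).encard ≤ 2 := by
      refine (Set.encard_insert_le _ _).trans ?_
      rw [Set.encard_singleton]; norm_num
    calc _ ≤ (2 : ℕ∞) + 1 := by gcongr
      _ = 3 := by norm_num
  calc _ ≤ (3 : ℕ∞) + 1 := by gcongr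
    _ = 4 := by norm_num

section Long

variable {A B C : ℂ} {good : ℂ → Prop} {T : Set (ℂ × ℂ × ℂ)}

/-- The shape of an invariant set around a point with a coordinate that is not `good`. -/
theorem IsLong.good_of_not_good (hT : IsLong A B C T) (hc : Controlled A B C good T)
    {q : ℂ × ℂ × ℂ} (hq : q ∈ T) (hx : ¬ good q.1) :
    good q.2.1 ∧ good q.2.2 ∧ good (A - q.1 - q.2.1 * q.2.2) := by
  obtain ⟨fy, fz⟩ := hc.fst q hq hx
  have hnx : sx A q ≠ q := by
    intro fx
    have := hT.long {q} (by simpa using hq) ⟨q, rfl⟩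
      ⟨by simpa using fx, by simpa using fy, by simpa using fz⟩
    rw [Set.encard_singleton] at this
    exact absurd this (by norm_num)
  refine ⟨?_, ?_, ?_⟩
  · by_contra h
    exact hnx (hc.snd q hq h).1
  · by_contra h
    exact hnx (hc.thd q hq h).1
  · by_contra h
    obtain ⟨gy, gz⟩ := hc.fst _ (hT.sx_mem q hq) h
    -- The invariant pair is listed with repetitions so that `encard_four_le` applies.
    have := hT.long {q, sx A q, q, q}
      (by rintro _ (rfl | rfl | rfl | rfl); exacts [hq, hT.sx_mem _ hq, hq, hq])
      ⟨q, by simp⟩ ⟨?_, ?_, ?_⟩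
    · exact absurd this (not_lt.2 (encard_four_le _ _ _ _))
    · rintro _ (rfl | rfl | rfl | rfl) <;> simp [sx_sx]
    · rintro _ (rfl | rfl | rfl | rfl) <;> simp [fy, gy]
    · rintro _ (rfl | rfl | rfl | rfl) <;> simp [fz, gz]

/-- This is where the bound four comes from. If x is not in F, then `sy` and `sz` fix q, so B = 2y +
xz and C = 2z + xy. With x' the first coordinate of q₁ = `sx A q`, the second coordinate of `sy B
q1` is y + (x - x')z, which lies outside F unless z = 0. So `sy B q1` is fixed by `sx` and `sz`, or
it equals q₁; likewise for `sz C q1`. The points q, q₁, `sy B q1`, `sz C q1` then form an invariant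
set. -/
theorem IsLong.fst_mem (hT : IsLong A B C T) (hc : Controlled A B C good T) (F : Subfield ℂ)
    (hF : ∀ t, good t → t ∈ F) {q : ℂ × ℂ × ℂ} (hq : q ∈ T) : q.1 ∈ F := by
  by_contra hxF
  have hx : ¬ good q.1 := fun h => hxF (hF _ h)
  obtain ⟨fy, fz⟩ := hc.fst q hq hx
  obtain ⟨gy, gz, gx⟩ := hT.good_of_not_good hc hq hx
  replace gy := hF _ gy
  replace gz := hF _ gz
  replace gx := hF _ gx
  set q1 := sx A q with hq1
  have h1 : q1 ∈ T := hT.sx_mem q hq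
  obtain ⟨x, y, z⟩ := q
  simp only [sy_apply, sz_apply, Prod.mk.injEq, true_and, and_true] at fy fz hxF gx gy gz
  have aux : ∀ {x' : ℂ}, x' ∈ F → ∀ {w : ℂ}, w ∈ F → w ≠ 0 → ∀ {t : ℂ}, t ∈ F →
      t + (x - x') * w ∉ F := by
    intro x' hx' w hw hw0 t ht hmem
    apply hxF
    have h3 : x = (t + (x - x') * w - t) / w + x' := by field_simp; ring
    rw [h3]
    exact F.add_mem (F.div_mem (F.sub_mem hmem ht) hw) hx'
  have hfy : sx A (sy B q1) = sy B q1 ∧ sz C (sy B q1) = sy B q1 ∨ sy B q1 = q1 := by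
    by_cases hz : z = 0
    · right
      subst hz
      simp only [hq1, sx_apply, sy_apply, Prod.mk.injEq, true_and, and_true]
      linear_combination fy
    · left
      refine hc.snd _ (hT.sy_mem _ h1) fun h => aux gx gz hz gy ?_
      convert hF _ h using 1
      simp only [hq1, sx_apply, sy_apply]
      linear_combination -fy
  have hfz : sx A (sz C q1) = sz C q1 ∧ sy B (sz C q1) = sz C q1 ∨ sz C q1 = q1 := by
    by_cases hy : y = 0
    · right
      subst hy
      simp only [hq1, sx_apply, sz_apply, Prod.mk.injEq, true_and]
      linear_combination fz
    · left
      refine hc.thd _ (hT.sz_mem _ h1) fun h => aux gx gy hy gz ?_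
      convert hF _ h using 1
      simp only [hq1, sx_apply, sz_apply]
      linear_combination -fz
  have fy' : sy B (x, y, z) = (x, y, z) := by simp [sy_apply, fy]
  have fz' : sz C (x, y, z) = (x, y, z) := by simp [sz_apply, fz]
  have := hT.long {(x, y, z), q1, sy B q1, sz C q1} ?_ ⟨(x, y, z), by simp⟩ ⟨?_, ?_, ?_⟩
  · exact absurd this (not_lt.2 (encard_four_le _ _ _ _))
  · rintro _ (rfl | rfl | rfl | rfl)
    exacts [hq, h1, hT.sy_mem _ h1, hT.sz_mem _ h1]
  · have e : sx A q1 = (x, y, z) := sx_sx A _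
    rintro _ (rfl | rfl | rfl | rfl)
    · simp [← hq1]
    · simp [e]
    · rcases hfy with h | h
      · simp [h.1]
      · simp [h, e]
    · rcases hfz with h | h
      · simp [h.1]
      · simp [h, e]
  · rintro _ (rfl | rfl | rfl | rfl)
    · simp [fy']
    · simp
    · simp [sy_sy]
    · rcases hfz with h | h
      · simp [h.2]
      · simp [h]
  · rintro _ (rfl | rfl | rfl | rfl)
    · simp [fz']
    · simp
    · rcases hfy with h | h
      · simp [h.2]
      · simp [h]
    · simp [sz_sz]

theorem IsLong.coord_mem (hT : IsLong A B C T) (hc : Controlled A B C good T) (F : Subfield ℂ)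
    (hF : ∀ t, good t → t ∈ F) {q : ℂ × ℂ × ℂ} (hq : q ∈ T) :
    q.1 ∈ F ∧ q.2.1 ∈ F ∧ q.2.2 ∈ F :=
  ⟨hT.fst_mem hc F hF hq,
    hT.rot.fst_mem hc.rot F hF (q := (q.2.1, q.2.2, q.1)) hq,
    hT.rot.rot.fst_mem hc.rot.rot F hF (q := (q.2.2, q.1, q.2.1)) hq⟩

theorem IsLong.param_mem (hT : IsLong A B C T) (hc : Controlled A B C good T) (F : Subfield ℂ)
    (hF : ∀ t, good t → t ∈ F) {q : ℂ × ℂ × ℂ} (hq : q ∈ T) : A ∈ F ∧ B ∈ F ∧ C ∈ F := by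
  obtain ⟨hx, hy, hz⟩ := hT.coord_mem hc F hF hq
  have h1 := (hT.coord_mem hc F hF (hT.sx_mem q hq)).1
  have h2 := (hT.coord_mem hc F hF (hT.sy_mem q hq)).2.1
  have h3 := (hT.coord_mem hc F hF (hT.sz_mem q hq)).2.2
  simp only [sx_apply, sy_apply, sz_apply] at h1 h2 h3
  refine ⟨?_, ?_, ?_⟩
  · convert F.add_mem (F.add_mem h1 hx) (F.mul_mem hy hz) using 1; ring
  · convert F.add_mem (F.add_mem h2 hy) (F.mul_mem hx hz) using 1; ring
  · convert F.add_mem (F.add_mem h3 hz) (F.mul_mem hx hy) using 1; ring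

end Long

theorem controlled_of_rot {good : ℂ → Prop} {A B C : ℂ} {T : Set (ℂ × ℂ × ℂ)}
    (h1 : ∀ q ∈ T, good q.1 ∨ (sy B q = q ∧ sz C q = q))
    (h2 : ∀ q ∈ rot ⁻¹' T, good q.1 ∨ (sy C q = q ∧ sz A q = q))
    (h3 : ∀ q ∈ rot ⁻¹' (rot ⁻¹' T), good q.1 ∨ (sy A q = q ∧ sz B q = q)) :
    Controlled A B C good T := by
  refine ⟨fun q hq h => (h1 q hq).resolve_left h, fun q hq h => ?_, fun q hq h => ?_⟩
  · have := (h2 (q.2.1, q.2.2, q.1) hq).resolve_left h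
    have h1 := congrArg CantatLoray.rot this.1
    have h2 := congrArg CantatLoray.rot this.2
    rw [rot_sz] at h1
    rw [rot_sx] at h2
    exact ⟨h2, h1⟩
  · have := (h3 (q.2.2, q.1, q.2.1) hq).resolve_left h
    have h1 := congrArg (fun t => CantatLoray.rot (CantatLoray.rot t)) this.1
    have h2 := congrArg (fun t => CantatLoray.rot (CantatLoray.rot t)) this.2
    simp only [rot_sy, rot_sz, rot_sx] at h1 h2
    exact ⟨h1, h2⟩

theorem isBounded_preimage_rot {T : Set (ℂ × ℂ × ℂ)} (hb : Bornology.IsBounded T) :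
    Bornology.IsBounded (rot ⁻¹' T) := by
  obtain ⟨M, hM⟩ := hb.exists_norm_le
  refine isBounded_iff_forall_norm_le.2 ⟨M, fun q hq => ?_⟩
  have := hM _ hq
  simp only [rot, Prod.norm_def, sup_le_iff] at this ⊢
  tauto

theorem IsInvariant.controlled {A B C : ℂ} {T : Set (ℂ × ℂ × ℂ)} (hT : IsInvariant A B C T)
    (hb : Bornology.IsBounded T) : Controlled A B C IsElliptic T :=
  controlled_of_rot (fun _ hq => hT.isElliptic_or_fixed hb hq)
    (fun _ hq => hT.rot.isElliptic_or_fixed (isBounded_preimage_rot hb) hq)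
    (fun _ hq => hT.rot.rot.isElliptic_or_fixed
      (isBounded_preimage_rot (isBounded_preimage_rot hb)) hq)


/-! ### Traces of rotations of finite order -/

/-- `w` is of the form `2 cos (π r)` with `r` rational, and `w ≠ ± 2`. -/
def IsFiniteOrderTrace (w : ℂ) : Prop :=
  ∃ ζ : ℂ, ∃ n : ℕ, 0 < n ∧ ζ ^ n = 1 ∧ ζ ^ 2 ≠ 1 ∧ w = ζ + ζ⁻¹

/-- Here both eigenforms are followed along the same iterate, so that the iterate itself can be
recovered from them; this is what the averaging in `norm_sliceDisc_le` needs. -/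
theorem exists_mem_sz_sy_iterate' {A B C : ℂ} {T : Set (ℂ × ℂ × ℂ)} (hT : IsInvariant A B C T)
    {x y z l u v : ℂ} (hl : l ≠ 0) (hx : x = l + l⁻¹) (hu : 2 * u + x * v = B)
    (hv : 2 * v + x * u = C) (hq : (x, y, z) ∈ T) (k : ℕ) :
    ∃ y' z', (x, y', z') ∈ T ∧
      (y' - u) + l * (z' - v) = (l ^ 2) ^ k * ((y - u) + l * (z - v)) ∧
      (y' - u) + l⁻¹ * (z' - v) = ((l⁻¹) ^ 2) ^ k * ((y - u) + l⁻¹ * (z - v)) := by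
  have hll : l * l⁻¹ = 1 := mul_inv_cancel₀ hl
  subst hx
  generalize l⁻¹ = m at *
  induction k with
  | zero => exact ⟨y, z, hq, by simp⟩
  | succ k ih =>
    obtain ⟨y1, z1, h1, e1, e2⟩ := ih
    refine ⟨_, _, hT.sz_mem _ (hT.sy_mem _ h1), ?_, ?_⟩
    · simp only [← hu, ← hv, sy_apply]
      rw [pow_succ', mul_assoc, ← e1]
      linear_combination ((y1 - u) + (l + m) * (z1 - v) + l * (z1 - v)) * hll
    · simp only [← hu, ← hv, sy_apply]
      rw [pow_succ', mul_assoc, ← e2]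
      linear_combination ((y1 - u) + (l + m) * (z1 - v) + m * (z1 - v)) * hll

/-- In a finite set two iterates coincide. If l is not a root of unity, this kills both eigenforms,
and the point is the centre of its slice. -/
theorem IsInvariant.isFiniteOrderTrace_or_fixed {A B C : ℂ} {T : Set (ℂ × ℂ × ℂ)}
    (hT : IsInvariant A B C T) (hfin : T.Finite) {q : ℂ × ℂ × ℂ} (hq : q ∈ T) :
    IsFiniteOrderTrace q.1 ∨ (sy B q = q ∧ sz C q = q) := by
  rcases hT.isElliptic_or_fixed hfin.isBounded hq with hell | h
  swap
  · exact Or.inr h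
  by_contra! hcon
  obtain ⟨hrat, hfix⟩ := hcon
  obtain ⟨x, y, z⟩ := q
  have hx2 : x ^ 2 ≠ 4 := by
    obtain ⟨t, ht, h⟩ := hell
    simp only at h
    rw [h]
    intro h4
    norm_cast at h4
    nlinarith [ht.1, ht.2]
  obtain ⟨l, hl0, -, hxl⟩ := exists_add_inv_eq x
  have hll : l * l⁻¹ = 1 := mul_inv_cancel₀ hl0
  have hx4 : 4 - x ^ 2 ≠ 0 := fun h => hx2 (by linear_combination -h)
  obtain ⟨u, v, hu, hv⟩ : ∃ u v, 2 * u + x * v = B ∧ 2 * v + x * u = C :=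
    ⟨(2 * B - x * C) / (4 - x ^ 2), (2 * C - x * B) / (4 - x ^ 2), by field_simp; ring,
      by field_simp; ring⟩
  have hl2 : l ^ 2 ≠ 1 := by
    intro h
    apply hx2
    rw [hxl]
    have : l⁻¹ ^ 2 = 1 := by rw [inv_pow, h, inv_one]
    linear_combination h + this + 2 * hll
  have key := exists_mem_sz_sy_iterate' hT hl0 hxl hu hv hq
  have aux : ∀ w p : ℂ, (∀ k : ℕ, ∃ q ∈ T, (q.2.1 - u) + w * (q.2.2 - v) = (w ^ 2) ^ k * p) →
      (w ≠ 0) → (∀ n : ℕ, 0 < n → w ^ n ≠ 1) → p = 0 := by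
    intro w p h hw0 hw
    by_contra hp
    choose f hf hf' using h
    obtain ⟨i, j, hij, he⟩ := Set.Finite.exists_lt_map_eq_of_forall_mem (f := f) hf hfin
    have h1 : (w ^ 2) ^ i * p = (w ^ 2) ^ j * p := by rw [← hf' i, ← hf' j, he]
    have h2 := mul_right_cancel₀ hp h1
    apply hw (2 * (j - i)) (by omega)
    rw [pow_mul]
    have h3 : (w ^ 2) ^ i * (w ^ 2) ^ (j - i) = (w ^ 2) ^ i * 1 := by
      rw [← pow_add, Nat.add_sub_cancel' hij.le, mul_one, h2]
    exact mul_left_cancel₀ (pow_ne_zero _ (pow_ne_zero _ hw0)) h3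
  have hln : ∀ n : ℕ, 0 < n → l ^ n ≠ 1 := fun n hn h => hrat ⟨l, n, hn, h, hl2, hxl⟩
  have p1 : (y - u) + l * (z - v) = 0 := by
    refine aux l _ (fun k => ?_) hl0 hln
    obtain ⟨y', z', hm, e, -⟩ := key k
    exact ⟨_, hm, e⟩
  have p2 : (y - u) + l⁻¹ * (z - v) = 0 := by
    refine aux l⁻¹ _ (fun k => ?_) (inv_ne_zero hl0) fun n hn h => hln n hn ?_
    · obtain ⟨y', z', hm, -, e⟩ := key k
      exact ⟨_, hm, e⟩
    · rwa [inv_pow, inv_eq_one] at h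
  have hne : l - l⁻¹ ≠ 0 := by
    intro h0
    apply hl2
    linear_combination l * h0 + hll
  have p3 : (l - l⁻¹) * (z - v) = 0 := by linear_combination p1 - p2
  have hz0 : z - v = 0 := (mul_eq_zero.1 p3).resolve_left hne
  have hy0 : y - u = 0 := by linear_combination p1 - l * hz0
  refine hfix ?_ ?_
  · simp only [sy_apply, Prod.mk.injEq, true_and, and_true]
    linear_combination -hu - 2 * hy0 - x * hz0
  · simp only [sz_apply, Prod.mk.injEq, true_and]
    linear_combination -hv - 2 * hz0 - x * hy0

theorem IsInvariant.controlled_of_finite {A B C : ℂ} {T : Set (ℂ × ℂ × ℂ)}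
    (hT : IsInvariant A B C T) (hfin : T.Finite) : Controlled A B C IsFiniteOrderTrace T := by
  have hrot : ∀ T : Set (ℂ × ℂ × ℂ), T.Finite → (CantatLoray.rot ⁻¹' T).Finite := fun T h =>
    h.preimage rot_injective.injOn
  exact controlled_of_rot (fun q hq => hT.isFiniteOrderTrace_or_fixed hfin hq)
    (fun q hq => hT.rot.isFiniteOrderTrace_or_fixed (hrot _ hfin) hq)
    (fun q hq => hT.rot.rot.isFiniteOrderTrace_or_fixed (hrot _ (hrot _ hfin)) hq)

theorem isAlgebraic_of_pow_eq_one {ζ : ℂ} {n : ℕ} (hn : 0 < n) (h : ζ ^ n = 1) :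
    IsAlgebraic ℚ ζ :=
  IsAlgebraic.of_pow hn (by rw [h]; exact isAlgebraic_one)

theorem IsFiniteOrderTrace.isAlgebraic {w : ℂ} (h : IsFiniteOrderTrace w) : IsAlgebraic ℚ w := by
  obtain ⟨ζ, n, hn, h, -, rfl⟩ := h
  have := isAlgebraic_of_pow_eq_one hn h
  exact this.add this.inv

/-! ### The discriminant of the slices -/

/-- Up to a positive factor, the discriminant of the slice of the surface at `x`. -/
def sliceDisc {R : Type*} [CommRing R] (A B C D x : R) : R :=
  (D + A * x - x ^ 2) * (4 - x ^ 2) + B ^ 2 + C ^ 2 - x * B * C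

/-- At a point of the slice the discriminant is a quadratic form in the partial derivatives along y
and z. For real x in (-2, 2) the form is positive definite, so it vanishes exactly where `sy` and
`sz` both fix the point. -/
theorem sliceDisc_eq {R : Type*} [CommRing R] {A B C D x y z : R}
    (h : (x, y, z) ∈ surface A B C D) :
    sliceDisc A B C D x = (2 * y + x * z - B) ^ 2 + (2 * z + x * y - C) ^ 2
      - x * (2 * y + x * z - B) * (2 * z + x * y - C) := by
  simp only [surface, mem_ofPred_eq] at h
  unfold sliceDisc
  linear_combination -(4 - x ^ 2) * h

/-- Take moments of the second coordinate over n iterates. The first moment is the centre u, which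
is therefore bounded by M. In the second moment the powers of ζ⁴ and ζ⁻⁴ cancel, which is why ζ⁴ ≠ 1
is required, and a multiple of the product pp' of the two eigenforms remains. This gives |pp'| ≤
2M²|4 - x²|, while P(x) = (4 - x²)pp'. -/
theorem norm_sliceDisc_le {A B C D : ℂ} {T : Set (ℂ × ℂ × ℂ)} (hT : IsInvariant A B C T)
    {x y z ζ : ℂ} {n : ℕ} (hn : 0 < n) (hζ : ζ ^ n = 1) (hζ4 : ζ ^ 4 ≠ 1) (hx : x = ζ + ζ⁻¹)
    (hq : (x, y, z) ∈ T) (hS : (x, y, z) ∈ surface A B C D) {M : ℝ}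
    (hM : ∀ q ∈ T, ‖q.2.1‖ ≤ M) :
    x ^ 2 ≠ 4 ∧ ‖sliceDisc A B C D x‖ ≤ 2 * M ^ 2 * ‖4 - x ^ 2‖ ^ 2 := by
  have hζ0 : ζ ≠ 0 := by
    rintro rfl
    rw [zero_pow hn.ne'] at hζ
    exact zero_ne_one hζ
  have hll : ζ * ζ⁻¹ = 1 := mul_inv_cancel₀ hζ0
  have hζ2 : ζ ^ 2 ≠ 1 := fun h => hζ4 (by rw [show 4 = 2 * 2 from rfl, pow_mul, h, one_pow])
  have hx2 : x ^ 2 ≠ 4 := by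
    intro h
    have h1 : (ζ - ζ⁻¹) ^ 2 = 0 := by rw [hx] at h; linear_combination h - 4 * hll
    have h2 : ζ - ζ⁻¹ = 0 := pow_eq_zero_iff two_ne_zero |>.1 h1
    exact hζ2 (by linear_combination ζ * h2 + hll)
  refine ⟨hx2, ?_⟩
  have hx4 : 4 - x ^ 2 ≠ 0 := fun h => hx2 (by linear_combination -h)
  obtain ⟨u, v, hu, hv⟩ : ∃ u v, 2 * u + x * v = B ∧ 2 * v + x * u = C :=
    ⟨(2 * B - x * C) / (4 - x ^ 2), (2 * C - x * B) / (4 - x ^ 2), by field_simp; ring,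
      by field_simp; ring⟩
  choose Y Z hmem e1 e2 using exists_mem_sz_sy_iterate' hT hζ0 hx hu hv hq
  set p := (y - u) + ζ * (z - v) with hp
  set p' := (y - u) + ζ⁻¹ * (z - v) with hp'
  have hn0 : (n : ℂ) ≠ 0 := Nat.cast_ne_zero.2 hn.ne'
  have geom : ∀ w : ℂ, w ≠ 1 → w ^ n = 1 → ∑ k ∈ Finset.range n, w ^ k = 0 := by
    intro w hw1 hwn
    have h := geom_sum_mul w n
    rw [hwn, sub_self] at h
    exact (mul_eq_zero.1 h).resolve_right (sub_ne_zero.2 hw1)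
  have hinv : ∀ j : ℕ, ζ ^ j ≠ 1 → (ζ⁻¹) ^ j ≠ 1 := fun j h h' =>
    h (by rwa [inv_pow, inv_eq_one] at h')
  have hinvn : (ζ⁻¹) ^ n = 1 := by rw [inv_pow, hζ, inv_one]
  have s1 := geom (ζ ^ 2) hζ2 (by rw [← pow_mul, mul_comm, pow_mul, hζ, one_pow])
  have s2 := geom (ζ⁻¹ ^ 2) (hinv 2 hζ2) (by rw [← pow_mul, mul_comm, pow_mul, hinvn, one_pow])
  have s3 := geom (ζ ^ 4) hζ4 (by rw [← pow_mul, mul_comm, pow_mul, hζ, one_pow])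
  have s4 := geom (ζ⁻¹ ^ 4) (hinv 4 hζ4) (by rw [← pow_mul, mul_comm, pow_mul, hinvn, one_pow])
  have hY : ∀ k, (ζ⁻¹ - ζ) * (Y k - u) = ζ⁻¹ * p * (ζ ^ 2) ^ k - ζ * p' * (ζ⁻¹ ^ 2) ^ k := by
    intro k
    linear_combination ζ⁻¹ * e1 k - ζ * e2 k
  have hne : ζ⁻¹ - ζ ≠ 0 := fun h => hζ2 (by linear_combination hll - ζ * h)
  have hsum1 : ∑ k ∈ Finset.range n, (Y k - u) = 0 := by
    have : (ζ⁻¹ - ζ) * ∑ k ∈ Finset.range n, (Y k - u) = 0 := by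
      rw [Finset.mul_sum, Finset.sum_congr rfl fun k _ => hY k, Finset.sum_sub_distrib,
        ← Finset.mul_sum, ← Finset.mul_sum, s1, s2]
      ring
    exact (mul_eq_zero.1 this).resolve_left hne
  have hsq : ∀ k, (x ^ 2 - 4) * (Y k - u) ^ 2
      = ζ⁻¹ ^ 2 * p ^ 2 * (ζ ^ 4) ^ k + ζ ^ 2 * p' ^ 2 * (ζ⁻¹ ^ 4) ^ k - 2 * (p * p') := by
    intro k
    have h1 : (ζ ^ 2) ^ k * (ζ⁻¹ ^ 2) ^ k = 1 := by
      rw [← mul_pow, ← mul_pow, hll, one_pow, one_pow]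
    have h2 : (ζ ^ 4) ^ k = (ζ ^ 2) ^ k * (ζ ^ 2) ^ k := by rw [← mul_pow]; ring
    have h3 : (ζ⁻¹ ^ 4) ^ k = (ζ⁻¹ ^ 2) ^ k * (ζ⁻¹ ^ 2) ^ k := by rw [← mul_pow]; ring
    have h4 : x ^ 2 - 4 = (ζ⁻¹ - ζ) ^ 2 := by rw [hx]; linear_combination 4 * hll
    rw [h2, h3, h4, ← mul_pow, hY k]
    linear_combination -2 * p * p' * ζ * ζ⁻¹ * h1 - 2 * p * p' * hll
  have hsum2 : (x ^ 2 - 4) * ∑ k ∈ Finset.range n, (Y k - u) ^ 2 = - 2 * n * (p * p') := by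
    rw [Finset.mul_sum, Finset.sum_congr rfl fun k _ => hsq k, Finset.sum_sub_distrib,
      Finset.sum_add_distrib, ← Finset.mul_sum, ← Finset.mul_sum, s3, s4]
    simp
    ring
  have hP : sliceDisc A B C D x = (4 - x ^ 2) * (p * p') := by
    have h1 : p * p' = (y - u) ^ 2 + (z - v) ^ 2 + x * (y - u) * (z - v) := by
      rw [hp, hp', hx]
      linear_combination (z - v) ^ 2 * hll
    rw [h1, sliceDisc_eq hS, ← hu, ← hv]
    ring
  have hY1 : ∀ k, ‖Y k‖ ≤ M := fun k => hM _ (hmem k)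
  have hun : ‖u‖ ≤ M := by
    have h1 : ∑ k ∈ Finset.range n, Y k = n * u := by
      rw [Finset.sum_sub_distrib] at hsum1
      simpa [sub_eq_zero] using hsum1
    have h2 : ‖∑ k ∈ Finset.range n, Y k‖ ≤ n * M := by
      refine (norm_sum_le_of_le _ fun k _ => hY1 k).trans ?_
      simp
    rw [h1, norm_mul, Complex.norm_natCast] at h2
    exact le_of_mul_le_mul_left h2 (by exact_mod_cast hn)
  have hM0 : 0 ≤ M := (norm_nonneg _).trans hun
  have hbound : ‖∑ k ∈ Finset.range n, (Y k - u) ^ 2‖ ≤ n * (4 * M ^ 2) := by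
    refine (norm_sum_le_of_le (f := fun k => (Y k - u) ^ 2) (n := fun _ => 4 * M ^ 2) _
      fun k _ => ?_).trans ?_
    · rw [norm_pow]
      have : ‖Y k - u‖ ≤ 2 * M := (norm_sub_le _ _).trans (by linarith [hY1 k])
      nlinarith [norm_nonneg (Y k - u)]
    · simp
  have hpp : ‖p * p'‖ ≤ 2 * M ^ 2 * ‖4 - x ^ 2‖ := by
    have h1 := congrArg norm hsum2
    rw [norm_mul, norm_mul, norm_mul, Complex.norm_natCast, norm_sub_rev (x ^ 2)] at h1
    have hn' : (0 : ℝ) < n := by exact_mod_cast hn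
    have h2 : ‖(-2 : ℂ)‖ = 2 := by simp
    rw [h2] at h1
    have h3 := mul_le_mul_of_nonneg_left hbound (norm_nonneg (4 - x ^ 2))
    rw [h1] at h3
    have h4 : n * ‖p * p'‖ ≤ n * (2 * M ^ 2 * ‖4 - x ^ 2‖) := by linarith
    exact le_of_mul_le_mul_left h4 hn'
  rw [hP, norm_mul]
  nlinarith [norm_nonneg (4 - x ^ 2)]


/-! ### Galois conjugation of orbits -/

/-- The field of algebraic numbers. -/
local notation "ℚbar" => algebraicClosure ℚ ℂ

instance isAlgebraic_algebraicClosure : Algebra.IsAlgebraic ℚ ℚbar := by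
  have := algebraicClosure.isAlgebraic ℚ ℂ
  convert this
  · rfl
  · exact Subsingleton.elim _ _

/-- The cyclotomic polynomial is the minimal polynomial of ζ over ℚ, so every primitive m-th root of
unity is the image of ζ under some embedding. -/
theorem exists_conjugate_root {m : ℕ} (hm : 0 < m) {ζ : ℚbar} (hζ : IsPrimitiveRoot ζ m) :
    ∃ τ : ℚbar →ₐ[ℚ] ℂ, τ ζ = Complex.exp (2 * Real.pi * Complex.I / m) := by
  have h1 : Complex.exp (2 * Real.pi * Complex.I / m) ∈ (minpoly ℚ ζ).rootSet ℂ := by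
    rw [← Polynomial.cyclotomic_eq_minpoly_rat hζ hm, Polynomial.mem_rootSet]
    refine ⟨Polynomial.cyclotomic_ne_zero m ℚ, ?_⟩
    rw [← Polynomial.eval_map_algebraMap, Polynomial.map_cyclotomic]
    exact (Complex.isPrimitiveRoot_exp m hm.ne').isRoot_cyclotomic hm
  rw [← Algebra.IsAlgebraic.range_eval_eq_rootSet_minpoly] at h1
  exact h1

theorem finite_conjugates (a : ℚbar) : (Set.range fun τ : ℚbar →ₐ[ℚ] ℂ => τ a).Finite := by
  rw [Algebra.IsAlgebraic.range_eval_eq_rootSet_minpoly]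
  exact Polynomial.rootSet_finite _ _

/-- The image of the algebraic points of `T` under an embedding of the algebraic numbers. -/
def conjugateSet (τ : ℚbar →ₐ[ℚ] ℂ) (T : Set (ℂ × ℂ × ℂ)) : Set (ℂ × ℂ × ℂ) :=
  {q | ∃ x y z : ℚbar, ((x : ℂ), (y : ℂ), (z : ℂ)) ∈ T ∧ q = (τ x, τ y, τ z)}

theorem IsInvariant.conjugateSet {A B C : ℚbar} {T : Set (ℂ × ℂ × ℂ)}
    (hT : IsInvariant (A : ℂ) (B : ℂ) (C : ℂ) T) (τ : ℚbar →ₐ[ℚ] ℂ) :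
    IsInvariant (τ A) (τ B) (τ C) (conjugateSet τ T) where
  sx_mem := by
    rintro _ ⟨x, y, z, h, rfl⟩
    exact ⟨A - x - y * z, y, z, by simpa [sx_apply] using hT.sx_mem _ h, by simp [sx_apply]⟩
  sy_mem := by
    rintro _ ⟨x, y, z, h, rfl⟩
    exact ⟨x, B - y - x * z, z, by simpa [sy_apply] using hT.sy_mem _ h, by simp [sy_apply]⟩
  sz_mem := by
    rintro _ ⟨x, y, z, h, rfl⟩
    exact ⟨x, y, C - z - x * y, by simpa [sz_apply] using hT.sz_mem _ h, by simp [sz_apply]⟩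

theorem conjugateSet_subset_surface {A B C D : ℚbar} {T : Set (ℂ × ℂ × ℂ)}
    (hT : T ⊆ surface (A : ℂ) (B : ℂ) (C : ℂ) (D : ℂ)) (τ : ℚbar →ₐ[ℚ] ℂ) :
    conjugateSet τ T ⊆ surface (τ A) (τ B) (τ C) (τ D) := by
  rintro _ ⟨x, y, z, h, rfl⟩
  have h1 := hT h
  simp only [surface, mem_ofPred_eq] at h1 ⊢
  norm_cast at h1
  have := congrArg τ h1
  simpa using this

theorem IsFiniteOrderTrace.norm_conjugate_le {x : ℚbar} (h : IsFiniteOrderTrace (x : ℂ))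
    (τ : ℚbar →ₐ[ℚ] ℂ) : ‖τ x‖ ≤ 2 := by
  obtain ⟨ζ, n, hn, hζ, -, hx⟩ := h
  let ζ' : ℚbar := ⟨ζ, mem_algebraicClosure_iff.2 (isAlgebraic_of_pow_eq_one hn hζ)⟩
  have hζ' : ζ' ^ n = 1 := Subtype.ext (by simpa [ζ'] using hζ)
  have hx' : x = ζ' + ζ'⁻¹ := Subtype.ext (by simpa [ζ'] using hx)
  have h1 : ‖τ ζ'‖ = 1 := by
    have := congrArg (fun t => ‖τ t‖) hζ'
    simp only [map_pow, norm_pow, map_one, norm_one] at this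
    exact (pow_eq_one_iff_of_nonneg (norm_nonneg _) hn.ne').1 this
  rw [hx', map_add, map_inv₀]
  refine (norm_add_le _ _).trans ?_
  rw [norm_inv, h1]
  norm_num

/-- A second coordinate y that is not ζ + ζ⁻¹ can be written B - y' - zx with y', z, x all of that
form. Their conjugates have norm at most 2, and 6 = 2 + 2 · 2. The bound depends on τ only through τ
B. -/
theorem IsLong.norm_snd_conjugateSet_le {A B C : ℚbar} {T : Set (ℂ × ℂ × ℂ)}
    (hT : IsLong (A : ℂ) (B : ℂ) (C : ℂ) T)
    (hc : Controlled (A : ℂ) (B : ℂ) (C : ℂ) IsFiniteOrderTrace T) (τ : ℚbar →ₐ[ℚ] ℂ) :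
    ∀ q ∈ conjugateSet τ T, ‖q.2.1‖ ≤ ‖τ B‖ + 6 := by
  rintro _ ⟨x, y, z, h, rfl⟩
  simp only
  by_cases hy : IsFiniteOrderTrace (y : ℂ)
  · linarith [hy.norm_conjugate_le τ, norm_nonneg (τ B)]
  · obtain ⟨h1, h2, h3⟩ := hT.rot.good_of_not_good hc.rot (q := ((y : ℂ), (z : ℂ), (x : ℂ))) h hy
    simp only at h1 h2 h3
    have h3' : IsFiniteOrderTrace ((B - y - z * x : ℚbar) : ℂ) := by simpa using h3
    have h4 := h3'.norm_conjugate_le τ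
    have h5 : τ y = τ B - τ (B - y - z * x) - τ z * τ x := by
      simp only [map_sub, map_mul]; ring
    rw [h5]
    refine (norm_sub_le _ _).trans ?_
    rw [norm_mul]
    have h6 := norm_sub_le (τ B) (τ (B - y - z * x))
    have h7 := h1.norm_conjugate_le τ
    have h8 := h2.norm_conjugate_le τ
    nlinarith [norm_nonneg (τ z), norm_nonneg (τ x)]

theorem finite_roots_of_unity_le (N : ℕ) : {w : ℂ | ∃ k, 0 < k ∧ k ≤ N ∧ w ^ k = 1}.Finite := by
  have : {w : ℂ | ∃ k, 0 < k ∧ k ≤ N ∧ w ^ k = 1}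
      ⊆ ⋃ k ∈ Finset.Icc 1 N, {w : ℂ | w ^ k = 1} := by
    rintro w ⟨k, h0, hN, h⟩
    simp only [mem_iUnion]
    exact ⟨k, Finset.mem_Icc.2 ⟨h0, hN⟩, h⟩
  refine Set.Finite.subset (Set.Finite.biUnion (Finset.finite_toSet _) fun k hk => ?_) this
  have hk0 : 0 < k := (Finset.mem_Icc.1 hk).1
  refine (Polynomial.nthRoots k (1 : ℂ)).toFinset.finite_toSet.subset fun w hw => ?_
  simpa [Polynomial.mem_nthRoots hk0] using hw

theorem tendsto_exp_two_pi_div {f : ℕ → ℕ} (hf : Tendsto f atTop atTop) :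
    Tendsto (fun j => Complex.exp (2 * Real.pi * Complex.I / (f j : ℂ))) atTop (𝓝 1) := by
  have h1 : Tendsto (fun j => (2 * Real.pi * Complex.I / (f j : ℂ))) atTop (𝓝 0) :=
    (tendsto_const_div_atTop_nhds_zero_nat (2 * Real.pi * Complex.I)).comp hf
  simpa [Function.comp_def] using (Complex.continuous_exp.tendsto 0).comp h1

/-- Infinitely many values ζ + ζ⁻¹ make the order m of eζ unbounded. An embedding that sends eζ to
exp(2πi/m) sends x to 2τ(e)cos(2π/m), which approaches 2τ(e) as m grows, and `norm_sliceDisc_le`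
applies to the conjugated orbit. -/
theorem IsLong.exists_conjugate_sliceDisc_bound {A B C D : ℚbar} {T : Set (ℂ × ℂ × ℂ)}
    (hT : IsLong (A : ℂ) (B : ℂ) (C : ℂ) T) (hS : T ⊆ surface (A : ℂ) (B : ℂ) (C : ℂ) (D : ℂ))
    (hc : Controlled (A : ℂ) (B : ℂ) (C : ℂ) IsFiniteOrderTrace T)
    (hinf : {x : ℂ | IsFiniteOrderTrace x ∧ ∃ q ∈ T, q.1 = x}.Infinite) {e : ℚbar}
    (he : e ^ 2 = 1) :
    ∃ τ : ℚbar →ₐ[ℚ] ℂ, ∃ M : ℝ, ∃ x : ℕ → ℂ, Tendsto x atTop (𝓝 (2 * τ e)) ∧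
      ∀ j, x j ^ 2 ≠ 4 ∧
        ‖sliceDisc (τ A) (τ B) (τ C) (τ D) (x j)‖ ≤ M * ‖4 - x j ^ 2‖ ^ 2 := by
  have he0 : e ≠ 0 := by rintro rfl; norm_num at he
  have heC : (e : ℂ) ^ 2 = 1 := by exact_mod_cast he
  have hcoord : ∀ q ∈ T, IsAlgebraic ℚ q.1 ∧ IsAlgebraic ℚ q.2.1 ∧ IsAlgebraic ℚ q.2.2 := by
    intro q hq
    have := hT.coord_mem hc (ℚbar).toSubfield
      (fun t ht => mem_algebraicClosure_iff.2 ht.isAlgebraic) hq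
    exact ⟨mem_algebraicClosure_iff.1 this.1, mem_algebraicClosure_iff.1 this.2.1,
      mem_algebraicClosure_iff.1 this.2.2⟩
  -- orders are unbounded
  have step : ∀ N : ℕ, ∃ τ : ℚbar →ₐ[ℚ] ℂ, ∃ m > N, ∃ x : ℂ,
      x = τ e * (Complex.exp (2 * Real.pi * Complex.I / m)
        + (Complex.exp (2 * Real.pi * Complex.I / m))⁻¹) ∧
      x ^ 2 ≠ 4 ∧
      ‖sliceDisc (τ A) (τ B) (τ C) (τ D) x‖ ≤ 2 * (‖τ B‖ + 6) ^ 2 * ‖4 - x ^ 2‖ ^ 2 := by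
    intro N
    -- The margin 4 guarantees (eζ)⁴ ≠ 1, hence ζ⁴ ≠ 1, as the second moment requires.
    have hfin := ((finite_roots_of_unity_le (N + 4)).image
      fun w : ℂ => (e : ℂ)⁻¹ * w + ((e : ℂ)⁻¹ * w)⁻¹)
    obtain ⟨x, ⟨⟨ζ, n, hn, hζ, hζ2, hx⟩, q, hq, hqx⟩, hxN⟩ := hinf.exists_notMem_finite hfin
    have heC0 : (e : ℂ) ≠ 0 := fun h => by rw [h] at heC; norm_num at heC
    have hxN' : ∀ k, 0 < k → k ≤ N + 4 → ((e : ℂ) * ζ) ^ k ≠ 1 := by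
      intro k h0 hk h
      refine hxN ⟨(e : ℂ) * ζ, ⟨k, h0, hk, h⟩, ?_⟩
      simp only [inv_mul_cancel_left₀ heC0, hx]
    obtain ⟨hq1, hq2, hq3⟩ := hcoord q hq
    let ζ' : ℚbar := ⟨ζ, mem_algebraicClosure_iff.2 (isAlgebraic_of_pow_eq_one hn hζ)⟩
    have hζ' : ζ' ^ n = 1 := Subtype.ext (by simpa [ζ'] using hζ)
    have heζ : (e * ζ') ^ (2 * n) = 1 := by
      rw [mul_pow, pow_mul e, he, one_pow, mul_comm 2 n, pow_mul, hζ']; simp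
    have hfo : IsOfFinOrder (e * ζ') := isOfFinOrder_iff_pow_eq_one.2 ⟨2 * n, by omega, heζ⟩
    set m := orderOf (e * ζ') with hm
    have hm0 : 0 < m := hfo.orderOf_pos
    have hmN : N + 4 < m := by
      by_contra! hle
      refine hxN' m hm0 hle ?_
      have := congrArg (fun t : ℚbar => (t : ℂ)) (pow_orderOf_eq_one (e * ζ'))
      rw [← hm] at this
      exact this
    obtain ⟨τ, hτ⟩ := exists_conjugate_root hm0 (IsPrimitiveRoot.orderOf (e * ζ'))
    refine ⟨τ, m, by omega, ?_⟩
    have hτe : τ e * τ e = 1 := by rw [← map_mul, ← sq, he, map_one]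
    have hτe' : (τ e)⁻¹ = τ e := inv_eq_of_mul_eq_one_left hτe
    have hτζ : τ ζ' = τ e * Complex.exp (2 * Real.pi * Complex.I / m) := by
      rw [← hτ, map_mul, ← mul_assoc, hτe, one_mul]
    refine ⟨τ ζ' + (τ ζ')⁻¹, ?_, ?_⟩
    · rw [hτζ, mul_inv, hτe', mul_add]
    · have hTτ := hT.toIsInvariant.conjugateSet τ
      let y' : ℚbar := ⟨q.2.1, mem_algebraicClosure_iff.2 hq2⟩
      let z' : ℚbar := ⟨q.2.2, mem_algebraicClosure_iff.2 hq3⟩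
      have hmem : (τ ζ' + (τ ζ')⁻¹, τ y', τ z') ∈ conjugateSet τ T := by
        refine ⟨ζ' + ζ'⁻¹, y', z', ?_, by simp⟩
        convert hq using 1
        refine Prod.ext ?_ rfl
        simp [ζ', hqx, hx]
      refine norm_sliceDisc_le hTτ (n := n) hn (by rw [← map_pow, hζ', map_one]) ?_ rfl hmem
        (conjugateSet_subset_surface hS τ hmem) (hT.norm_snd_conjugateSet_le hc τ)
      intro h4
      refine hxN' 4 (by norm_num) (by omega) ?_
      have h5 : ζ' ^ 4 = 1 := RingHom.injective (τ : ℚbar →+* ℂ) (by simpa using h4)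
      have h6 : ζ ^ 4 = 1 := by
        have := congrArg (fun t : ℚbar => (t : ℂ)) h5
        simpa [ζ'] using this
      rw [mul_pow, h6, show 4 = 2 * 2 from rfl, pow_mul, heC]
      simp
  choose τ m hm x hx hx4 hbd using step
  -- The embedding varies with N, but the parameters have only finitely many conjugates: along a
  -- subsequence their images, and with them the bound, are constant.
  have hfin : (Set.range fun σ : ℚbar →ₐ[ℚ] ℂ => (σ A, σ B, σ C, σ D, σ e)).Finite := by
    refine ((finite_conjugates A).prod ((finite_conjugates B).prod ((finite_conjugates C).prod
      ((finite_conjugates D).prod (finite_conjugates e))))).subset ?_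
    rintro _ ⟨σ, rfl⟩
    exact ⟨⟨σ, rfl⟩, ⟨σ, rfl⟩, ⟨σ, rfl⟩, ⟨σ, rfl⟩, ⟨σ, rfl⟩⟩
  obtain ⟨t, ht⟩ : ∃ t, {N | ((τ N) A, (τ N) B, (τ N) C, (τ N) D, (τ N) e) = t}.Infinite := by
    by_contra! hcon
    refine Set.infinite_univ (α := ℕ) ?_
    have : (univ : Set ℕ) ⊆ ⋃ t ∈ (Set.range fun σ : ℚbar →ₐ[ℚ] ℂ => (σ A, σ B, σ C, σ D, σ e)),
        {N | ((τ N) A, (τ N) B, (τ N) C, (τ N) D, (τ N) e) = t} := by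
      intro N _
      simp only [mem_iUnion]
      exact ⟨_, ⟨τ N, rfl⟩, rfl⟩
    exact (hfin.biUnion fun t _ => hcon t).subset this
  obtain ⟨g, hg, hgt⟩ := Filter.extraction_of_frequently_atTop (Nat.frequently_atTop_iff_infinite.2 ht)
  have hgA : ∀ j, (τ (g j)) A = t.1 := fun j => congrArg (fun t => t.1) (hgt j)
  have hgB : ∀ j, (τ (g j)) B = t.2.1 := fun j => congrArg (fun t => t.2.1) (hgt j)
  have hgC : ∀ j, (τ (g j)) C = t.2.2.1 := fun j => congrArg (fun t => t.2.2.1) (hgt j)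
  have hgD : ∀ j, (τ (g j)) D = t.2.2.2.1 := fun j => congrArg (fun t => t.2.2.2.1) (hgt j)
  have hge : ∀ j, (τ (g j)) e = t.2.2.2.2 := fun j => congrArg (fun t => t.2.2.2.2) (hgt j)
  refine ⟨τ (g 0), 2 * (‖t.2.1‖ + 6) ^ 2, fun j => x (g j), ?_, fun j => ⟨hx4 _, ?_⟩⟩
  · have h1 : Tendsto (fun j => m (g j)) atTop atTop :=
      tendsto_atTop_mono (fun j => (hm (g j)).le) hg.tendsto_atTop
    have h2 := tendsto_exp_two_pi_div h1
    have h3 := (h2.add (h2.inv₀ one_ne_zero)).const_mul t.2.2.2.2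
    simp only [hx, hge]
    convert h3 using 2
    norm_num
    ring
  · have := hbd (g j)
    rw [hgA, hgB, hgC, hgD] at this
    rwa [hgA, hgB, hgC, hgD]

/-- For e = ±1 the discriminant at 2e is (B - eC)². Its vanishing for both signs gives B = C = 0.
Then P = (D + Ax - x²)(4 - x²), and dividing the bound by |4 - x²| before passing to the limit gives
D + 2eA = 4 for both signs. -/
theorem IsLong.eq_cayley_of_infinite_fst {A B C D : ℂ} {T : Set (ℂ × ℂ × ℂ)}
    (hT : IsLong A B C T) (hne : T.Nonempty) (hS : T ⊆ surface A B C D)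
    (hc : Controlled A B C IsFiniteOrderTrace T)
    (hinf : {x : ℂ | IsFiniteOrderTrace x ∧ ∃ q ∈ T, q.1 = x}.Infinite) :
    A = 0 ∧ B = 0 ∧ C = 0 ∧ D = 4 := by
  obtain ⟨q, hq⟩ := hne
  have hF : ∀ t, IsFiniteOrderTrace t → t ∈ (ℚbar).toSubfield :=
    fun t ht => mem_algebraicClosure_iff.2 ht.isAlgebraic
  obtain ⟨hx, hy, hz⟩ := hT.coord_mem hc _ hF hq
  obtain ⟨hA, hB, hC⟩ := hT.param_mem hc _ hF hq
  have hD : D ∈ (ℚbar).toSubfield := by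
    have h1 : D = q.1 ^ 2 + q.2.1 ^ 2 + q.2.2 ^ 2 + q.1 * q.2.1 * q.2.2
        - (A * q.1 + B * q.2.1 + C * q.2.2) := by
      have := hS hq
      simp only [surface, mem_ofPred_eq] at this
      linear_combination -this
    rw [h1]
    exact Subfield.sub_mem _ (Subfield.add_mem _ (Subfield.add_mem _ (Subfield.add_mem _
      (Subfield.pow_mem _ hx 2) (Subfield.pow_mem _ hy 2)) (Subfield.pow_mem _ hz 2))
      (Subfield.mul_mem _ (Subfield.mul_mem _ hx hy) hz))
      (Subfield.add_mem _ (Subfield.add_mem _ (Subfield.mul_mem _ hA hx)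
      (Subfield.mul_mem _ hB hy)) (Subfield.mul_mem _ hC hz))
  lift A to ℚbar using hA
  lift B to ℚbar using hB
  lift C to ℚbar using hC
  lift D to ℚbar using hD
  have key := fun e he => hT.exists_conjugate_sliceDisc_bound hS hc hinf (e := e) he
  have hBC : ∀ e : ℚbar, e ^ 2 = 1 → B = e * C := by
    intro e he
    obtain ⟨τ, M, x, hx, hbd⟩ := key e he
    have hτe : τ e ^ 2 = 1 := by rw [← map_pow, he, map_one]
    have h1 : Continuous fun x => sliceDisc (τ A) (τ B) (τ C) (τ D) x := by
      unfold sliceDisc; fun_prop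
    have h2 : Continuous fun x : ℂ => M * ‖4 - x ^ 2‖ ^ 2 := by fun_prop
    have h3 := le_of_tendsto_of_tendsto' ((h1.norm.tendsto _).comp hx) ((h2.tendsto _).comp hx)
      (fun j => (hbd j).2)
    rw [show (4 : ℂ) - (2 * τ e) ^ 2 = 0 by linear_combination -4 * hτe] at h3
    simp only [norm_zero, ne_eq, OfNat.ofNat_ne_zero, not_false_eq_true, zero_pow, mul_zero,
      norm_le_zero_iff] at h3
    have h4 : (τ B - τ e * τ C) ^ 2 = 0 := by
      rw [← h3, sliceDisc]
      linear_combination (4 * (τ D + τ A * (2 * τ e) - (2 * τ e) ^ 2) + τ C ^ 2) * hτe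
    have h5 : τ B = τ e * τ C := by
      rw [← sub_eq_zero]
      exact pow_eq_zero_iff two_ne_zero |>.1 h4
    exact (RingHom.injective (τ : ℚbar →+* ℂ)) (by simpa using h5)
  have e1 : B = C := by simpa using hBC 1 (by norm_num)
  have e2 : B = -C := by simpa using hBC (-1) (by norm_num)
  have hC0 : C = 0 := by
    have h3 : (2 : ℚbar) * C = 0 := by linear_combination e2 - e1
    simpa using h3
  have hB0 : B = 0 := by rw [e1, hC0]
  have hAD : ∀ e : ℚbar, e ^ 2 = 1 → D + 2 * e * A = 4 := by
    intro e he
    obtain ⟨τ, M, x, hx, hbd⟩ := key e he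
    have hτe : τ e ^ 2 = 1 := by rw [← map_pow, he, map_one]
    have h1 : Continuous fun x => τ D + τ A * x - x ^ 2 := by fun_prop
    have h2 : Continuous fun x : ℂ => M * ‖4 - x ^ 2‖ := by fun_prop
    have h3 := le_of_tendsto_of_tendsto' ((h1.norm.tendsto _).comp hx) ((h2.tendsto _).comp hx)
      (fun j => by
        obtain ⟨h4, h5⟩ := hbd j
        have h6 : 0 < ‖4 - x j ^ 2‖ :=
          norm_pos_iff.2 fun h => h4 (by linear_combination -h)
        rw [hB0, hC0] at h5
        simp only [sliceDisc, map_zero] at h5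
        rw [show (τ D + τ A * x j - x j ^ 2) * (4 - x j ^ 2) + 0 ^ 2 + 0 ^ 2 - x j * 0 * 0
          = (τ D + τ A * x j - x j ^ 2) * (4 - x j ^ 2) by ring, norm_mul, sq ‖_‖, ← mul_assoc] at h5
        exact le_of_mul_le_mul_right h5 h6)
    rw [show (4 : ℂ) - (2 * τ e) ^ 2 = 0 by linear_combination -4 * hτe] at h3
    simp only [norm_zero, mul_zero, norm_le_zero_iff] at h3
    apply RingHom.injective (τ : ℚbar →+* ℂ)
    simp only [map_add, map_mul, map_ofNat, RingHom.coe_coe]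
    linear_combination h3 + 4 * hτe
  have e3 := hAD 1 (by norm_num)
  have e4 := hAD (-1) (by norm_num)
  have hA0 : A = 0 := by
    have h3 : (4 : ℚbar) * A = 0 := by linear_combination e3 - e4
    simpa using h3
  have hD4 : D = 4 := by rw [hA0] at e3; simpa using e3
  refine ⟨by simp [hA0], by simp [hB0], by simp [hC0], ?_⟩
  rw [hD4]
  rfl

/-- The orbits of the points of finite order on the Cayley cubic. -/
def cayleyTorsion (n : ℕ) : Set (ℂ × ℂ × ℂ) :=
  {q | ∃ ζ η : ℂ, ζ ^ n = 1 ∧ η ^ n = 1 ∧ q = (ζ + ζ⁻¹, η + η⁻¹, -(ζ * η + (ζ * η)⁻¹))}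

theorem finite_cayleyTorsion {n : ℕ} (hn : 0 < n) : (cayleyTorsion n).Finite := by
  have h : {w : ℂ | w ^ n = 1}.Finite :=
    (finite_roots_of_unity_le n).subset fun w hw => ⟨n, hn, le_rfl, hw⟩
  refine ((h.prod h).image fun p : ℂ × ℂ =>
    (p.1 + p.1⁻¹, p.2 + p.2⁻¹, -(p.1 * p.2 + (p.1 * p.2)⁻¹))).subset ?_
  rintro _ ⟨ζ, η, h1, h2, rfl⟩
  exact ⟨(ζ, η), ⟨h1, h2⟩, rfl⟩

/-- The Cayley cubic is the quotient of a two-dimensional torus by inversion, and the three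
involutions lift to monomial maps, which preserve n-torsion. -/
theorem isInvariant_cayleyTorsion {n : ℕ} (hn : 0 < n) : IsInvariant 0 0 0 (cayleyTorsion n) := by
  have h0 : ∀ {w : ℂ}, w ^ n = 1 → w ≠ 0 := by
    rintro w h rfl
    rw [zero_pow hn.ne'] at h
    exact zero_ne_one h
  refine ⟨?_, ?_, ?_⟩
  · rintro _ ⟨ζ, η, h1, h2, rfl⟩
    have := h0 h1
    have := h0 h2
    refine ⟨ζ * η ^ 2, η⁻¹, ?_, ?_, ?_⟩
    · rw [mul_pow, h1, ← pow_mul, mul_comm 2 n, pow_mul, h2]; simp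
    · rw [inv_pow, h2, inv_one]
    · simp only [sx_apply, Prod.mk.injEq]
      refine ⟨?_, ?_, ?_⟩ <;> field_simp <;> ring
  · rintro _ ⟨ζ, η, h1, h2, rfl⟩
    have := h0 h1
    have := h0 h2
    refine ⟨ζ⁻¹, η * ζ ^ 2, ?_, ?_, ?_⟩
    · rw [inv_pow, h1, inv_one]
    · rw [mul_pow, h2, ← pow_mul, mul_comm 2 n, pow_mul, h1]; simp
    · simp only [sy_apply, Prod.mk.injEq]
      refine ⟨?_, ?_, ?_⟩ <;> field_simp <;> ring
  · rintro _ ⟨ζ, η, h1, h2, rfl⟩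
    have := h0 h1
    have := h0 h2
    refine ⟨ζ, η⁻¹, h1, ?_, ?_⟩
    · rw [inv_pow, h2, inv_one]
    · simp only [sz_apply, Prod.mk.injEq]
      refine ⟨trivial, ?_, ?_⟩
      · rw [inv_inv, add_comm]
      · field_simp
        ring

theorem mem_cayleyTorsion {x y z : ℂ} (hx : IsFiniteOrderTrace x) (hy : IsFiniteOrderTrace y)
    (hS : (x, y, z) ∈ surface (0 : ℂ) 0 0 4) : ∃ n > 0, (x, y, z) ∈ cayleyTorsion n := by
  obtain ⟨ζ, n, hn, h1, -, rfl⟩ := hx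
  obtain ⟨η, m, hm, h2, -, rfl⟩ := hy
  have hζ : ζ ^ (n * m) = 1 := by rw [pow_mul, h1, one_pow]
  have hη : η ^ (n * m) = 1 := by rw [mul_comm, pow_mul, h2, one_pow]
  have hζ0 : ζ ≠ 0 := by rintro rfl; rw [zero_pow hn.ne'] at h1; exact zero_ne_one h1
  have hη0 : η ≠ 0 := by rintro rfl; rw [zero_pow hm.ne'] at h2; exact zero_ne_one h2
  refine ⟨n * m, by positivity, ?_⟩
  simp only [surface, mem_ofPred_eq] at hS
  -- For given x and y the equation is quadratic in z; its two roots correspond to η and η⁻¹.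
  have hf : (z + (ζ * η + (ζ * η)⁻¹)) * (z + (ζ * η⁻¹ + (ζ * η⁻¹)⁻¹)) = 0 := by
    have e1 : ζ * ζ⁻¹ = 1 := mul_inv_cancel₀ hζ0
    have e2 : η * η⁻¹ = 1 := mul_inv_cancel₀ hη0
    rw [mul_inv, mul_inv, inv_inv]
    linear_combination hS + (ζ ^ 2 + ζ⁻¹ ^ 2) * e2 + (η ^ 2 + η⁻¹ ^ 2) * e1 - 2 * e1 - 2 * e2
  rcases mul_eq_zero.1 hf with h | h
  · exact ⟨ζ, η, hζ, hη, by rw [eq_neg_of_add_eq_zero_left h]⟩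
  · refine ⟨ζ, η⁻¹, hζ, by rw [inv_pow, hη, inv_one], ?_⟩
    rw [eq_neg_of_add_eq_zero_left h, inv_inv, add_comm η]

/-- The first two coordinates determine a point of the surface up to `sz`. A point at which one of
these coordinates is not good is the image, under `sx` or `sy`, of a point where both are good. -/
theorem finite_of_finite_good {A B C D : ℂ} {T : Set (ℂ × ℂ × ℂ)} {good : ℂ → Prop}
    (hT : IsLong A B C T) (hS : T ⊆ surface A B C D) (hc : Controlled A B C good T)
    (h1 : {x : ℂ | good x ∧ ∃ q ∈ T, q.1 = x}.Finite)
    (h2 : {y : ℂ | good y ∧ ∃ q ∈ T, q.2.1 = y}.Finite) : T.Finite := by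
  set G := {q ∈ T | good q.1 ∧ good q.2.1} with hG
  have hGfin : G.Finite := by
    have : G ⊆ ⋃ x ∈ {x : ℂ | good x ∧ ∃ q ∈ T, q.1 = x},
        ⋃ y ∈ {y : ℂ | good y ∧ ∃ q ∈ T, q.2.1 = y}, {q ∈ T | q.1 = x ∧ q.2.1 = y} := by
      rintro q ⟨hq, hx, hy⟩
      simp only [mem_iUnion]
      exact ⟨q.1, ⟨hx, q, hq, rfl⟩, q.2.1, ⟨hy, q, hq, rfl⟩, hq, rfl, rfl⟩
    refine (h1.biUnion fun x _ => h2.biUnion fun y _ => ?_).subset this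
    rcases Set.eq_empty_or_nonempty {q ∈ T | q.1 = x ∧ q.2.1 = y} with h | ⟨q0, hq0, rfl, rfl⟩
    · rw [h]; exact Set.finite_empty
    · refine (Set.toFinite {q0, sz C q0}).subset ?_
      rintro ⟨x, y, z⟩ ⟨hq, e1, e2⟩
      simp only at e1 e2
      subst e1 e2
      have g1 := hS hq
      have g2 := hS hq0
      simp only [surface, mem_ofPred_eq] at g1 g2
      have : (z - q0.2.2) * (z - (C - q0.2.2 - q0.1 * q0.2.1)) = 0 := by
        linear_combination g1 - g2
      rcases mul_eq_zero.1 this with h | h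
      · left
        rw [sub_eq_zero.1 h]
      · right
        rw [sub_eq_zero.1 h]
        rfl
  refine ((hGfin.union (hGfin.image (sx A))).union (hGfin.image (sy B))).subset ?_
  intro q hq
  by_cases hx : good q.1
  · by_cases hy : good q.2.1
    · exact Or.inl (Or.inl ⟨hq, hx, hy⟩)
    · right
      obtain ⟨-, g1, g2⟩ := hT.rot.good_of_not_good hc.rot (q := (q.2.1, q.2.2, q.1)) hq hy
      refine ⟨sy B q, ⟨hT.sy_mem q hq, hx, ?_⟩, sy_sy B q⟩
      rw [sy_apply, mul_comm q.1]
      exact g2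
  · left; right
    obtain ⟨g1, -, g2⟩ := hT.good_of_not_good hc hq hx
    exact ⟨sx A q, ⟨hT.sx_mem q hq, g2, g1⟩, sx_sx A q⟩

/-- In an infinite bounded orbit, some coordinate is not the trace of a rotation of finite order,
at a point where it matters. -/
theorem not_controlled_of_infinite {A B C D : ℂ} {p : ℂ × ℂ × ℂ} (hp : p ∈ surface A B C D)
    (hinf : (orb A B C p).Infinite) : ¬ Controlled A B C IsFiniteOrderTrace (orb A B C p) := by
  intro hc
  have hT : IsLong A B C (orb A B C p) := IsLong.orb (by rw [hinf.encard_eq]; exact ENat.natCast_lt_top 4)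
  have hS := orb_subset_surface A B C D p hp
  have hcay : A = 0 ∧ B = 0 ∧ C = 0 ∧ D = 4 := by
    by_cases h1 : {x : ℂ | IsFiniteOrderTrace x ∧ ∃ q ∈ orb A B C p, q.1 = x}.Finite
    · by_cases h2 : {y : ℂ | IsFiniteOrderTrace y ∧ ∃ q ∈ orb A B C p, q.2.1 = y}.Finite
      · exact absurd (finite_of_finite_good hT hS hc h1 h2) hinf
      · have := hT.rot.eq_cayley_of_infinite_fst (D := D)
          ⟨(p.2.1, p.2.2, p.1), mem_orb_self A B C p⟩ (fun q hq => rot_mem_surface.1 (hS hq)) hc.rot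
          (Set.Infinite.mono ?_ h2)
        · tauto
        · rintro y ⟨hy, q, hq, rfl⟩
          exact ⟨hy, (q.2.1, q.2.2, q.1), hq, rfl⟩
    · exact hT.eq_cayley_of_infinite_fst ⟨p, mem_orb_self A B C p⟩ hS hc h1
  obtain ⟨rfl, rfl, rfl, rfl⟩ := hcay
  -- Such a q is a torsion point, so its orbit lies in a finite invariant set.
  obtain ⟨q, hq, hx, hy⟩ : ∃ q ∈ orb (0 : ℂ) 0 0 p, IsFiniteOrderTrace q.1 ∧
      IsFiniteOrderTrace q.2.1 := by
    have hp' := mem_orb_self (0 : ℂ) 0 0 p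
    by_cases hx : IsFiniteOrderTrace p.1
    · by_cases hy : IsFiniteOrderTrace p.2.1
      · exact ⟨p, hp', hx, hy⟩
      · obtain ⟨-, g1, g2⟩ := hT.rot.good_of_not_good hc.rot (q := (p.2.1, p.2.2, p.1)) hp' hy
        refine ⟨sy 0 p, hT.sy_mem p hp', hx, ?_⟩
        rw [sy_apply, mul_comm p.1]
        exact g2
    · obtain ⟨g1, -, g2⟩ := hT.good_of_not_good hc hp' hx
      exact ⟨sx 0 p, hT.sx_mem p hp', g2, g1⟩
  obtain ⟨n, hn, hmem⟩ := mem_cayleyTorsion hx hy (z := q.2.2) (hS hq)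
  obtain ⟨g, rfl⟩ := hq
  have h1 : orb (0 : ℂ) 0 0 (g • p) = orb 0 0 0 p := MulAction.orbit_smul g p
  exact hinf (h1 ▸ (finite_cayleyTorsion hn).subset ((isInvariant_cayleyTorsion hn).orb_subset hmem))


/-! ### Elliptic slices of the real surface -/

theorem toComplex_injective : Function.Injective toComplex := by
  rintro ⟨x, y, z⟩ ⟨x', y', z'⟩ h
  simpa [toComplex] using h

theorem continuous_toComplex : Continuous toComplex := by
  unfold toComplex; fun_prop

theorem toComplex_sx (A : ℝ) (q : ℝ × ℝ × ℝ) : toComplex (sx A q) = sx (A : ℂ) (toComplex q) := by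
  simp [toComplex, sx_apply]
theorem toComplex_sy (B : ℝ) (q : ℝ × ℝ × ℝ) : toComplex (sy B q) = sy (B : ℂ) (toComplex q) := by
  simp [toComplex, sy_apply]
theorem toComplex_sz (C : ℝ) (q : ℝ × ℝ × ℝ) : toComplex (sz C q) = sz (C : ℂ) (toComplex q) := by
  simp [toComplex, sz_apply]

theorem toComplex_mem_surface {A B C D : ℝ} {q : ℝ × ℝ × ℝ} :
    toComplex q ∈ surface (A : ℂ) (B : ℂ) (C : ℂ) (D : ℂ) ↔ q ∈ surface A B C D := by
  simp only [toComplex, surface, mem_ofPred_eq]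
  norm_cast

theorem IsInvariant.image_toComplex {A B C : ℝ} {K : Set (ℝ × ℝ × ℝ)} (hK : IsInvariant A B C K) :
    IsInvariant (A : ℂ) (B : ℂ) (C : ℂ) (toComplex '' K) where
  sx_mem := by
    rintro _ ⟨q, hq, rfl⟩
    exact ⟨_, hK.sx_mem q hq, toComplex_sx A q⟩
  sy_mem := by
    rintro _ ⟨q, hq, rfl⟩
    exact ⟨_, hK.sy_mem q hq, toComplex_sy B q⟩
  sz_mem := by
    rintro _ ⟨q, hq, rfl⟩
    exact ⟨_, hK.sz_mem q hq, toComplex_sz C q⟩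

theorem IsInvariant.mem_Ioo_or_fixed {A B C : ℝ} {K : Set (ℝ × ℝ × ℝ)} (hK : IsInvariant A B C K)
    (hb : IsCompact K) {q : ℝ × ℝ × ℝ} (hq : q ∈ K) :
    q.1 ∈ Ioo (-2) 2 ∨ (sy B q = q ∧ sz C q = q) := by
  rcases hK.image_toComplex.isElliptic_or_fixed (hb.image continuous_toComplex).isBounded
    (mem_image_of_mem _ hq) with ⟨t, ht, h⟩ | ⟨h1, h2⟩
  · left
    have : q.1 = t := by simpa [toComplex] using h
    rwa [this]
  · right
    rw [← toComplex_sy] at h1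
    rw [← toComplex_sz] at h2
    exact ⟨toComplex_injective h1, toComplex_injective h2⟩

section Slices

variable {A B C D : ℝ}

theorem fixed_iff {q : ℝ × ℝ × ℝ} : (sy B q = q ∧ sz C q = q) ↔
    2 * q.2.1 + q.1 * q.2.2 - B = 0 ∧ 2 * q.2.2 + q.1 * q.2.1 - C = 0 := by
  obtain ⟨x, y, z⟩ := q
  simp only [sy_apply, sz_apply, Prod.mk.injEq, true_and, and_true]
  constructor <;> rintro ⟨h1, h2⟩ <;> constructor <;> linarith

theorem four_sub_sq_pos {x : ℝ} (hx : x ∈ Ioo (-2 : ℝ) 2) : 0 < 4 - x ^ 2 := by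
  nlinarith [hx.1, hx.2]

theorem sliceDisc_nonneg {q : ℝ × ℝ × ℝ} (hq : q ∈ surface A B C D)
    (hx : q.1 ∈ Ioo (-2 : ℝ) 2) : 0 ≤ sliceDisc A B C D q.1 := by
  obtain ⟨x, y, z⟩ := q
  rw [sliceDisc_eq hq]
  have := four_sub_sq_pos hx
  simp only at this ⊢
  nlinarith [sq_nonneg ((2 * y + x * z - B) - x / 2 * (2 * z + x * y - C)),
    mul_nonneg this.le (sq_nonneg (2 * z + x * y - C))]

theorem sliceDisc_pos_iff {q : ℝ × ℝ × ℝ} (hq : q ∈ surface A B C D)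
    (hx : q.1 ∈ Ioo (-2 : ℝ) 2) :
    0 < sliceDisc A B C D q.1 ↔ ¬ (sy B q = q ∧ sz C q = q) := by
  rw [fixed_iff]
  obtain ⟨x, y, z⟩ := q
  have h4 := four_sub_sq_pos hx
  rw [sliceDisc_eq hq]
  simp only at h4 ⊢
  set u := 2 * y + x * z - B
  set v := 2 * z + x * y - C
  have key : u ^ 2 + v ^ 2 - x * u * v = (u - x / 2 * v) ^ 2 + (4 - x ^ 2) / 4 * v ^ 2 := by ring
  constructor
  · rintro h ⟨h1, h2⟩
    rw [h1, h2] at h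
    norm_num at h
  · intro h
    rw [key]
    by_contra hcon
    have h1 := sq_nonneg (u - x / 2 * v)
    have h2 : 0 ≤ (4 - x ^ 2) / 4 * v ^ 2 := by positivity
    have h3 : (4 - x ^ 2) / 4 * v ^ 2 = 0 := by linarith
    have h4 : v = 0 := by
      rcases mul_eq_zero.1 h3 with h | h
      · linarith
      · exact pow_eq_zero_iff two_ne_zero |>.1 h
    have h5 : (u - x / 2 * v) ^ 2 = 0 := by linarith
    have h6 := pow_eq_zero_iff two_ne_zero |>.1 h5
    exact h ⟨by rw [h4] at h6; linarith, h4⟩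

/-- The parametrization of the slice at `x` by an angle. -/
noncomputable def slicePoint (A B C D x θ : ℝ) : ℝ × ℝ × ℝ :=
  (x, (2 * B - x * C) / (4 - x ^ 2) + 2 * √(sliceDisc A B C D x) / (4 - x ^ 2) * Real.cos θ,
    (2 * C - x * B) / (4 - x ^ 2)
      - 2 * √(sliceDisc A B C D x) / (4 - x ^ 2) * Real.cos (θ + Real.arccos (x / 2)))

theorem cos_arccos_half {x : ℝ} (hx : x ∈ Ioo (-2 : ℝ) 2) :
    x = 2 * Real.cos (Real.arccos (x / 2)) := by
  rw [Real.cos_arccos (by linarith [hx.1]) (by linarith [hx.2])]; ring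

/-- With x = 2cos φ, centre (u, v) and amplitude ρ, the displacements ρcos θ and -ρcos(θ + φ)
satisfy Y² + Z² + xYZ = ρ²sin²φ, and this is the equation of the slice relative to its centre. -/
theorem slicePoint_mem {x θ : ℝ} (hx : x ∈ Ioo (-2 : ℝ) 2) (hP : 0 ≤ sliceDisc A B C D x) :
    slicePoint A B C D x θ ∈ surface A B C D := by
  have h4 := four_sub_sq_pos hx
  have hc := cos_arccos_half hx
  simp only [surface, slicePoint, mem_ofPred_eq]
  rw [Real.cos_add]
  have hsc := Real.sin_sq_add_cos_sq (Real.arccos (x / 2))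
  have hsc' := Real.sin_sq_add_cos_sq θ
  set c := Real.cos (Real.arccos (x / 2))
  set s := Real.sin (Real.arccos (x / 2))
  set c' := Real.cos θ
  set s' := Real.sin θ
  have hR := Real.sq_sqrt hP
  set R := √(sliceDisc A B C D x)
  have hs : 4 - x ^ 2 = 4 * s ^ 2 := by rw [hc]; linear_combination -4 * hsc
  obtain ⟨u, hu⟩ : ∃ u, u = (2 * B - x * C) / (4 - x ^ 2) := ⟨_, rfl⟩
  obtain ⟨v, hv⟩ : ∃ v, v = (2 * C - x * B) / (4 - x ^ 2) := ⟨_, rfl⟩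
  obtain ⟨ρ, hρ⟩ : ∃ ρ, ρ = 2 * R / (4 - x ^ 2) := ⟨_, rfl⟩
  rw [← hu, ← hv, ← hρ]
  have hu' : 2 * u + x * v = B := by rw [hu, hv]; field_simp; ring
  have hv' : 2 * v + x * u = C := by rw [hu, hv]; field_simp; ring
  have hρ' : ρ * (4 - x ^ 2) = 2 * R := by rw [hρ]; field_simp
  have hρ2 : ρ ^ 2 * (4 - x ^ 2) = 4 * (D + A * x - x ^ 2 + u ^ 2 + v ^ 2 + x * u * v) := by
    have h1 : ρ ^ 2 * (4 - x ^ 2) * (4 - x ^ 2)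
        = 4 * (D + A * x - x ^ 2 + u ^ 2 + v ^ 2 + x * u * v) * (4 - x ^ 2) := by
      calc _ = (ρ * (4 - x ^ 2)) ^ 2 := by ring
        _ = 4 * R ^ 2 := by rw [hρ']; ring
        _ = _ := by rw [hR, sliceDisc, ← hu', ← hv']; ring
    exact mul_right_cancel₀ h4.ne' h1
  rw [hs] at hρ2
  rw [← hu', ← hv']
  have hx2 : x = 2 * c := hc
  clear_value c s c' s' R
  subst hx2
  linear_combination hρ2 / 4 + ρ ^ 2 * s ^ 2 * hsc' - ρ ^ 2 * c' ^ 2 * hsc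

theorem exists_angle {a b : ℝ} (h : a ^ 2 + b ^ 2 = 1) : ∃ θ, Real.cos θ = a ∧ Real.sin θ = b := by
  have hn : ‖(⟨a, b⟩ : ℂ)‖ = 1 := by
    rw [Complex.norm_def, Complex.normSq_mk, ← sq, ← sq, h, Real.sqrt_one]
  have h0 : (⟨a, b⟩ : ℂ) ≠ 0 := by
    intro h0
    rw [h0, norm_zero] at hn
    exact zero_ne_one hn
  exact ⟨Complex.arg ⟨a, b⟩, by rw [Complex.cos_arg h0, hn]; simp, by rw [Complex.sin_arg, hn]; simp⟩

theorem exists_slicePoint {q : ℝ × ℝ × ℝ} (hq : q ∈ surface A B C D)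
    (hx : q.1 ∈ Ioo (-2 : ℝ) 2) : ∃ θ, slicePoint A B C D q.1 θ = q := by
  have hP := sliceDisc_nonneg hq hx
  have hS := sliceDisc_eq hq
  obtain ⟨x, y, z⟩ := q
  simp only at hx hP hS
  have h4 := four_sub_sq_pos hx
  have hc := cos_arccos_half hx
  have hR := Real.sq_sqrt hP
  have hsc := Real.sin_sq_add_cos_sq (Real.arccos (x / 2))
  simp only [slicePoint, Prod.mk.injEq, true_and, Real.cos_add]
  have hs0 : 0 ≤ Real.sin (Real.arccos (x / 2)) :=
    Real.sin_nonneg_of_nonneg_of_le_pi (Real.arccos_nonneg _) (Real.arccos_le_pi _)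
  set c := Real.cos (Real.arccos (x / 2))
  set s := Real.sin (Real.arccos (x / 2))
  set R := √(sliceDisc A B C D x)
  have hs : 4 - x ^ 2 = 4 * s ^ 2 := by rw [hc]; linear_combination -4 * hsc
  have hs1 : s ≠ 0 := by
    intro h
    rw [h] at hs
    norm_num at hs
    linarith
  obtain ⟨u, hu⟩ : ∃ u, u = (2 * B - x * C) / (4 - x ^ 2) := ⟨_, rfl⟩
  obtain ⟨v, hv⟩ : ∃ v, v = (2 * C - x * B) / (4 - x ^ 2) := ⟨_, rfl⟩
  obtain ⟨ρ, hρ⟩ : ∃ ρ, ρ = 2 * R / (4 - x ^ 2) := ⟨_, rfl⟩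
  rw [← hu, ← hv, ← hρ]
  have hu' : 2 * u + x * v = B := by rw [hu, hv]; field_simp; ring
  have hv' : 2 * v + x * u = C := by rw [hu, hv]; field_simp; ring
  have hρ' : ρ * (4 - x ^ 2) = 2 * R := by rw [hρ]; field_simp
  have hE : (y - u) ^ 2 + (z - v) ^ 2 + x * (y - u) * (z - v) = ρ ^ 2 * s ^ 2 := by
    have h1 : ((y - u) ^ 2 + (z - v) ^ 2 + x * (y - u) * (z - v)) * (4 - x ^ 2)
        = (ρ ^ 2 * s ^ 2) * (4 - x ^ 2) := by
      calc _ = R ^ 2 := by rw [hR, hS, ← hu', ← hv']; ring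
        _ = (ρ * (4 - x ^ 2)) ^ 2 / 4 := by rw [hρ']; ring
        _ = _ := by rw [hs]; ring
    exact mul_right_cancel₀ h4.ne' h1
  by_cases hρ0 : ρ = 0
  · refine ⟨0, ?_⟩
    rw [hρ0] at hE ⊢
    have h1 : ((y - u) + x / 2 * (z - v)) ^ 2 + s ^ 2 * (z - v) ^ 2 = 0 := by
      linear_combination hE - (z - v) ^ 2 / 4 * hs
    have h2 : s ^ 2 * (z - v) ^ 2 = 0 := by
      nlinarith [sq_nonneg ((y - u) + x / 2 * (z - v)),
      mul_nonneg (sq_nonneg s) (sq_nonneg (z - v))]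
    have h3 : z - v = 0 := by
      rcases mul_eq_zero.1 h2 with h | h
      · exact absurd (pow_eq_zero_iff two_ne_zero |>.1 h) hs1
      · exact pow_eq_zero_iff two_ne_zero |>.1 h
    rw [h3] at hE
    have h4 : y - u = 0 := by
      refine pow_eq_zero_iff two_ne_zero |>.1 (?_ : (y - u) ^ 2 = 0)
      linarith
    constructor <;> linarith
  · obtain ⟨θ, hθ1, hθ2⟩ := exists_angle (a := (y - u) / ρ)
      (b := ((z - v) / ρ + (y - u) / ρ * c) / s) (by
        field_simp
        rw [hc] at hE
        linear_combination hE + (y - u) ^ 2 * hsc)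
    refine ⟨θ, ?_, ?_⟩
    · rw [hθ1]; field_simp; ring
    · rw [hθ1, hθ2]; field_simp; ring

theorem sz_slicePoint {x θ : ℝ} (hx : x ∈ Ioo (-2 : ℝ) 2) :
    sz C (slicePoint A B C D x θ) = slicePoint A B C D x (-θ) := by
  have h4 := four_sub_sq_pos hx
  have hc := cos_arccos_half hx
  simp only [slicePoint, sz_apply, Prod.mk.injEq, true_and, Real.cos_neg, Real.cos_add,
    Real.sin_neg]
  set c := Real.cos (Real.arccos (x / 2))
  have hv : 2 * ((2 * C - x * B) / (4 - x ^ 2)) + x * ((2 * B - x * C) / (4 - x ^ 2)) = C := by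
    field_simp; ring
  have hx2 : x = 2 * c := hc
  linear_combination -hv - (2 * √(sliceDisc A B C D x) / (4 - x ^ 2) * Real.cos θ) * hx2

/-- In the angle θ, both `sy` and `sz` are reflections; their composition is the rotation by
2arccos(x/2). -/
theorem sy_slicePoint {x θ : ℝ} (hx : x ∈ Ioo (-2 : ℝ) 2) :
    sy B (slicePoint A B C D x θ)
      = slicePoint A B C D x (-(θ + 2 * Real.arccos (x / 2))) := by
  have h4 := four_sub_sq_pos hx
  have hc := cos_arccos_half hx
  simp only [slicePoint, sy_apply, Prod.mk.injEq, true_and]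
  set φ := Real.arccos (x / 2)
  have e1 : Real.cos (-(θ + 2 * φ)) = 2 * Real.cos φ * Real.cos (θ + φ) - Real.cos θ := by
    rw [Real.cos_neg, show θ + 2 * φ = (θ + φ) + φ by ring, show θ = (θ + φ) - φ by ring]
    rw [Real.cos_add, Real.cos_sub]
    ring_nf
  have e2 : Real.cos (-(θ + 2 * φ) + φ) = Real.cos (θ + φ) := by
    rw [← Real.cos_neg]; ring_nf
  have hu : 2 * ((2 * B - x * C) / (4 - x ^ 2)) + x * ((2 * C - x * B) / (4 - x ^ 2)) = B := by
    field_simp; ring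
  rw [e1, e2]
  refine ⟨?_, rfl⟩
  linear_combination -hu + (2 * √(sliceDisc A B C D x) / (4 - x ^ 2) * Real.cos (θ + φ)) * hc

/-! ### Irrational slices -/

theorem irrational_arccos {x : ℝ} (hx : x ∈ Ioo (-2 : ℝ) 2) (hirr : ¬ IsFiniteOrderTrace (x : ℂ)) :
    Irrational (2 * Real.arccos (x / 2) / (2 * Real.pi)) := by
  rintro ⟨r, hr⟩
  apply hirr
  have hφ : Real.arccos (x / 2) = r * Real.pi := by
    rw [hr]; field_simp
  have hx' := cos_arccos_half hx
  rw [hφ] at hx'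
  have hxe : (x : ℂ) = Complex.exp ((r * Real.pi : ℝ) * Complex.I)
      + (Complex.exp ((r * Real.pi : ℝ) * Complex.I))⁻¹ := by
    rw [hx', ← Complex.exp_neg]
    push_cast
    rw [Complex.cos]
    ring_nf
  refine ⟨Complex.exp ((r * Real.pi : ℝ) * Complex.I), 2 * r.den, by have := r.den_pos; omega,
    ?_, ?_, hxe⟩
  · rw [← Complex.exp_nat_mul, Complex.exp_eq_one_iff]
    refine ⟨r.num, ?_⟩
    have : (r : ℂ) * r.den = r.num := by exact_mod_cast Rat.mul_den_eq_num r
    push_cast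
    linear_combination 2 * Real.pi * Complex.I * this
  · intro h
    rcases sq_eq_one_iff.1 h with h | h <;> rw [h] at hxe
    · have : x = 2 := by
        have h2 : (x : ℂ) = (2 : ℝ) := by rw [hxe]; norm_num
        exact_mod_cast h2
      linarith [hx.2]
    · have : x = -2 := by
        have h2 : (x : ℂ) = (-2 : ℝ) := by rw [hxe]; norm_num
        exact_mod_cast h2
      linarith [hx.1]

/-- The translations preserving Θ form a group that contains a and b. The subgroup these generate is
dense because a/b is irrational, and Θ is closed. -/
theorem eq_univ_of_rotation_invariant {Θ : Set ℝ} (hcl : IsClosed Θ) (hne : Θ.Nonempty) {a b : ℝ}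
    (hab : Irrational (a / b)) (ha : ∀ θ, θ ∈ Θ ↔ θ + a ∈ Θ) (hb : ∀ θ, θ ∈ Θ ↔ θ + b ∈ Θ) :
    Θ = univ := by
  obtain ⟨θ0, h0⟩ := hne
  let H : AddSubgroup ℝ :=
    { carrier := {t | ∀ θ, θ ∈ Θ ↔ θ + t ∈ Θ}
      zero_mem' := fun θ => by simp
      add_mem' := fun {s t} hs ht θ => by rw [hs θ, ht (θ + s), add_assoc]
      neg_mem' := fun {t} ht θ => by rw [ht (θ + -t)]; simp }
  have hle : AddSubgroup.closure {a, b} ≤ H := by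
    rw [AddSubgroup.closure_le]
    rintro _ (rfl | rfl)
    exacts [ha, hb]
  have hd : Dense ((AddSubgroup.closure {a, b} : AddSubgroup ℝ) : Set ℝ) :=
    dense_addSubgroupClosure_pair_iff.2 hab
  have hd' : Dense {t | θ0 + t ∈ Θ} := hd.mono fun t ht => (hle ht θ0).1 h0
  have hcl' : IsClosed {t | θ0 + t ∈ Θ} := hcl.preimage (by fun_prop)
  refine eq_univ_of_forall fun θ => ?_
  have : θ - θ0 ∈ {t | θ0 + t ∈ Θ} := by
    rw [← hcl'.closure_eq, hd'.closure_eq]; trivial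
  simpa using this

theorem continuous_slicePoint (x : ℝ) : Continuous fun θ => slicePoint A B C D x θ := by
  unfold slicePoint; fun_prop

/-- The angles whose points lie in K form a closed nonempty set, invariant under 2π and under an
irrational multiple of 2π. -/
theorem IsInvariant.slice_subset {K : Set (ℝ × ℝ × ℝ)} (hK : IsInvariant A B C K)
    (hc : IsCompact K) {q : ℝ × ℝ × ℝ} (hq : q ∈ K) (hS : q ∈ surface A B C D)
    (hfix : ¬ (sy B q = q ∧ sz C q = q)) (hirr : ¬ IsFiniteOrderTrace (q.1 : ℂ))
    {q' : ℝ × ℝ × ℝ} (hq' : q' ∈ surface A B C D) (h1 : q'.1 = q.1) : q' ∈ K := by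
  have hx := (hK.mem_Ioo_or_fixed hc hq).resolve_right hfix
  set Θ := {θ | slicePoint A B C D q.1 θ ∈ K} with hΘ
  have hneg : ∀ θ ∈ Θ, -θ ∈ Θ := fun θ h => by
    have := hK.sz_mem _ h
    rwa [sz_slicePoint hx] at this
  have hneg' : ∀ θ ∈ Θ, -(θ + 2 * Real.arccos (q.1 / 2)) ∈ Θ := fun θ h => by
    have := hK.sy_mem _ h
    rwa [sy_slicePoint hx] at this
  have hper : ∀ θ, slicePoint A B C D q.1 (θ + 2 * Real.pi) = slicePoint A B C D q.1 θ := by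
    intro θ
    simp only [slicePoint]
    rw [Real.cos_add_two_pi, show θ + 2 * Real.pi + Real.arccos (q.1 / 2)
      = θ + Real.arccos (q.1 / 2) + 2 * Real.pi by ring, Real.cos_add_two_pi]
  have huniv : Θ = univ := by
    refine eq_univ_of_rotation_invariant (hc.isClosed.preimage (continuous_slicePoint _)) ?_
      (irrational_arccos hx hirr) (fun θ => ⟨fun h => ?_, fun h => ?_⟩) fun θ => ?_
    · obtain ⟨θ, hθ⟩ := exists_slicePoint hS hx
      exact ⟨θ, by rw [hΘ, mem_ofPred_eq, hθ]; exact hq⟩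
    · simpa using hneg _ (hneg' _ h)
    · have := hneg' _ (hneg _ h)
      simpa using this
    · simp only [hΘ, mem_ofPred_eq, hper]
  obtain ⟨θ, hθ⟩ := exists_slicePoint hq' (h1 ▸ hx)
  have : θ ∈ Θ := huniv ▸ mem_univ θ
  rw [← hθ, h1]
  exact this

theorem countable_isFiniteOrderTrace : {y : ℝ | IsFiniteOrderTrace (y : ℂ)}.Countable := by
  have h1 : {w : ℂ | IsFiniteOrderTrace w}.Countable := by
    refine ((countable_iUnion fun N : ℕ => (finite_roots_of_unity_le N).countable).image
      fun ζ => ζ + ζ⁻¹).mono ?_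
    rintro _ ⟨ζ, n, hn, h, -, rfl⟩
    exact ⟨ζ, mem_iUnion.2 ⟨n, n, hn, le_rfl, h⟩, rfl⟩
  exact h1.preimage Complex.ofReal_injective

theorem exists_not_isFiniteOrderTrace {a b : ℝ} (h : a < b) :
    ∃ y ∈ Ioo a b, ¬ IsFiniteOrderTrace (y : ℂ) := by
  by_contra! hcon
  have := countable_isFiniteOrderTrace.mono hcon
  exact (Cardinal.Real.Ioo_countable_iff.1 this).not_gt h

/-- A non degenerate slice contains a point with irrational second coordinate at which the
surface is a graph over the first two coordinates. -/
theorem exists_irrational_snd {x : ℝ} (hx : x ∈ Ioo (-2 : ℝ) 2) (hP : 0 < sliceDisc A B C D x) :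
    ∃ q ∈ surface A B C D, q.1 = x ∧ ¬ IsFiniteOrderTrace (q.2.1 : ℂ) ∧
      2 * q.2.2 + q.1 * q.2.1 - C ≠ 0 := by
  have h4 := four_sub_sq_pos hx
  obtain ⟨ρ, hρ⟩ : ∃ ρ, ρ = 2 * √(sliceDisc A B C D x) / (4 - x ^ 2) := ⟨_, rfl⟩
  have hρ0 : 0 < ρ := by rw [hρ]; have := Real.sqrt_pos.2 hP; positivity
  obtain ⟨u, hu⟩ : ∃ u, u = (2 * B - x * C) / (4 - x ^ 2) := ⟨_, rfl⟩
  -- Traces of finite order are countable, so y can be taken irrational and strictly inside the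
  -- projection of the ellipse. Then sin θ ≠ 0, and the derivative along z does not vanish.
  obtain ⟨y, hy, hirr⟩ := exists_not_isFiniteOrderTrace (show u - ρ < u + ρ by linarith)
  have hlt : ((y - u) / ρ) ^ 2 < 1 := by
    rw [sq_lt_one_iff_abs_lt_one, abs_div, abs_of_pos hρ0, div_lt_one hρ0, abs_lt]
    constructor <;> linarith [hy.1, hy.2]
  obtain ⟨θ, hθ1, hθ2⟩ := exists_angle (a := (y - u) / ρ) (b := √(1 - ((y - u) / ρ) ^ 2))
    (by rw [Real.sq_sqrt (by linarith)]; ring)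
  have hθ3 : 0 < Real.sin θ := by rw [hθ2]; exact Real.sqrt_pos.2 (by linarith)
  have hy2 : (slicePoint A B C D x θ).2.1 = y := by
    simp only [slicePoint]
    rw [← hρ, ← hu, hθ1]; field_simp; ring
  refine ⟨slicePoint A B C D x θ, slicePoint_mem hx hP.le, rfl, ?_, ?_⟩
  · rwa [hy2]
  · have hc := cos_arccos_half hx
    have hs : 0 < Real.sin (Real.arccos (x / 2)) := by
      refine Real.sin_pos_of_pos_of_lt_pi (Real.arccos_pos.2 (by linarith [hx.2])) ?_
      refine lt_of_le_of_ne (Real.arccos_le_pi _) fun h => ?_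
      rw [h, Real.cos_pi] at hc
      linarith [hx.1]
    have hv : 2 * ((2 * C - x * B) / (4 - x ^ 2)) + x * ((2 * B - x * C) / (4 - x ^ 2)) = C := by
      field_simp; ring
    have key : 2 * (slicePoint A B C D x θ).2.2
        + (slicePoint A B C D x θ).1 * (slicePoint A B C D x θ).2.1 - C
        = 2 * ρ * Real.sin θ * Real.sin (Real.arccos (x / 2)) := by
      simp only [slicePoint, Real.cos_add]
      rw [← hρ]
      linear_combination hv + ρ * Real.cos θ * hc
    rw [key]
    positivity

/-! ### Propagation of invariant sets along the slices -/

/-- The union of the slices at the points of an open interval. -/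
def slab (A B C D r s : ℝ) : Set (ℝ × ℝ × ℝ) := {q | q ∈ surface A B C D ∧ q.1 ∈ Ioo r s}

theorem continuous_sliceDisc : Continuous fun x => sliceDisc A B C D x := by
  unfold sliceDisc; fun_prop

theorem continuousAt_slicePoint {x : ℝ} (hx : x ∈ Ioo (-2 : ℝ) 2) (θ : ℝ) :
    ContinuousAt (fun p : ℝ × ℝ => slicePoint A B C D p.1 p.2) (x, θ) := by
  have h4 : (4 - (x, θ).1 ^ 2 : ℝ) ≠ 0 := (four_sub_sq_pos hx).ne'
  have h1 : Continuous fun x => sliceDisc A B C D x := continuous_sliceDisc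
  unfold slicePoint
  refine ContinuousAt.prodMk (by fun_prop) (ContinuousAt.prodMk ?_ ?_)
  · refine ContinuousAt.add (ContinuousAt.div (by fun_prop) (by fun_prop) h4)
      (ContinuousAt.mul (ContinuousAt.div ?_ (by fun_prop) h4) (by fun_prop))
    exact (Continuous.continuousAt (by fun_prop))
  · refine ContinuousAt.sub (ContinuousAt.div (by fun_prop) (by fun_prop) h4)
      (ContinuousAt.mul (ContinuousAt.div ?_ (by fun_prop) h4) ?_)
    · exact (Continuous.continuousAt (by fun_prop))
    · have := Real.continuous_arccos
      exact (Continuous.continuousAt (by fun_prop))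

/-- Change direction: the slice contains a point with irrational y at which the derivative along z
is nonzero. The set K then contains the whole slice at this y, and that slice meets every nearby
plane x = x'. -/
theorem IsInvariant.exists_mem_of_slice {K : Set (ℝ × ℝ × ℝ)} (hK : IsInvariant A B C K)
    (hc : IsCompact K) {x : ℝ} (hx : x ∈ Ioo (-2 : ℝ) 2) (hP : 0 < sliceDisc A B C D x)
    (hsl : ∀ q ∈ surface A B C D, q.1 = x → q ∈ K) :
    ∀ᶠ x' in 𝓝 x, ∃ q ∈ K, q ∈ surface A B C D ∧ q.1 = x' := by
  obtain ⟨⟨x0, y, z⟩, hq, h1, hirr, hz⟩ := exists_irrational_snd hx hP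
  simp only at h1 hirr hz
  subst h1
  have hqK := hsl _ hq rfl
  have hslice : ∀ q' ∈ surface A B C D, q'.2.1 = y → q' ∈ K := by
    intro q' hq' hy'
    have hnf : ¬ (sy C (y, z, x0) = (y, z, x0) ∧ sz A (y, z, x0) = (y, z, x0)) := by
      rw [fixed_iff]
      rintro ⟨h, -⟩
      simp only at h
      exact hz (by linarith)
    have hcpt : IsCompact (CantatLoray.rot ⁻¹' K) := by
      have himg : CantatLoray.rot ⁻¹' K = (fun q => CantatLoray.rot (CantatLoray.rot q)) '' K := by
        ext q
        constructor
        · intro h; exact ⟨CantatLoray.rot q, h, rot_rot_rot q⟩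
        · rintro ⟨q', h, rfl⟩; exact h
      rw [himg]
      refine hc.image ?_
      unfold CantatLoray.rot
      fun_prop
    exact hK.rot.slice_subset (D := D) hcpt (q := (y, z, x0)) hqK
      (rot_mem_surface.1 hq) hnf hirr (q' := (q'.2.1, q'.2.2, q'.1)) (rot_mem_surface.1 hq') hy'
  -- The discriminant of the surface equation as a quadratic in z, with y fixed; it is positive at
  -- x0, hence nearby.
  set disc : ℝ → ℝ := fun x' => (x' * y - C) ^ 2 - 4 * (x' ^ 2 + y ^ 2 - A * x' - B * y - D)
    with hdisc
  have hd0 : 0 < disc x0 := by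
    have h1 : disc x0 = (2 * z + x0 * y - C) ^ 2 := by
      simp only [surface, mem_ofPred_eq] at hq
      simp only [hdisc]
      linear_combination -4 * hq
    rw [h1]
    positivity
  have hdc : Continuous disc := by simp only [hdisc]; fun_prop
  filter_upwards [hdc.continuousAt.eventually (lt_mem_nhds hd0)] with x' hx'
  have hsq := Real.sq_sqrt hx'.le
  have hmem : (x', y, (C - x' * y + √(disc x')) / 2) ∈ surface A B C D := by
    simp only [surface, mem_ofPred_eq]
    linear_combination hsq / 4
  exact ⟨_, hslice _ hmem rfl, hmem, rfl⟩

/-- Once it contains a non degenerate slice, a compact invariant set contains all the neighbouring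
slices. -/
theorem IsInvariant.slab_subset {K : Set (ℝ × ℝ × ℝ)} (hK : IsInvariant A B C K)
    (hc : IsCompact K) {x r s : ℝ} (hr : -2 ≤ r) (hs : s ≤ 2)
    (hP : ∀ t ∈ Ioo r s, 0 < sliceDisc A B C D t) (hx : x ∈ Ioo r s)
    (hsl : ∀ q ∈ surface A B C D, q.1 = x → q ∈ K) : slab A B C D r s ⊆ K := by
  have hIoo : ∀ {t}, t ∈ Ioo r s → t ∈ Ioo (-2 : ℝ) 2 := fun ht =>
    ⟨hr.trans_lt ht.1, ht.2.trans_le hs⟩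
  set X := {t | ∀ q ∈ surface A B C D, q.1 = t → q ∈ K} with hX
  -- the complement is open
  have hopen : ∀ t ∈ Ioo r s, t ∉ X → ∀ᶠ t' in 𝓝 t, t' ∉ X := by
    intro t ht htX
    simp only [hX, mem_ofPred_eq, not_forall] at htX
    obtain ⟨q, hq, rfl, hqK⟩ := htX
    obtain ⟨θ, hθ⟩ := exists_slicePoint hq (hIoo ht)
    have h1 : ContinuousAt (fun t' => slicePoint A B C D t' θ) q.1 :=
      (continuousAt_slicePoint (hIoo ht) θ).comp (f := fun t' => (t', θ)) (by fun_prop)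
    have h2 : ∀ᶠ t' in 𝓝 q.1, slicePoint A B C D t' θ ∈ Kᶜ :=
      h1.eventually (hc.isClosed.isOpen_compl.mem_nhds (by simpa only [hθ, mem_compl_iff] using hqK))
    filter_upwards [h2, isOpen_Ioo.mem_nhds ht] with t' ht' ht'' hmem
    exact ht' (hmem _ (slicePoint_mem (hIoo ht'') (hP _ ht'').le) rfl)
  -- Otherwise there would be an open set of missing parameters near t. It contains an irrational
  -- one whose slice meets K, and that slice lies in K by `slice_subset`.
  have hopen' : ∀ t ∈ Ioo r s, t ∈ X → ∀ᶠ t' in 𝓝 t, t' ∈ X := by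
    intro t ht htX
    have h1 := hK.exists_mem_of_slice hc (hIoo ht) (hP t ht) htX
    obtain ⟨ε, hε, hball⟩ := Metric.eventually_nhds_iff_ball.1
      (h1.and (isOpen_Ioo.mem_nhds ht))
    filter_upwards [Metric.ball_mem_nhds t hε] with t' ht'
    by_contra hcon
    have h2 := hopen t' (hball t' ht').2 hcon
    obtain ⟨ε', hε', hball'⟩ := Metric.eventually_nhds_iff_ball.1
      (h2.and (Metric.isOpen_ball.mem_nhds ht'))
    obtain ⟨w, hw, hirr⟩ := exists_not_isFiniteOrderTrace (show t' - ε' < t' + ε' by linarith)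
    rw [← Real.ball_eq_Ioo] at hw
    obtain ⟨hwX, hwb⟩ := hball' w hw
    obtain ⟨⟨q, hqK, hqS, rfl⟩, hwI⟩ := hball w hwb
    refine hwX fun q' hq' h => hK.slice_subset hc hqK hqS ?_ hirr hq' h
    exact (sliceDisc_pos_iff hqS (hIoo hwI)).1 (hP _ hwI)
  have hall : Ioo r s ⊆ interior X := by
    refine isPreconnected_Ioo.subset_of_closure_inter_subset isOpen_interior ?_ ?_
    · exact ⟨x, hx, mem_interior_iff_mem_nhds.2 (hopen' x hx hsl)⟩
    · rintro t ⟨htc, ht⟩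
      refine mem_interior_iff_mem_nhds.2 (hopen' t ht ?_)
      by_contra hcon
      obtain ⟨t', h1, h2⟩ := mem_closure_iff_nhds.1 htc _ (hopen t ht hcon)
      exact h1 (interior_subset h2)
  rintro q ⟨hq, hqx⟩
  exact interior_subset (hall hqx) q hq rfl

/-- A maximal interval of non degenerate elliptic slices. -/
structure IsMaximalInterval (A B C D r s : ℝ) : Prop where
  left : -2 ≤ r
  lt : r < s
  right : s ≤ 2
  pos : ∀ t ∈ Ioo r s, 0 < sliceDisc A B C D t
  left_eq : r = -2 ∨ sliceDisc A B C D r = 0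
  right_eq : s = 2 ∨ sliceDisc A B C D s = 0

theorem exists_isMaximalInterval {x : ℝ} (hx : x ∈ Ioo (-2 : ℝ) 2) (hP : 0 < sliceDisc A B C D x) :
    ∃ r s, IsMaximalInterval A B C D r s ∧ x ∈ Ioo r s := by
  have hcont : Continuous fun x => sliceDisc A B C D x := continuous_sliceDisc
  -- right end
  have hright : ∃ s, x < s ∧ s ≤ 2 ∧ (∀ t ∈ Ico x s, 0 < sliceDisc A B C D t) ∧
      (s = 2 ∨ sliceDisc A B C D s = 0) := by
    set Z := {t | t ∈ Icc x 2 ∧ (t = 2 ∨ sliceDisc A B C D t = 0)} with hZ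
    have hZc : IsCompact Z := by
      refine isCompact_Icc.inter_right (IsClosed.union isClosed_singleton ?_)
      exact isClosed_eq hcont continuous_const
    have hZne : Z.Nonempty := ⟨2, ⟨hx.2.le, le_rfl⟩, Or.inl rfl⟩
    obtain ⟨s, ⟨⟨hs1, hs2⟩, hs3⟩, hmin⟩ := hZc.exists_isLeast hZne
    have hxs : x < s := by
      refine lt_of_le_of_ne hs1 ?_
      rintro rfl
      rcases hs3 with h | h
      · linarith [hx.2]
      · linarith
    refine ⟨s, hxs, hs2, fun t ht => ?_, hs3⟩
    by_contra hcon
    obtain ⟨w, hw, hw0⟩ := intermediate_value_Icc' ht.1 hcont.continuousOn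
      (show (0 : ℝ) ∈ Icc _ _ from ⟨not_lt.1 hcon, hP.le⟩)
    have := hmin ⟨⟨hw.1, (hw.2.trans ht.2.le).trans hs2⟩, Or.inr hw0⟩
    linarith [hw.2, ht.2]
  have hleft : ∃ r, r < x ∧ -2 ≤ r ∧ (∀ t ∈ Ioc r x, 0 < sliceDisc A B C D t) ∧
      (r = -2 ∨ sliceDisc A B C D r = 0) := by
    set Z := {t | t ∈ Icc (-2) x ∧ (t = -2 ∨ sliceDisc A B C D t = 0)} with hZ
    have hZc : IsCompact Z := by
      refine isCompact_Icc.inter_right (IsClosed.union isClosed_singleton ?_)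
      exact isClosed_eq hcont continuous_const
    have hZne : Z.Nonempty := ⟨-2, ⟨le_rfl, hx.1.le⟩, Or.inl rfl⟩
    obtain ⟨r, ⟨⟨hr1, hr2⟩, hr3⟩, hmax⟩ := hZc.exists_isGreatest hZne
    have hrx : r < x := by
      refine lt_of_le_of_ne hr2 ?_
      rintro rfl
      rcases hr3 with h | h
      · linarith [hx.1]
      · linarith
    refine ⟨r, hrx, hr1, fun t ht => ?_, hr3⟩
    by_contra hcon
    obtain ⟨w, hw, hw0⟩ := intermediate_value_Icc ht.2 hcont.continuousOn
      (show (0 : ℝ) ∈ Icc _ _ from ⟨not_lt.1 hcon, hP.le⟩)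
    have := hmax ⟨⟨hr1.trans (ht.1.le.trans hw.1), hw.2⟩, Or.inr hw0⟩
    linarith [hw.1, ht.1]
  obtain ⟨s, h1, h2, h3, h4⟩ := hright
  obtain ⟨r, g1, g2, g3, g4⟩ := hleft
  refine ⟨r, s, ⟨g2, g1.trans h1, h2, fun t ht => ?_, g4, h4⟩, g1, h1⟩
  rcases le_total t x with h | h
  · exact g3 t ⟨ht.1, h⟩
  · exact h3 t ⟨h, ht.2⟩

end Slices


/-! ### Intervals with a bounded slab -/

/-- A maximal interval of non degenerate slices whose ends are roots of the discriminant, and even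
double roots at `± 2`. -/
structure IsCompactInterval (A B C D r s : ℝ) : Prop extends IsMaximalInterval A B C D r s where
  left_zero : sliceDisc A B C D r = 0
  right_zero : sliceDisc A B C D s = 0
  edge : ∀ e : ℝ, e ^ 2 = 1 → (2 * e = r ∨ 2 * e = s) →
    C = e * B ∧ B ^ 2 / 4 + D + 2 * e * A - 4 = 0

section Components

variable {A B C D r s : ℝ}

theorem IsMaximalInterval.subset_Ioo (h : IsMaximalInterval A B C D r s) :
    Ioo r s ⊆ Ioo (-2 : ℝ) 2 := Ioo_subset_Ioo h.left h.right

/-- The amplitude 2√P/(4 - t²) of the slices is bounded. -/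
theorem IsMaximalInterval.exists_sliceDisc_le (h : IsMaximalInterval A B C D r s)
    (hb : Bornology.IsBounded (slab A B C D r s)) :
    ∃ M, ∀ t ∈ Ioo r s, sliceDisc A B C D t ≤ M * (4 - t ^ 2) ^ 2 := by
  obtain ⟨M, hM⟩ := hb.exists_norm_le
  refine ⟨M ^ 2 / 4, fun t ht => ?_⟩
  have ht' := h.subset_Ioo ht
  have h4 := four_sub_sq_pos ht'
  have hP := h.pos t ht
  have hy : ∀ θ, |(slicePoint A B C D t θ).2.1| ≤ M := fun θ =>
    (norm_fst_le _).trans ((norm_snd_le _).trans (hM _ ⟨slicePoint_mem ht' hP.le, ht⟩))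
  have h0 := hy 0
  have h1 := hy Real.pi
  simp only [slicePoint, Real.cos_zero, Real.cos_pi] at h0 h1
  have hρ0 : 0 ≤ 2 * √(sliceDisc A B C D t) / (4 - t ^ 2) := by positivity
  set ρ := 2 * √(sliceDisc A B C D t) / (4 - t ^ 2) with hρ
  have hρM : ρ ≤ M := by
    rw [abs_le] at h0 h1
    linarith [h0.2, h1.1]
  have hρ' : ρ * (4 - t ^ 2) = 2 * √(sliceDisc A B C D t) := by rw [hρ]; field_simp
  have hsq := Real.sq_sqrt hP.le
  have : sliceDisc A B C D t = ρ ^ 2 / 4 * (4 - t ^ 2) ^ 2 := by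
    rw [← hsq]
    linear_combination -(1 / 4 : ℝ) * (ρ * (4 - t ^ 2) + 2 * √(sliceDisc A B C D t)) * hρ'
  rw [this]
  gcongr

/-- At an end 2e = ±2 the bound by (4 - t²)² forces a double zero. The value there is (C - eB)²,
whence C = eB. After division by 2 - ex the quotient k still vanishes at 2e, which is the second
relation. -/
theorem IsMaximalInterval.isCompactInterval (h : IsMaximalInterval A B C D r s)
    (hb : Bornology.IsBounded (slab A B C D r s)) : IsCompactInterval A B C D r s := by
  obtain ⟨M, hM⟩ := h.exists_sliceDisc_le hb
  have hcl : ∀ x, x = r ∨ x = s → (𝓝[Ioo r s] x).NeBot := by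
    intro x hx
    rw [← mem_closure_iff_nhdsWithin_neBot, closure_Ioo h.lt.ne]
    rcases hx with rfl | rfl
    exacts [⟨le_rfl, h.lt.le⟩, ⟨h.lt.le, le_rfl⟩]
  have hcont : Continuous fun x => sliceDisc A B C D x := continuous_sliceDisc
  have hedge0 : ∀ e : ℝ, e ^ 2 = 1 → (2 * e = r ∨ 2 * e = s) → sliceDisc A B C D (2 * e) = 0 := by
    intro e he hor
    have := hcl _ hor
    have h1 : sliceDisc A B C D (2 * e) ≤ M * (4 - (2 * e) ^ 2) ^ 2 := by
      refine le_of_tendsto_of_tendsto (b := 𝓝[Ioo r s] (2 * e))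
        (hcont.continuousAt.tendsto.mono_left nhdsWithin_le_nhds)
        ((Continuous.tendsto (f := fun t : ℝ => M * (4 - t ^ 2) ^ 2)
          (by fun_prop) _).mono_left nhdsWithin_le_nhds) ?_
      filter_upwards [self_mem_nhdsWithin] with t ht using hM t ht
    have h2 : 0 ≤ sliceDisc A B C D (2 * e) := by
      refine ge_of_tendsto (x := 𝓝[Ioo r s] (2 * e))
        (hcont.continuousAt.tendsto.mono_left nhdsWithin_le_nhds) ?_
      filter_upwards [self_mem_nhdsWithin] with t ht using (h.pos t ht).le
    rw [show (4 : ℝ) - (2 * e) ^ 2 = 0 by linear_combination -4 * he] at h1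
    norm_num at h1
    exact le_antisymm h1 h2
  refine ⟨h, ?_, ?_, fun e he hor => ?_⟩
  · rcases h.left_eq with h1 | h1
    · have := hedge0 (-1) (by norm_num) (Or.inl (by linarith))
      rw [h1]; norm_num at this ⊢; exact this
    · exact h1
  · rcases h.right_eq with h1 | h1
    · have := hedge0 1 (by norm_num) (Or.inr (by linarith))
      rw [h1]; norm_num at this ⊢; exact this
    · exact h1
  · have h0 := hedge0 e he hor
    have hCB : C = e * B := by
      have h1 : (C - e * B) ^ 2 = 0 := by
        rw [← h0, sliceDisc]
        linear_combination (4 * (D + A * (2 * e) - (2 * e) ^ 2) + B ^ 2) * he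
      have := pow_eq_zero_iff two_ne_zero |>.1 h1
      linarith
    refine ⟨hCB, ?_⟩
    have hneb := hcl _ hor
    set k : ℝ → ℝ := fun x => (D + A * x - x ^ 2) * (2 + e * x) + B ^ 2 with hk
    have hkc : Continuous k := by simp only [hk]; fun_prop
    have hfac : ∀ x, sliceDisc A B C D x = (2 - e * x) * k x := by
      intro x
      rw [sliceDisc, hCB]
      linear_combination (B ^ 2 + (D + A * x - x ^ 2) * x ^ 2) * he
    have hpos : ∀ t ∈ Ioo r s, 0 < 2 - e * t := by
      intro t ht
      have := h.subset_Ioo ht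
      rcases sq_eq_one_iff.1 he with rfl | rfl <;> linarith [this.1, this.2]
    have h1 : k (2 * e) ≤ M * ((2 - e * (2 * e)) * (2 + e * (2 * e)) ^ 2) := by
      refine le_of_tendsto_of_tendsto (b := 𝓝[Ioo r s] (2 * e))
        (hkc.continuousAt.tendsto.mono_left nhdsWithin_le_nhds)
        ((Continuous.tendsto (f := fun t : ℝ => M * ((2 - e * t) * (2 + e * t) ^ 2))
          (by fun_prop) _).mono_left nhdsWithin_le_nhds) ?_
      filter_upwards [self_mem_nhdsWithin] with t ht
      have h2 := hM t ht
      have h3 := hpos t ht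
      rw [hfac t] at h2
      have h4 : M * (4 - t ^ 2) ^ 2 = (2 - e * t) * (M * ((2 - e * t) * (2 + e * t) ^ 2)) := by
        have : (4 - t ^ 2) = (2 - e * t) * (2 + e * t) := by linear_combination t ^ 2 * he
        rw [this]; ring
      rw [h4] at h2
      exact le_of_mul_le_mul_left h2 h3
    have h2 : 0 ≤ k (2 * e) := by
      refine ge_of_tendsto (x := 𝓝[Ioo r s] (2 * e))
        (hkc.continuousAt.tendsto.mono_left nhdsWithin_le_nhds) ?_
      filter_upwards [self_mem_nhdsWithin] with t ht
      have h2 := h.pos t ht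
      rw [hfac t] at h2
      exact ((mul_pos_iff_of_pos_left (hpos t ht)).1 h2).le
    rw [show (2 : ℝ) - e * (2 * e) = 0 by linear_combination -2 * he] at h1
    rw [zero_mul, mul_zero] at h1
    have h3 : k (2 * e) = 0 := le_antisymm h1 h2
    simp only [hk] at h3
    linear_combination h3 / 4 - ((D + A * (2 * e) - (2 * e) ^ 2) / 2 - 4) * he

/-- The quadratic cofactor of the discriminant. -/
theorem IsCompactInterval.factor (h : IsCompactInterval A B C D r s) :
    ∃ b c : ℝ, (∀ x, sliceDisc A B C D x = (x - r) * (x - s) * (x ^ 2 + b * x + c)) ∧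
      b = r + s - A ∧ c - (r + s) * b + r * s = -(D + 4) ∧
      r * s * b - (r + s) * c = 4 * A - B * C ∧ r * s * c = 4 * D + B ^ 2 + C ^ 2 ∧
      r ^ 2 + b * r + c ≤ 0 ∧ s ^ 2 + b * s + c ≤ 0 ∧ 0 ≤ 4 + 2 * b + c ∧
      0 ≤ 4 - 2 * b + c := by
  have hr := h.left_zero
  have hs := h.right_zero
  have hlt := h.lt
  obtain ⟨b, hb⟩ : ∃ b, b = r + s - A := ⟨_, rfl⟩
  obtain ⟨c, hc⟩ : ∃ c, c = (r + s) * b - r * s - (D + 4) := ⟨_, rfl⟩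
  -- Division by (x - r)(x - s). The remainder is affine and vanishes at the distinct points r and
  -- s, hence is zero.
  have hrem : ∀ x, sliceDisc A B C D x = (x - r) * (x - s) * (x ^ 2 + b * x + c)
      + ((4 * A - B * C) - (r * s * b - (r + s) * c)) * x
      + (4 * D + B ^ 2 + C ^ 2 - r * s * c) := by
    intro x
    rw [sliceDisc, hc, hb]
    ring
  have h1 := hrem r
  have h2 := hrem s
  rw [hr] at h1
  rw [hs] at h2
  have h3 : ((4 * A - B * C) - (r * s * b - (r + s) * c)) * (s - r) = 0 := by
    linear_combination h1 - h2
  have h4 : (4 * A - B * C) - (r * s * b - (r + s) * c) = 0 :=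
    (mul_eq_zero.1 h3).resolve_right (by linarith)
  have h5 : 4 * D + B ^ 2 + C ^ 2 - r * s * c = 0 := by
    rw [h4] at h1; linarith
  have hfac : ∀ x, sliceDisc A B C D x = (x - r) * (x - s) * (x ^ 2 + b * x + c) := by
    intro x
    rw [hrem x, h4, h5]; ring
  have hTc : Continuous fun x : ℝ => x ^ 2 + b * x + c := by fun_prop
  have hneg : ∀ t ∈ Ioo r s, t ^ 2 + b * t + c < 0 := by
    intro t ht
    have hp := h.pos t ht
    rw [hfac] at hp
    have : (t - r) * (t - s) < 0 := mul_neg_of_pos_of_neg (by linarith [ht.1]) (by linarith [ht.2])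
    by_contra! hcon
    nlinarith
  have hend : ∀ x ∈ Icc r s, x ^ 2 + b * x + c ≤ 0 := by
    intro x hx
    rw [← closure_Ioo hlt.ne] at hx
    exact closure_minimal (s := Ioo r s) (t := {x | x ^ 2 + b * x + c ≤ 0})
      (fun t ht => (hneg t ht).le) (isClosed_le hTc continuous_const) hx
  refine ⟨b, c, hfac, hb, by rw [hc]; ring, by linarith, by linarith, hend r ⟨le_rfl, hlt.le⟩,
    hend s ⟨hlt.le, le_rfl⟩, ?_, ?_⟩
  -- The number 4 + 2b + c is the value of the cofactor at 2. It vanishes by the edge relation if s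
  -- = 2; otherwise its sign follows from P(2) = (B - C)² ≥ 0. The point -2 is treated in the same
  -- way.
  · rcases h.right.eq_or_lt with hs2 | hs2
    · obtain ⟨e1, e2⟩ := h.edge 1 (by norm_num) (Or.inr (by linarith))
      have h6 : (2 - r) * (4 + 2 * b + c) = 0 := by
        subst hs2
        rw [hc, hb] at h4 ⊢
        rw [e1] at h4
        linear_combination (-4) * e2 - h4
      have := (mul_eq_zero.1 h6).resolve_left (by linarith)
      linarith
    · have h6 : 0 ≤ sliceDisc A B C D 2 := by
        rw [show sliceDisc A B C D 2 = (B - C) ^ 2 by rw [sliceDisc]; ring]; positivity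
      rw [hfac] at h6
      have h7 : 0 < (2 - r) * (2 - s) := mul_pos (by linarith) (by linarith)
      by_contra! hcon
      nlinarith
  · rcases h.left.eq_or_lt with hr2 | hr2
    · obtain ⟨e1, e2⟩ := h.edge (-1) (by norm_num) (Or.inl (by linarith))
      have h6 : (-2 - s) * (4 - 2 * b + c) = 0 := by
        subst hr2
        rw [hc, hb] at h4 ⊢
        rw [e1] at h4
        linear_combination 4 * e2 - h4
      have := (mul_eq_zero.1 h6).resolve_left (by linarith)
      linarith
    · have h6 : 0 ≤ sliceDisc A B C D (-2) := by
        rw [show sliceDisc A B C D (-2) = (B + C) ^ 2 by rw [sliceDisc]; ring]; positivity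
      rw [hfac] at h6
      have h7 : 0 < (-2 - r) * (-2 - s) := mul_pos_of_neg_of_neg (by linarith) (by linarith)
      by_contra! hcon
      nlinarith

/-- If s ≤ r', the roots of the quadratic cofactor of (x - r)(x - s) are r' and s', so it is
positive at r, whereas it must be nonpositive there. If s = r', the cofactor vanishes at s because
it is nonpositive there by the first interval and nonnegative by the second. -/
theorem IsCompactInterval.not_le {r' s' : ℝ} (h : IsCompactInterval A B C D r s)
    (h' : IsCompactInterval A B C D r' s') : ¬ s ≤ r' := by
  intro hle
  obtain ⟨b, c, hfac, -, -, -, -, hTr, hTs, -, -⟩ := h.factor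
  have hlt := h.lt
  have hlt' := h'.lt
  have h1 := h'.left_zero
  have h2 := h'.right_zero
  rw [hfac] at h1 h2
  have hTs' : s' ^ 2 + b * s' + c = 0 :=
    (mul_eq_zero.1 h2).resolve_left (mul_ne_zero (by linarith) (by linarith))
  have hTr' : r' ^ 2 + b * r' + c = 0 := by
    rcases hle.eq_or_lt with rfl | hlt2
    · refine le_antisymm hTs ?_
      have hcl : s ∈ closure (Ioo s s') := by
        rw [closure_Ioo hlt'.ne]; exact ⟨le_rfl, hlt'.le⟩
      refine closure_minimal (s := Ioo s s') (t := {x | 0 ≤ x ^ 2 + b * x + c})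
        (fun t ht => ?_) (isClosed_le continuous_const (by fun_prop)) hcl
      have hp := h'.pos t ht
      rw [hfac] at hp
      exact ((mul_pos_iff_of_pos_left
        (mul_pos (by linarith [ht.1]) (by linarith [ht.1]))).1 hp).le
    · exact (mul_eq_zero.1 h1).resolve_left (mul_ne_zero (by linarith) (by linarith))
  have h3 : (s' - r') * (b + (s' + r')) = 0 := by linear_combination hTs' - hTr'
  have h4 : b + (s' + r') = 0 := (mul_eq_zero.1 h3).resolve_left (by linarith)
  have h5 : r ^ 2 + b * r + c = (r - r') * (r - s') := by
    linear_combination (r - r') * h4 + hTr'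
  have : 0 < (r - r') * (r - s') := mul_pos_of_neg_of_neg (by linarith) (by linarith)
  linarith

/-- There is at most one such interval. -/
theorem IsCompactInterval.unique {r' s' : ℝ} (h : IsCompactInterval A B C D r s)
    (h' : IsCompactInterval A B C D r' s') : r = r' ∧ s = s' := by
  have h1 := h.not_le h'
  have h2 := h'.not_le h
  push Not at h1 h2
  have a1 := h.lt
  have a2 := h'.lt
  constructor
  · rcases lt_trichotomy r r' with hlt | heq | hlt
    · have := h.pos r' ⟨hlt, h1⟩
      linarith [h'.left_zero]
    · exact heq
    · have := h'.pos r ⟨hlt, h2⟩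
      linarith [h.left_zero]
  · rcases lt_trichotomy s s' with hlt | heq | hlt
    · have := h'.pos s ⟨h1, hlt⟩
      linarith [h.right_zero]
    · exact heq
    · have := h.pos s' ⟨h2, hlt⟩
      linarith [h'.right_zero]

theorem IsMaximalInterval.isPreconnected_slab (h : IsMaximalInterval A B C D r s) :
    IsPreconnected (slab A B C D r s) := by
  have heq : slab A B C D r s
      = (fun p : ℝ × ℝ => slicePoint A B C D p.1 p.2) '' (Ioo r s ×ˢ univ) := by
    ext q
    constructor
    · rintro ⟨hq, hx⟩
      obtain ⟨θ, hθ⟩ := exists_slicePoint hq (h.subset_Ioo hx)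
      exact ⟨(q.1, θ), ⟨hx, mem_univ _⟩, hθ⟩
    · rintro ⟨⟨t, θ⟩, ⟨ht, -⟩, rfl⟩
      exact ⟨slicePoint_mem (h.subset_Ioo ht) (h.pos t ht).le, ht⟩
  rw [heq]
  refine (isPreconnected_Ioo.prod isPreconnected_univ).image _ ?_
  rintro ⟨t, θ⟩ ⟨ht, -⟩
  exact (continuousAt_slicePoint (h.subset_Ioo ht) θ).continuousWithinAt

theorem mem_smoothPart_of_pos {q : ℝ × ℝ × ℝ} (hq : q ∈ surface A B C D)
    (hP : 0 < sliceDisc A B C D q.1) : q ∈ smoothPart A B C D := by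
  refine ⟨hq, fun hs => ?_⟩
  obtain ⟨-, -, h2, h3⟩ := hs
  obtain ⟨x, y, z⟩ := q
  rw [sliceDisc_eq hq] at hP
  simp only at h2 h3
  rw [h2, h3] at hP
  norm_num at hP

theorem IsMaximalInterval.slab_subset_smoothPart (h : IsMaximalInterval A B C D r s) :
    slab A B C D r s ⊆ smoothPart A B C D :=
  fun _ hq => mem_smoothPart_of_pos hq.1 (h.pos _ hq.2)

/-- A point of the double line in the plane `x = 2 e` at which the surface is smooth and bends
towards the elliptic slices is the end of a curve of points on elliptic slices. -/
theorem exists_edge_curve {e y z : ℝ} (he : e ^ 2 = 1) (hCB : C = e * B)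
    (hD : B ^ 2 / 4 + D + 2 * e * A - 4 = 0) (hyz : y + e * z = B / 2)
    (hg : 0 < 4 + e * y * z - e * A) :
    ∃ f : ℝ → ℝ × ℝ × ℝ, Continuous f ∧ f 0 = (2 * e, y, z) ∧
      ∀ᶠ ε in 𝓝[>] (0 : ℝ), f ε ∈ surface A B C D ∧ (f ε).1 ∈ Ioo (-2 : ℝ) 2 ∧
        0 < sliceDisc A B C D (f ε).1 := by
  set g : ℝ → ℝ := fun ε => 4 + e * y * (z + ε) - e * A with hgdef
  have hgc : Continuous g := by simp only [hgdef]; fun_prop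
  -- Substituting x = e(2 + ξ), with y fixed and z replaced by z + ε, turns the surface equation
  -- into ξ² + gξ + ε² = 0. This is the root that tends to 0; it is negative, so x moves into (-2,
  -- 2).
  set ξ : ℝ → ℝ := fun ε => (-g ε + √(g ε ^ 2 - 4 * ε ^ 2)) / 2 with hξdef
  have hξc : Continuous ξ := by simp only [hξdef]; fun_prop
  have hg0 : 0 < g 0 := by simpa [hgdef] using hg
  have hξ0 : ξ 0 = 0 := by
    simp only [hξdef]
    norm_num
    rw [Real.sqrt_sq hg0.le]; ring
  refine ⟨fun ε => (e * (2 + ξ ε), y, z + ε), by fun_prop, by simp [hξ0, mul_comm], ?_⟩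
  have ev1 : ∀ᶠ ε in 𝓝[>] (0 : ℝ), 0 < g ε :=
    (hgc.continuousAt.eventually (lt_mem_nhds hg0)).filter_mono nhdsWithin_le_nhds
  have ev2 : ∀ᶠ ε in 𝓝[>] (0 : ℝ), 0 < g ε ^ 2 - 4 * ε ^ 2 := by
    have : Continuous fun ε => g ε ^ 2 - 4 * ε ^ 2 := by fun_prop
    refine (this.continuousAt.eventually (lt_mem_nhds ?_)).filter_mono nhdsWithin_le_nhds
    simpa using pow_pos hg0 2
  have ev3 : ∀ᶠ ε in 𝓝[>] (0 : ℝ), -4 < ξ ε :=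
    (hξc.continuousAt.eventually (lt_mem_nhds (by rw [hξ0]; norm_num))).filter_mono
      nhdsWithin_le_nhds
  have ev4 : ∀ᶠ ε in 𝓝[>] (0 : ℝ), 0 < ξ ε * (1 + y ^ 2 / 4) + g ε := by
    have : Continuous fun ε => ξ ε * (1 + y ^ 2 / 4) + g ε := by fun_prop
    refine (this.continuousAt.eventually (lt_mem_nhds ?_)).filter_mono nhdsWithin_le_nhds
    simpa [hξ0] using hg0
  filter_upwards [ev1, ev2, ev3, ev4, self_mem_nhdsWithin] with ε h1 h2 h3 h4 (h5 : 0 < ε)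
  have hsq := Real.sq_sqrt h2.le
  have hrel : ξ ε * (ξ ε + g ε) = - ε ^ 2 := by
    simp only [hξdef]
    linear_combination hsq / 4
  have hξneg : ξ ε < 0 := by
    simp only [hξdef]
    have : √(g ε ^ 2 - 4 * ε ^ 2) < g ε := by
      rw [Real.sqrt_lt' h1]
      nlinarith
    linarith
  generalize ξ ε = w at *
  have hgε : g ε = 4 + e * y * (z + ε) - e * A := rfl
  rw [hgε] at hrel h4
  have hmem : (e * (2 + w), y, z + ε) ∈ surface A B C D := by
    simp only [surface, mem_ofPred_eq]
    have hy : y = B / 2 - e * z := by linarith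
    have hD' : D = 4 - B ^ 2 / 4 - 2 * e * A := by linarith
    rw [hCB, hD']
    rw [hy] at hrel ⊢
    linear_combination hrel + ((2 + w) ^ 2 + z ^ 2 - (w + 2) * z * (z + ε)
      + w * z * (z + ε)) * he
  have hx : e * (2 + w) ∈ Ioo (-2 : ℝ) 2 := by
    have : (e * (2 + w)) ^ 2 < 4 := by
      rw [mul_pow, he]; nlinarith
    constructor <;> nlinarith
  refine ⟨hmem, hx, ?_⟩
  rw [sliceDisc_pos_iff hmem hx, fixed_iff]
  rintro ⟨-, h6⟩
  simp only at h6
  -- The point must not be the centre of its slice. If it were, this relation and the quadratic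
  -- equation would give w = 0 or w(1 + y²/4) + g = 0, and both are excluded.
  have h7 : 2 * ε = - e * w * y := by
    rw [hCB] at h6
    linear_combination h6 - 2 * e * hyz + 2 * z * he
  have h8 : w * (w * (1 + y ^ 2 / 4) + (4 + e * y * (z + ε) - e * A)) = 0 := by
    have h9 : ε ^ 2 = w ^ 2 * y ^ 2 / 4 := by
      have : (2 * ε) ^ 2 = (- e * w * y) ^ 2 := by rw [h7]
      linear_combination this / 4 + w ^ 2 * y ^ 2 / 4 * he
    linear_combination hrel - h9
  rcases mul_eq_zero.1 h8 with h | h <;> linarith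

end Components


/-! ### The closure of a bounded slab is open in the smooth part -/

section Components

variable {A B C D r s : ℝ}

theorem isClosed_surface : IsClosed (surface A B C D) := by
  unfold surface
  exact isClosed_eq (by fun_prop) (by fun_prop)

theorem closure_slab_subset_surface : closure (slab A B C D r s) ⊆ surface A B C D :=
  closure_minimal (fun _ hq => hq.1) isClosed_surface

theorem closure_slab_subset_Icc {q : ℝ × ℝ × ℝ} (hq : q ∈ closure (slab A B C D r s)) :
    q.1 ∈ Icc r s :=
  closure_minimal (s := slab A B C D r s) (t := {q | q.1 ∈ Icc r s})
    (fun _ hq => Ioo_subset_Icc_self hq.2) (isClosed_Icc.preimage continuous_fst) hq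

/-- The plane x = 2e cuts the surface in the double line y + ez = B/2, and the sign of the second
factor tells on which side of the plane the surface lies. -/
theorem edge_identity {e x y z : ℝ} (he : e ^ 2 = 1) (hCB : C = e * B)
    (hD : B ^ 2 / 4 + D + 2 * e * A - 4 = 0) (hq : (x, y, z) ∈ surface A B C D) :
    (2 - e * x) * (e * x + 2 + e * y * z - e * A) = (y + e * z - B / 2) ^ 2 := by
  simp only [surface, mem_ofPred_eq] at hq
  have hD' : D = 4 - B ^ 2 / 4 - 2 * e * A := by linarith
  rw [hCB, hD'] at hq
  linear_combination -hq - (x ^ 2 + x * y * z - A * x + z ^ 2) * he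

/-- The closure of the slab of a compact interval is open in the smooth part. -/
theorem IsCompactInterval.eventually_mem_closure_slab (h : IsCompactInterval A B C D r s)
    {q : ℝ × ℝ × ℝ} (hq : q ∈ closure (slab A B C D r s)) (hsm : q ∈ smoothPart A B C D) :
    ∀ᶠ q' in 𝓝 q, q' ∈ surface A B C D → q' ∈ closure (slab A B C D r s) := by
  have hfst : Tendsto (fun q' : ℝ × ℝ × ℝ => q'.1) (𝓝 q) (𝓝 q.1) := continuous_fst.tendsto q
  have hqS := closure_slab_subset_surface hq
  obtain ⟨hqr, hqs⟩ := closure_slab_subset_Icc hq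
  have hlt := h.lt
  by_cases hin : q.1 ∈ Ioo r s
  · filter_upwards [hfst.eventually (isOpen_Ioo.mem_nhds hin)] with q' h1 h2
    exact subset_closure ⟨h2, h1⟩
  have hend : q.1 = r ∨ q.1 = s := by
    by_contra! hcon
    exact hin ⟨lt_of_le_of_ne hqr hcon.1.symm, lt_of_le_of_ne hqs hcon.2⟩
  by_cases hI : q.1 ∈ Ioo (-2 : ℝ) 2
  · -- an isolated point of the slice
    obtain ⟨b, c, hfac, hb, hc, hbc, -, hTr, hTs, -, -⟩ := h.factor
    have hP0 : sliceDisc A B C D q.1 = 0 := by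
      rcases hend with h1 | h1 <;> rw [h1]
      exacts [h.left_zero, h.right_zero]
    have hcenter : ∀ q' ∈ surface A B C D, q'.1 = q.1 →
        2 * q'.2.1 + q'.1 * q'.2.2 - B = 0 ∧ 2 * q'.2.2 + q'.1 * q'.2.1 - C = 0 := by
      intro q' hq' h1
      rw [← fixed_iff]
      by_contra hcon
      have := (sliceDisc_pos_iff hq' (h1 ▸ hI)).2 hcon
      rw [h1, hP0] at this
      exact lt_irrefl _ this
    -- At the centre of a slice, (A - 2x - yz)(4 - x²) is the derivative of the discriminant. As q
    -- is smooth, its first coordinate is a simple root, so the cofactor is nonzero and the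
    -- discriminant is negative just beyond the interval: no real points there.
    have hT0 : q.1 ^ 2 + b * q.1 + c < 0 := by
      refine lt_of_le_of_ne (by rcases hend with h1 | h1 <;> rw [h1] <;> assumption) fun hT => ?_
      apply hsm.2
      obtain ⟨h1, h2⟩ := hcenter q hqS rfl
      refine ⟨hqS, ?_, h1, h2⟩
      obtain ⟨x, y, z⟩ := q
      simp only [surface, mem_ofPred_eq] at hqS hend hT h1 h2 hI ⊢
      have h4 := four_sub_sq_pos hI
      have hB : B = 2 * y + x * z := by linarith
      have hC : C = 2 * z + x * y := by linarith
      have key : (A - 2 * x - y * z) * (4 - x ^ 2)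
          = 4 * x ^ 3 - 3 * A * x ^ 2 - 2 * (D + 4) * x + (4 * A - B * C) := by
        rw [hB, hC] at hqS ⊢
        linear_combination -2 * x * hqS
      have key2 : 4 * x ^ 3 - 3 * A * x ^ 2 - 2 * (D + 4) * x + (4 * A - B * C) = 0 := by
        rw [← hbc]
        rcases hend with rfl | rfl
        · linear_combination (x - s) * hT - 3 * x ^ 2 * hb - 2 * x * hc
        · linear_combination (x - r) * hT - 3 * x ^ 2 * hb - 2 * x * hc
      rw [key2] at key
      have := (mul_eq_zero.1 key).resolve_right h4.ne'
      linarith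
    have ev1 : ∀ᶠ x in 𝓝 q.1, x ^ 2 + b * x + c < 0 :=
      (show Continuous fun x : ℝ => x ^ 2 + b * x + c by fun_prop).continuousAt.eventually
        (gt_mem_nhds hT0)
    have ev2 : ∀ᶠ x in 𝓝 q.1, x = r ∨ x = s → x = q.1 := by
      rcases hend with h1 | h1
      · filter_upwards [gt_mem_nhds (show q.1 < s by linarith)] with x hx hor
        rcases hor with rfl | rfl
        · exact h1.symm
        · exact absurd hx (lt_irrefl _)
      · filter_upwards [lt_mem_nhds (show r < q.1 by linarith)] with x hx hor
        rcases hor with rfl | rfl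
        · exact absurd hx (lt_irrefl _)
        · exact h1.symm
    filter_upwards [hfst.eventually ev1, hfst.eventually ev2,
      hfst.eventually (isOpen_Ioo.mem_nhds hI)] with q' g1 g2 g3 hq'
    have hnn := sliceDisc_nonneg hq' g3
    rw [hfac] at hnn
    have hle : (q'.1 - r) * (q'.1 - s) ≤ 0 := by
      by_contra! hcon
      have := mul_neg_of_pos_of_neg hcon g1
      linarith
    by_cases hor : q'.1 = r ∨ q'.1 = s
    · have h1 := g2 hor
      obtain ⟨e1, e2⟩ := hcenter q' hq' h1
      obtain ⟨e3, e4⟩ := hcenter q hqS rfl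
      obtain ⟨x, y, z⟩ := q
      obtain ⟨x', y', z'⟩ := q'
      simp only at h1 e1 e2 e3 e4 hI
      subst h1
      have h4 := four_sub_sq_pos hI
      have hy : (y' - y) * (4 - x' ^ 2) = 0 := by linear_combination 2 * (e1 - e3) - x' * (e2 - e4)
      have hz : (z' - z) * (4 - x' ^ 2) = 0 := by linear_combination 2 * (e2 - e4) - x' * (e1 - e3)
      have hy' := (mul_eq_zero.1 hy).resolve_right h4.ne'
      have hz' := (mul_eq_zero.1 hz).resolve_right h4.ne'
      rw [sub_eq_zero.1 hy', sub_eq_zero.1 hz']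
      exact hq
    · push Not at hor
      refine subset_closure ⟨hq', ?_, ?_⟩
      · refine lt_of_le_of_ne ?_ hor.1.symm
        by_contra! hcon
        nlinarith
      · refine lt_of_le_of_ne ?_ hor.2
        by_contra! hcon
        nlinarith
  · -- a point of a double line in a plane `x = ± 2`
    obtain ⟨e, he, hqe, hor⟩ : ∃ e : ℝ, e ^ 2 = 1 ∧ q.1 = 2 * e ∧ (2 * e = r ∨ 2 * e = s) := by
      have hl := h.left
      have hr := h.right
      rcases hend with h1 | h1
      · refine ⟨-1, by norm_num, ?_, Or.inl ?_⟩ <;>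
        · by_contra hcon
          refine hI ⟨lt_of_le_of_ne (h1 ▸ hl) fun h2 => hcon (by linarith), by linarith⟩
      · refine ⟨1, by norm_num, ?_, Or.inr ?_⟩ <;>
        · by_contra hcon
          refine hI ⟨by linarith, lt_of_le_of_ne (h1 ▸ hr) fun h2 => hcon (by linarith)⟩
    obtain ⟨hCB, hD⟩ := h.edge e he hor
    have hloc : ∀ᶠ x in 𝓝 (2 * e), x ∈ Ioo (-2 : ℝ) 2 → x ∈ Ioo r s := by
      rcases sq_eq_one_iff.1 he with rfl | rfl
      · have hs2 : s = 2 := by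
          rcases hor with h1 | h1
          · linarith [h.right]
          · linarith
        filter_upwards [lt_mem_nhds (show r < 2 * 1 by linarith)] with x h1 h2
        exact ⟨h1, hs2 ▸ h2.2⟩
      · have hr2 : r = -2 := by
          rcases hor with h1 | h1
          · linarith
          · linarith [h.left]
        filter_upwards [gt_mem_nhds (show 2 * (-1 : ℝ) < s by linarith)] with x h1 h2
        exact ⟨hr2 ▸ h2.1, h1⟩
    -- The second factor of `edge_identity`. It is nonnegative on the closure of the slab, and on
    -- the double line it vanishes only at singular points. So G > 0 near q, and nearby points of
    -- the surface satisfy ex ≤ 2; those with equality are limits along the curves of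
    -- `exists_edge_curve`.
    set G : ℝ × ℝ × ℝ → ℝ := fun q => e * q.1 + 2 + e * q.2.1 * q.2.2 - e * A with hG
    have hGc : Continuous G := by simp only [hG]; fun_prop
    have hid : ∀ q' ∈ surface A B C D, (2 - e * q'.1) * G q' = (q'.2.1 + e * q'.2.2 - B / 2) ^ 2 :=
      fun q' hq' => edge_identity he hCB hD hq'
    have hpos : ∀ t ∈ Ioo (-2 : ℝ) 2, 0 < 2 - e * t := by
      intro t ht
      rcases sq_eq_one_iff.1 he with rfl | rfl <;> linarith [ht.1, ht.2]
    have hGnn : 0 ≤ G q := by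
      refine closure_minimal (s := slab A B C D r s) (t := {q | 0 ≤ G q}) ?_
        (isClosed_le continuous_const hGc) hq
      intro q' hq'
      have h1 := hid q' hq'.1
      have h2 := hpos _ (h.subset_Ioo hq'.2)
      by_contra! hcon
      have h3 : (2 - e * q'.1) * G q' < 0 := mul_neg_of_pos_of_neg h2 (lt_of_not_ge hcon)
      nlinarith [sq_nonneg (q'.2.1 + e * q'.2.2 - B / 2)]
    have hline : ∀ q' ∈ surface A B C D, q'.1 = 2 * e → q'.2.1 + e * q'.2.2 = B / 2 := by
      intro q' hq' h1
      have h2 := hid q' hq'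
      rw [h1, show (2 : ℝ) - e * (2 * e) = 0 by linear_combination -2 * he, zero_mul] at h2
      have := pow_eq_zero_iff two_ne_zero |>.1 h2.symm
      linarith
    have hGpos : 0 < G q := by
      refine lt_of_le_of_ne hGnn fun h0 => hsm.2 ⟨hqS, ?_, ?_, ?_⟩
      · simp only [hG] at h0
        linear_combination -e * h0 - (q.1 + q.2.1 * q.2.2 - A) * he + hqe
      · linear_combination 2 * hline q hqS hqe + q.2.2 * hqe
      · rw [hCB]
        linear_combination 2 * e * hline q hqS hqe - 2 * q.2.2 * he + q.2.1 * hqe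
    have hsgn : ∀ᶠ x in 𝓝 (2 * e), 0 < e * x := by
      have : Continuous fun x => e * x := by fun_prop
      refine this.continuousAt.eventually (lt_mem_nhds ?_)
      show 0 < e * (2 * e)
      rw [show e * (2 * e) = 2 by linear_combination 2 * he]
      norm_num
    rw [hqe] at hfst
    filter_upwards [hGc.continuousAt.eventually (lt_mem_nhds hGpos), hfst.eventually hloc,
      hfst.eventually hsgn] with q' g1 g2 g3 hq'
    have h1 := hid q' hq'
    have hle : 0 ≤ 2 - e * q'.1 := by
      by_contra! hcon
      have := mul_neg_of_neg_of_pos hcon g1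
      nlinarith [sq_nonneg (q'.2.1 + e * q'.2.2 - B / 2)]
    rcases hle.eq_or_lt with h2 | h2
    · have hx' : q'.1 = 2 * e := by linear_combination e * h2 - q'.1 * he
      have hgp : 0 < 4 + e * q'.2.1 * q'.2.2 - e * A := by
        simp only [hG] at g1
        linarith
      obtain ⟨f, hf, hf0, hev⟩ := exists_edge_curve he hCB hD (hline q' hq' hx') hgp
      have hf0' : f 0 = q' := by rw [hf0, ← hx']
      have hft : Tendsto f (𝓝[>] 0) (𝓝 q') := by
        have := hf.tendsto 0
        rw [hf0'] at this
        exact this.mono_left nhdsWithin_le_nhds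
      refine mem_closure_of_tendsto hft ?_
      have h3 : Tendsto (fun ε => (f ε).1) (𝓝[>] 0) (𝓝 (2 * e)) := by
        rw [← hx']
        exact (continuous_fst.tendsto q').comp hft
      filter_upwards [hev, h3.eventually hloc] with ε k1 k2
      exact ⟨k1.1, k2 k1.2.1⟩
    · refine subset_closure ⟨hq', g2 ?_⟩
      have : q'.1 ^ 2 < 4 := by
        have h5 : (e * q'.1) ^ 2 < 4 := by nlinarith
        rwa [mul_pow, he, one_mul] at h5
      constructor <;> nlinarith

/-- Relative to the smooth part, the closure of the slab is both open and closed. -/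
theorem IsCompactInterval.component_subset (h : IsCompactInterval A B C D r s)
    {q : ℝ × ℝ × ℝ} (hq : q ∈ slab A B C D r s) :
    connectedComponentIn (smoothPart A B C D) q ⊆ closure (slab A B C D r s) := by
  set K := closure (slab A B C D r s) with hK
  have hqE := h.slab_subset_smoothPart hq
  have hpre : IsPreconnected (connectedComponentIn (smoothPart A B C D) q) :=
    isPreconnected_connectedComponentIn
  have hE := connectedComponentIn_subset (smoothPart A B C D) q
  by_contra hcon
  obtain ⟨q', hq', hq'K⟩ := not_subset.1 hcon
  obtain ⟨w, hw, hw1, hw2⟩ := hpre (interior {q' | q' ∈ surface A B C D → q' ∈ K}) Kᶜ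
    isOpen_interior isClosed_closure.isOpen_compl
    (fun w hw => by
      by_cases hwK : w ∈ K
      · exact Or.inl (mem_interior_iff_mem_nhds.2 (h.eventually_mem_closure_slab hwK (hE hw)))
      · exact Or.inr hwK)
    ⟨q, mem_connectedComponentIn hqE, mem_interior_iff_mem_nhds.2
      (h.eventually_mem_closure_slab (subset_closure hq) hqE)⟩
    ⟨q', hq', hq'K⟩
  exact hw2 (interior_subset hw1 (hE hw).1)

/-! ### Bounded components meet the elliptic slices -/

theorem IsBoundedComponent.subset_of_isPreconnected {E V W : Set (ℝ × ℝ × ℝ)}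
    (hV : IsBoundedComponent E V) (hW : IsPreconnected W) (hWE : W ⊆ E)
    (hne : (W ∩ V).Nonempty) : W ⊆ V := by
  obtain ⟨⟨q, hq, rfl⟩, -⟩ := hV
  obtain ⟨w, hwW, hwV⟩ := hne
  rw [connectedComponentIn_eq hwV]
  exact hW.subset_connectedComponentIn hwW hWE

/-- The path stays in V, which is bounded, while y + lz grows at least linearly along it. -/
theorem IsBoundedComponent.false_of_ray {E V : Set (ℝ × ℝ × ℝ)} (hV : IsBoundedComponent E V)
    {f : ℝ → ℝ × ℝ × ℝ} (hf : ContinuousOn f (Ici 0)) (hfE : ∀ t, 0 ≤ t → f t ∈ E)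
    (hf0 : f 0 ∈ V) {l c k : ℝ} (hc : 0 < c)
    (hgrow : ∀ t, 0 ≤ t → c * t - k ≤ |(f t).2.1 + l * (f t).2.2|) : False := by
  have hsub : f '' Ici 0 ⊆ V := by
    refine hV.subset_of_isPreconnected (isPreconnected_Ici.image f hf) ?_ ⟨f 0, ⟨0, self_mem_Ici, rfl⟩, hf0⟩
    rintro _ ⟨t, ht, rfl⟩
    exact hfE t ht
  obtain ⟨M, hM⟩ := hV.2.exists_norm_le
  have hM0 : 0 ≤ M := (norm_nonneg _).trans (hM _ hf0)
  set t := (k + (1 + |l|) * M + 1) / c with ht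
  have hk : ∀ t, 0 ≤ t → c * t - k ≤ (1 + |l|) * M := by
    intro t ht
    refine (hgrow t ht).trans ?_
    have h1 := hM _ (hsub ⟨t, ht, rfl⟩)
    have h2 : |(f t).2.1| ≤ M := (norm_fst_le _).trans ((norm_snd_le _).trans h1)
    have h3 : |(f t).2.2| ≤ M := (norm_snd_le _).trans ((norm_snd_le _).trans h1)
    calc _ ≤ |(f t).2.1| + |l * (f t).2.2| := abs_add_le _ _
      _ = |(f t).2.1| + |l| * |(f t).2.2| := by rw [abs_mul]
      _ ≤ M + |l| * M := by gcongr
      _ = _ := by ring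
  have h0 := hk 0 le_rfl
  have ht0 : 0 ≤ t := by
    rw [ht]
    refine div_nonneg ?_ hc.le
    have : 0 ≤ (1 + |l|) * M := by positivity
    have hk' : -k ≤ (1 + |l|) * M := by linarith
    linarith
  have h1 := hk t ht0
  rw [ht, mul_div_cancel₀ _ hc.ne'] at h1
  linarith

/-- In the eigenforms p and p' the slice is a level set of pp', and the ray is ((1 + t)p, p'/(1 +
t)). A singular point would have both forms zero, and the first one never vanishes on the ray. -/
theorem false_of_ray_of_hyperbolic {V : Set (ℝ × ℝ × ℝ)}
    (hV : IsBoundedComponent (smoothPart A B C D) V) {x y z u v l m : ℝ} (hlm : l * m = 1)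
    (hne : l ≠ m) (hx : x = l + m) (hu : 2 * u + x * v = B) (hv : 2 * v + x * u = C)
    (hq : (x, y, z) ∈ V) (hp : (y - u) + l * (z - v) ≠ 0) : False := by
  have hE : V ⊆ smoothPart A B C D := by
    obtain ⟨⟨q, -, rfl⟩, -⟩ := hV
    exact connectedComponentIn_subset _ _
  have hS := (hE hq).1
  obtain ⟨p, hp'⟩ : ∃ p, p = (y - u) + l * (z - v) := ⟨_, rfl⟩
  obtain ⟨p', hpp'⟩ : ∃ p', p' = (y - u) + m * (z - v) := ⟨_, rfl⟩
  rw [← hp'] at hp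
  have hlm0 : l - m ≠ 0 := sub_ne_zero.2 hne
  set f : ℝ → ℝ × ℝ × ℝ := fun t =>
    (x, u + (l * (p' / (1 + t)) - m * ((1 + t) * p)) / (l - m),
      v + ((1 + t) * p - p' / (1 + t)) / (l - m)) with hf
  have h1t : ∀ t : ℝ, 0 ≤ t → (1 + t) ≠ 0 := fun t ht => by positivity
  refine hV.false_of_ray (f := f) (l := l) (c := |p|) (k := |u + l * v|) ?_ ?_ ?_
    (abs_pos.2 hp) ?_
  · have : ContinuousOn (fun t : ℝ => p' / (1 + t)) (Ici 0) :=
      ContinuousOn.div (by fun_prop) (by fun_prop) h1t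
    simp only [hf]
    fun_prop
  · intro t ht
    have ht' := h1t t ht
    have hmem : f t ∈ surface A B C D := by
      simp only [surface, mem_ofPred_eq, hf] at hS ⊢
      obtain ⟨a, ha⟩ : ∃ a, a = (1 + t) * p := ⟨_, rfl⟩
      obtain ⟨b, hb⟩ : ∃ b, b = p' / (1 + t) := ⟨_, rfl⟩
      rw [← ha, ← hb]
      have hab : a * b = p * p' := by rw [ha, hb]; field_simp
      obtain ⟨Y, hY⟩ : ∃ Y, Y = (l * b - m * a) / (l - m) := ⟨_, rfl⟩
      obtain ⟨Z, hZ⟩ : ∃ Z, Z = (a - b) / (l - m) := ⟨_, rfl⟩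
      rw [← hY, ← hZ]
      have e1 : Y + l * Z = a := by rw [hY, hZ]; field_simp; ring
      have e2 : Y + m * Z = b := by rw [hY, hZ]; field_simp; ring
      have e3 : Y ^ 2 + Z ^ 2 + x * Y * Z = p * p' := by
        rw [← hab, ← e1, ← e2, hx]; linear_combination -Z ^ 2 * hlm
      have e4 : (y - u) ^ 2 + (z - v) ^ 2 + x * (y - u) * (z - v) = p * p' := by
        rw [hp', hpp', hx]; linear_combination -(z - v) ^ 2 * hlm
      rw [← hu, ← hv] at hS ⊢
      linear_combination hS + e3 - e4
    refine ⟨hmem, fun hs => ?_⟩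
    obtain ⟨-, -, h2, h3⟩ := hs
    simp only [hf] at h2 h3
    have : (1 + t) * p * (l - m) = 0 := by
      rw [← hu] at h2
      rw [← hv] at h3
      rw [hx] at h2 h3
      field_simp at h2 h3
      have e5 : (l - m) * ((1 + t) * p + p' / (1 + t)) = 0 := by
        field_simp
        linear_combination h2
      have e6 : (l - m) * (m * ((1 + t) * p) + l * (p' / (1 + t))) = 0 := by
        field_simp
        linear_combination h3 + (2 * (1 + t) ^ 2 * p - 2 * p') * hlm
      have e7 := (mul_eq_zero.1 e5).resolve_left hlm0
      have e8 := (mul_eq_zero.1 e6).resolve_left hlm0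
      linear_combination l * e7 - e8
    rcases mul_eq_zero.1 this with h | h
    · exact (mul_ne_zero ht' hp) h
    · exact hlm0 h
  · have : f 0 = (x, y, z) := by
      simp only [hf, hp', hpp', Prod.mk.injEq, true_and]
      constructor
      · field_simp; ring
      · field_simp; ring
    rwa [this]
  · intro t ht
    have ht' := h1t t ht
    have e1 : (f t).2.1 + l * (f t).2.2 = (u + l * v) + (1 + t) * p := by
      simp only [hf]; field_simp; ring
    rw [e1]
    have e2 : |(1 + t) * p| ≤ |(u + l * v) + (1 + t) * p| + |u + l * v| := by
      have := abs_sub ((u + l * v) + (1 + t) * p) (u + l * v)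
      simpa using this
    rw [abs_mul, abs_of_nonneg (by positivity : (0 : ℝ) ≤ 1 + t)] at e2
    nlinarith [abs_nonneg p]

theorem IsBoundedComponent.sq_le_four {V : Set (ℝ × ℝ × ℝ)}
    (hV : IsBoundedComponent (smoothPart A B C D) V) {q : ℝ × ℝ × ℝ} (hq : q ∈ V) :
    q.1 ^ 2 ≤ 4 := by
  by_contra! hx
  have hE : V ⊆ smoothPart A B C D := by
    obtain ⟨⟨q, -, rfl⟩, -⟩ := hV
    exact connectedComponentIn_subset _ _
  obtain ⟨x, y, z⟩ := q
  simp only at hx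
  have hx4 : 4 - x ^ 2 ≠ 0 := by linarith
  obtain ⟨u, v, hu, hv⟩ : ∃ u v, 2 * u + x * v = B ∧ 2 * v + x * u = C :=
    ⟨(2 * B - x * C) / (4 - x ^ 2), (2 * C - x * B) / (4 - x ^ 2), by field_simp; ring,
      by field_simp; ring⟩
  have hd0 : 0 < √(x ^ 2 - 4) := Real.sqrt_pos.2 (by linarith)
  have hd := Real.sq_sqrt (show 0 ≤ x ^ 2 - 4 by linarith)
  set d := √(x ^ 2 - 4)
  obtain ⟨l, hl⟩ : ∃ l, l = (x + d) / 2 := ⟨_, rfl⟩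
  obtain ⟨m, hm⟩ : ∃ m, m = (x - d) / 2 := ⟨_, rfl⟩
  have hlm : l * m = 1 := by rw [hl, hm]; linear_combination -hd / 4
  have hne : l ≠ m := by
    intro h
    rw [hl, hm] at h
    linarith
  have hxlm : x = l + m := by rw [hl, hm]; ring
  by_cases hp : (y - u) + l * (z - v) = 0
  swap
  · exact false_of_ray_of_hyperbolic hV hlm hne hxlm hu hv hq hp
  by_cases hp' : (y - u) + m * (z - v) = 0
  swap
  · exact false_of_ray_of_hyperbolic hV (by rw [mul_comm, hlm]) hne.symm (by rw [hxlm, add_comm])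
      hu hv hq hp'
  have hz : z = v := by
    have : (l - m) * (z - v) = 0 := by linear_combination hp - hp'
    have := (mul_eq_zero.1 this).resolve_left (sub_ne_zero.2 hne)
    linarith
  have hy : y = u := by rw [hz] at hp; linarith
  subst hz hy
  have hS := (hE hq).1
  -- At the centre the slice is a pair of crossing lines. Along one of them only the centre itself
  -- could be singular, and it is a smooth point by assumption.
  refine hV.false_of_ray (f := fun t => (x, y - m * t, z + t)) (l := l) (c := l - m)
    (k := |y + l * z|) (by fun_prop) ?_ (by simpa using hq) (by rw [hl, hm]; linarith) ?_
  · intro t ht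
    rcases ht.eq_or_lt with rfl | ht
    · simpa using hE hq
    refine ⟨?_, fun hs => ?_⟩
    · simp only [surface, mem_ofPred_eq] at hS ⊢
      rw [← hu, ← hv, hxlm] at hS ⊢
      linear_combination hS - t ^ 2 * hlm
    · obtain ⟨-, -, h2, -⟩ := hs
      simp only at h2
      have : (l - m) * t = 0 := by
        rw [← hu, hxlm] at h2
        linear_combination h2
      rcases mul_eq_zero.1 this with h | h
      · exact hne (sub_eq_zero.1 h)
      · exact ht.ne' h
  · intro t ht
    have e1 : (y - m * t) + l * (z + t) = (y + l * z) + (l - m) * t := by ring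
    simp only
    rw [e1]
    have e2 := abs_sub ((y + l * z) + (l - m) * t) (y + l * z)
    simp only [add_sub_cancel_left] at e2
    have e3 := le_abs_self ((l - m) * t)
    linarith

end Components


/-! ### Bounded components reach nondegenerate elliptic slices; uniqueness -/

section Components

variable {A B C D r s : ℝ}

theorem IsBoundedComponent.subset {E V : Set (ℝ × ℝ × ℝ)} (hV : IsBoundedComponent E V) : V ⊆ E := by
  obtain ⟨⟨q, -, rfl⟩, -⟩ := hV
  exact connectedComponentIn_subset _ _

theorem IsBoundedComponent.nonempty {E V : Set (ℝ × ℝ × ℝ)} (hV : IsBoundedComponent E V) :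
    V.Nonempty := by
  obtain ⟨⟨q, hq, rfl⟩, -⟩ := hV
  exact ⟨q, mem_connectedComponentIn hq⟩

theorem IsBoundedComponent.exists_mem_of_path {E V : Set (ℝ × ℝ × ℝ)}
    (hV : IsBoundedComponent E V) {f : ℝ → ℝ × ℝ × ℝ} {η : ℝ} (hη : 0 < η)
    (hf : ContinuousOn f (Icc 0 η)) (hf0 : f 0 ∈ V) {p : ℝ × ℝ × ℝ → Prop}
    (hev : ∀ᶠ ε in 𝓝[>] (0 : ℝ), f ε ∈ E ∧ p (f ε)) : ∃ q ∈ V, p q := by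
  obtain ⟨δ, hδ, hsub⟩ := mem_nhdsGT_iff_exists_Ioc_subset.1 hev
  have hδ' : (0 : ℝ) < δ := hδ
  set m := min δ η
  have hm : 0 < m := lt_min hδ' hη
  refine ⟨f m, ?_, (hsub ⟨hm, min_le_left _ _⟩).2⟩
  refine hV.subset_of_isPreconnected (isPreconnected_Icc.image f
    (hf.mono (Icc_subset_Icc_right (min_le_right _ _)))) ?_
    ⟨f 0, ⟨0, left_mem_Icc.2 hm.le, rfl⟩, hf0⟩ ⟨m, right_mem_Icc.2 hm.le, rfl⟩
  rintro _ ⟨t, ht, rfl⟩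
  rcases ht.1.eq_or_lt with rfl | h0
  · exact hV.subset hf0
  · exact (hsub ⟨h0, ht.2.trans (min_le_left _ _)⟩).1

/-- The right-hand side is the derivative of the discriminant at x. So for x ≠ ±2, the centre of a
degenerate slice is singular on the surface exactly when x is a multiple root. -/
theorem center_identity {x y z : ℝ} (hS : (x, y, z) ∈ surface A B C D)
    (h1 : 2 * y + x * z - B = 0) (h2 : 2 * z + x * y - C = 0) :
    (A - 2 * x - y * z) * (4 - x ^ 2)
      = 4 * x ^ 3 - 3 * A * x ^ 2 - 2 * (D + 4) * x + (4 * A - B * C) := by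
  simp only [surface, mem_ofPred_eq] at hS
  have hB : B = 2 * y + x * z := by linarith
  have hC : C = 2 * z + x * y := by linarith
  rw [hB, hC] at hS ⊢
  linear_combination -2 * x * hS

/-- If the slice is a single point, smoothness makes x a simple root, so the discriminant is
positive on one side. Points of fixed angle θ lead from q into that side without leaving the
component. -/
theorem IsBoundedComponent.exists_pos_of_center {V : Set (ℝ × ℝ × ℝ)}
    (hV : IsBoundedComponent (smoothPart A B C D) V) {q : ℝ × ℝ × ℝ} (hq : q ∈ V)
    (hI : q.1 ∈ Ioo (-2 : ℝ) 2) :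
    ∃ q ∈ V, q.1 ∈ Ioo (-2 : ℝ) 2 ∧ 0 < sliceDisc A B C D q.1 := by
  have hS := (hV.subset hq).1
  rcases (sliceDisc_nonneg hS hI).lt_or_eq with hP | hP
  · exact ⟨q, hq, hI, hP⟩
  have hfix : sy B q = q ∧ sz C q = q := by
    by_contra hcon
    exact absurd ((sliceDisc_pos_iff hS hI).2 hcon) (by rw [← hP]; exact lt_irrefl _)
  rw [fixed_iff] at hfix
  obtain ⟨θ, hθ⟩ := exists_slicePoint hS hI
  have hFx : 2 * q.1 + q.2.1 * q.2.2 - A ≠ 0 := fun h0 =>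
    (hV.subset hq).2 ⟨hS, h0, hfix.1, hfix.2⟩
  have h4 := four_sub_sq_pos hI
  have key := center_identity (A := A) (D := D) hS hfix.1 hfix.2
  obtain ⟨x, hx⟩ : ∃ x, x = q.1 := ⟨_, rfl⟩
  rw [← hx] at hFx h4 key hP hI hθ
  set g : ℝ → ℝ := fun t => (t ^ 3 + t ^ 2 * x + t * x ^ 2 + x ^ 3) - A * (t ^ 2 + t * x + x ^ 2)
    - (4 + D) * (t + x) + (4 * A - B * C) with hg
  have hgx : g x ≠ 0 := by
    have : g x = (A - 2 * x - q.2.1 * q.2.2) * (4 - x ^ 2) := by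
      rw [key]; simp only [hg]; ring
    rw [this]
    exact mul_ne_zero (fun h0 => hFx (by linarith)) h4.ne'
  have hPg : ∀ t, sliceDisc A B C D t = (t - x) * g t := by
    intro t
    have : sliceDisc A B C D t - sliceDisc A B C D x = (t - x) * g t := by
      simp only [sliceDisc, hg]; ring
    rw [← hP, sub_zero] at this
    exact this
  have hgc : Continuous g := by simp only [hg]; fun_prop
  -- Since P(t) = (t - x)g(t), the sign of g(x) decides the side on which P is positive.
  obtain ⟨σ, hσ⟩ : ∃ σ : ℝ, 0 < σ * g x := ⟨g x, mul_self_pos.2 hgx⟩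
  have hlin : Continuous fun ε : ℝ => x + σ * ε := by fun_prop
  have hnear : ∀ᶠ ε in 𝓝 (0 : ℝ), x + σ * ε ∈ Ioo (-2 : ℝ) 2 := by
    refine hlin.continuousAt.eventually ?_
    simp only [mul_zero, add_zero]
    exact isOpen_Ioo.mem_nhds hI
  have hpos : ∀ᶠ ε in 𝓝 (0 : ℝ), 0 < σ * g (x + σ * ε) := by
    have : Continuous fun ε : ℝ => σ * g (x + σ * ε) := by fun_prop
    refine this.continuousAt.eventually (lt_mem_nhds ?_)
    simpa using hσ
  obtain ⟨η, hη, hηs⟩ := Metric.eventually_nhds_iff_ball.1 hnear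
  refine hV.exists_mem_of_path (f := fun ε => slicePoint A B C D (x + σ * ε) θ) (half_pos hη) ?_ ?_
    ?_
  · intro ε hε
    have hmem : x + σ * ε ∈ Ioo (-2 : ℝ) 2 := by
      refine hηs ε ?_
      rw [Metric.mem_ball, Real.dist_eq, sub_zero, abs_of_nonneg hε.1]
      linarith [hε.2]
    have h2 : ContinuousAt (fun ε : ℝ => (x + σ * ε, θ)) ε := by fun_prop
    exact (ContinuousAt.comp (f := fun ε : ℝ => (x + σ * ε, θ)) (x := ε)
      (continuousAt_slicePoint hmem θ) h2).continuousWithinAt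
  · simp only [mul_zero, add_zero]
    rwa [hθ]
  · filter_upwards [hnear.filter_mono nhdsWithin_le_nhds, hpos.filter_mono nhdsWithin_le_nhds,
      self_mem_nhdsWithin] with ε h1 h2 h3
    have h3' : (0 : ℝ) < ε := h3
    have hP' : 0 < sliceDisc A B C D (x + σ * ε) := by
      rw [hPg]
      have : (x + σ * ε - x) * g (x + σ * ε) = ε * (σ * g (x + σ * ε)) := by ring
      rw [this]
      exact mul_pos h3' h2
    exact ⟨mem_smoothPart_of_pos (slicePoint_mem h1 hP'.le) hP', h1, hP'⟩

/-- The slice at x = 2e is a parabola if C ≠ eB; otherwise it is a pair of parallel lines or a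
double line. In the first two cases it contains an unbounded smooth ray through the point. On a
double line the sign of g = 4 + eyz - eA matters: if g < 0 it stays negative along one half of the
line, again a smooth ray; if g > 0 the surface bends into the elliptic region. -/
theorem IsBoundedComponent.exists_pos_of_edge {V : Set (ℝ × ℝ × ℝ)}
    (hV : IsBoundedComponent (smoothPart A B C D) V) {e y z : ℝ} (he : e ^ 2 = 1)
    (hq : (2 * e, y, z) ∈ V) :
    ∃ q ∈ V, q.1 ∈ Ioo (-2 : ℝ) 2 ∧ 0 < sliceDisc A B C D q.1 := by
  obtain ⟨hS, hns⟩ := hV.subset hq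
  simp only [surface, mem_ofPred_eq] at hS
  have hline : (y + e * z) ^ 2 = B * y + C * z + (D + 2 * e * A - 4) := by
    linear_combination hS + (z ^ 2 - 4) * he
  by_cases hCB : C = e * B
  swap
  · exfalso
    have hCB' : C - e * B ≠ 0 := sub_ne_zero.2 hCB
    obtain ⟨p, hp⟩ : ∃ p, p = y + e * z := ⟨_, rfl⟩
    obtain ⟨Z, hZ⟩ : ∃ Z : ℝ → ℝ, Z = fun t => ((p + t) ^ 2 - B * (p + t) - (D + 2 * e * A - 4))
      / (C - e * B) := ⟨_, rfl⟩
    have hZ' : ∀ t, (C - e * B) * Z t = (p + t) ^ 2 - B * (p + t) - (D + 2 * e * A - 4) := by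
      intro t
      rw [hZ]
      exact mul_div_cancel₀ _ hCB'
    have hZc : Continuous Z := by rw [hZ]; fun_prop
    have hZ0 : Z 0 = z := by
      have h1 := hZ' 0
      have : (C - e * B) * (Z 0 - z) = 0 := by
        rw [add_zero] at h1
        rw [hp] at h1
        linear_combination h1 + hline
      have := (mul_eq_zero.1 this).resolve_left hCB'
      linarith
    refine hV.false_of_ray (f := fun t => (2 * e, p + t - e * Z t, Z t)) (l := e) (c := 1)
      (k := |p|) (by fun_prop) ?_ ?_ one_pos ?_
    · intro t _
      refine ⟨?_, fun hs => hCB ?_⟩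
      · simp only [surface, mem_ofPred_eq]
        linear_combination -hZ' t + (4 - Z t ^ 2) * he
      · obtain ⟨-, -, h1, h2⟩ := hs
        simp only at h1 h2
        linear_combination e * h1 - h2 - 2 * Z t * he
    · rw [hZ0, add_zero, hp, add_sub_cancel_right]
      exact hq
    · intro t ht
      simp only [sub_add_cancel]
      have := abs_sub (p + t) p
      rw [add_sub_cancel_left, abs_of_nonneg ht] at this
      linarith
  by_cases hp : y + e * z = B / 2
  swap
  · exfalso
    refine hV.false_of_ray (f := fun t => (2 * e, y + t, z - e * t)) (l := 0) (c := 1)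
      (k := |y|) (by fun_prop) ?_ (by simpa using hq) one_pos ?_
    · intro t _
      refine ⟨?_, fun hs => hp ?_⟩
      · simp only [surface, mem_ofPred_eq]
        rw [hCB] at hS ⊢
        linear_combination hS + (B * t - 2 * y * t - t ^ 2) * he
      · obtain ⟨-, -, h1, -⟩ := hs
        simp only at h1
        linear_combination h1 / 2 + t * he
    · intro t ht
      simp only [zero_mul, add_zero]
      have := abs_sub (y + t) y
      rw [add_sub_cancel_left, abs_of_nonneg ht] at this
      linarith
  have hD : B ^ 2 / 4 + D + 2 * e * A - 4 = 0 := by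
    rw [hp, hCB] at hline
    linear_combination -hline - B * hp
  have hg0 : 4 + e * y * z - e * A ≠ 0 := by
    intro h0
    refine hns ⟨hS, ?_, ?_, ?_⟩
    · linear_combination e * h0 + (A - y * z) * he
    · linear_combination 2 * hp
    · linear_combination 2 * e * hp - hCB - 2 * z * he
  rcases hg0.lt_or_gt with hg | hg
  · exfalso
    obtain ⟨σ, hσ, hσ'⟩ : ∃ σ : ℝ, σ ^ 2 = 1 ∧ σ * (e * z - y) ≤ 0 := by
      rcases le_total (e * z - y) 0 with h | h
      · exact ⟨1, by norm_num, by linarith⟩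
      · exact ⟨-1, by norm_num, by linarith⟩
    refine hV.false_of_ray (f := fun t => (2 * e, y + σ * t, z - e * (σ * t))) (l := 0) (c := 1)
      (k := |y|) (by fun_prop) ?_ (by simpa using hq) one_pos ?_
    · intro t ht
      refine ⟨?_, fun hs => ?_⟩
      · simp only [surface, mem_ofPred_eq]
        rw [hCB] at hS ⊢
        linear_combination hS + (B * (σ * t) - 2 * y * (σ * t) - (σ * t) ^ 2) * he
      · obtain ⟨-, h1, -, -⟩ := hs
        simp only at h1
        have h2 : (4 + e * y * z - e * A) + t * (σ * (e * z - y)) - t ^ 2 = 0 := by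
          linear_combination e * h1 + (-4 + y * σ * t + σ ^ 2 * t ^ 2) * he + t ^ 2 * hσ
        nlinarith [mul_nonneg ht (neg_nonneg.2 hσ')]
    · intro t ht
      simp only [zero_mul, add_zero]
      have := abs_sub (y + σ * t) y
      have hσ1 : |σ| = 1 := by
        rw [← sq_eq_sq₀ (abs_nonneg _) zero_le_one, sq_abs, hσ, one_pow]
      rw [add_sub_cancel_left, abs_mul, hσ1, abs_of_nonneg ht] at this
      linarith
  · obtain ⟨f, hf, hf0, hev⟩ := exists_edge_curve he hCB hD hp hg
    refine hV.exists_mem_of_path one_pos hf.continuousOn (by rwa [hf0]) ?_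
    filter_upwards [hev] with ε h
    exact ⟨mem_smoothPart_of_pos h.1 h.2.2, h.2⟩

theorem IsBoundedComponent.exists_pos {V : Set (ℝ × ℝ × ℝ)}
    (hV : IsBoundedComponent (smoothPart A B C D) V) :
    ∃ q ∈ V, q.1 ∈ Ioo (-2 : ℝ) 2 ∧ 0 < sliceDisc A B C D q.1 := by
  obtain ⟨⟨x, y, z⟩, hq⟩ := hV.nonempty
  have h4 : x ^ 2 ≤ 4 := hV.sq_le_four hq
  rcases h4.lt_or_eq with h | h
  · exact hV.exists_pos_of_center hq ⟨by simp only; nlinarith, by simp only; nlinarith⟩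
  · have hx : x = 2 * (x / 2) := by ring
    rw [hx] at hq
    exact hV.exists_pos_of_edge (by linarith) hq

theorem connectedComponentIn_eq_of_slab (hI : IsMaximalInterval A B C D r s)
    {q q' : ℝ × ℝ × ℝ} (hq : q ∈ slab A B C D r s) (hq' : q' ∈ slab A B C D r s) :
    connectedComponentIn (smoothPart A B C D) q = connectedComponentIn (smoothPart A B C D) q' :=
  connectedComponentIn_eq
    (hI.isPreconnected_slab.subset_connectedComponentIn hq hI.slab_subset_smoothPart hq')

/-- The component through the slab of a compact interval is the only bounded component. -/
theorem IsCompactInterval.eq_of_isBoundedComponent (h : IsCompactInterval A B C D r s)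
    {q : ℝ × ℝ × ℝ} (hq : q ∈ slab A B C D r s) {V : Set (ℝ × ℝ × ℝ)}
    (hV : IsBoundedComponent (smoothPart A B C D) V) :
    V = connectedComponentIn (smoothPart A B C D) q := by
  obtain ⟨q', hq', hI, hP⟩ := hV.exists_pos
  obtain ⟨r', s', hm, hmem⟩ := exists_isMaximalInterval hI hP
  have hslab : q' ∈ slab A B C D r' s' := ⟨(hV.subset hq').1, hmem⟩
  have hsub : slab A B C D r' s' ⊆ V :=
    hV.subset_of_isPreconnected hm.isPreconnected_slab hm.slab_subset_smoothPart ⟨q', hslab, hq'⟩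
  have hc := hm.isCompactInterval (hV.2.subset hsub)
  obtain ⟨rfl, rfl⟩ := h.unique hc
  rw [connectedComponentIn_eq_of_slab hm hq hslab]
  obtain ⟨⟨q0, -, rfl⟩, -⟩ := hV
  exact connectedComponentIn_eq hq'

theorem IsCompactInterval.isBoundedComponent (h : IsCompactInterval A B C D r s)
    (hb : Bornology.IsBounded (slab A B C D r s)) {q : ℝ × ℝ × ℝ} (hq : q ∈ slab A B C D r s) :
    IsBoundedComponent (smoothPart A B C D) (connectedComponentIn (smoothPart A B C D) q) :=
  ⟨⟨q, h.slab_subset_smoothPart hq, rfl⟩, hb.closure.subset (h.component_subset hq)⟩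

end Components


/-! ### Unit quaternions and SU(2)-representations -/

section UnitaryRepresentations

open Quaternion

/-- The standard embedding of the quaternions into the complex matrices of size two. -/
noncomputable def quaternionMatrix (q : ℍ[ℝ]) : Matrix (Fin 2) (Fin 2) ℂ :=
  !![⟨q.re, q.imI⟩, ⟨q.imJ, q.imK⟩; ⟨-q.imJ, q.imK⟩, ⟨q.re, -q.imI⟩]

theorem quaternionMatrix_one : quaternionMatrix 1 = 1 := by
  ext i j
  fin_cases i <;> fin_cases j <;> simp [quaternionMatrix, Complex.ext_iff]

theorem quaternionMatrix_mul (p q : ℍ[ℝ]) :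
    quaternionMatrix (p * q) = quaternionMatrix p * quaternionMatrix q := by
  ext i j
  fin_cases i <;> fin_cases j <;>
  · simp [quaternionMatrix, Complex.ext_iff, Matrix.mul_apply, Fin.sum_univ_two]
    constructor <;> ring

theorem quaternionMatrix_star (q : ℍ[ℝ]) :
    quaternionMatrix (star q) = star (quaternionMatrix q) := by
  ext i j
  fin_cases i <;> fin_cases j <;>
    simp [quaternionMatrix, Complex.ext_iff, Matrix.star_apply]

theorem trace_quaternionMatrix (q : ℍ[ℝ]) : (quaternionMatrix q).trace = ((2 * q.re : ℝ) : ℂ) := by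
  simp [quaternionMatrix, Matrix.trace_fin_two, Complex.ext_iff]
  ring

theorem det_quaternionMatrix (q : ℍ[ℝ]) : (quaternionMatrix q).det = ((normSq q : ℝ) : ℂ) := by
  simp [quaternionMatrix, Matrix.det_fin_two, Complex.ext_iff, Quaternion.normSq_def', -Complex.ofReal_pow]
  constructor <;> ring

theorem normSq_eq_one (q : unitary ℍ[ℝ]) : normSq (q : ℍ[ℝ]) = 1 := by
  have h : (q : ℍ[ℝ]) * star (q : ℍ[ℝ]) = 1 := Unitary.coe_mul_star_self q
  rw [Quaternion.self_mul_star] at h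
  exact Quaternion.coe_injective (by rw [h, Quaternion.coe_one])

theorem exists_unitary {x y z w : ℝ} (h : x ^ 2 + y ^ 2 + z ^ 2 + w ^ 2 = 1) :
    ∃ q : unitary ℍ[ℝ], (q : ℍ[ℝ]).re = x ∧ (q : ℍ[ℝ]).imI = y ∧ (q : ℍ[ℝ]).imJ = z ∧
      (q : ℍ[ℝ]).imK = w := by
  obtain ⟨q, rfl, rfl, rfl, rfl⟩ : ∃ q : ℍ[ℝ], q.re = x ∧ q.imI = y ∧ q.imJ = z ∧ q.imK = w :=
    ⟨⟨x, y, z, w⟩, rfl, rfl, rfl, rfl⟩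
  refine ⟨⟨q, ?_⟩, rfl, rfl, rfl, rfl⟩
  rw [← Quaternion.normSq_def'] at h
  rw [Unitary.mem_iff, Quaternion.star_mul_self, Quaternion.self_mul_star, h]
  simp

/-- The unit quaternions act by special unitary matrices. -/
noncomputable def unitQuaternionHom :
    unitary ℍ[ℝ] →* Matrix.SpecialLinearGroup (Fin 2) ℂ where
  toFun q := ⟨quaternionMatrix q, by rw [det_quaternionMatrix, normSq_eq_one, Complex.ofReal_one]⟩
  map_one' := Subtype.ext quaternionMatrix_one
  map_mul' p q := Subtype.ext (quaternionMatrix_mul p q)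

theorem unitQuaternionHom_mem (q : unitary ℍ[ℝ]) :
    (unitQuaternionHom q : Matrix (Fin 2) (Fin 2) ℂ) ∈ Matrix.specialUnitaryGroup (Fin 2) ℂ := by
  rw [Matrix.mem_specialUnitaryGroup_iff]
  refine ⟨?_, (unitQuaternionHom q).2⟩
  rw [Matrix.mem_unitaryGroup_iff]
  change quaternionMatrix q * star (quaternionMatrix q) = 1
  have h : (q : ℍ[ℝ]) * star (q : ℍ[ℝ]) = 1 := Unitary.coe_mul_star_self q
  rw [← quaternionMatrix_star, ← quaternionMatrix_mul, h, quaternionMatrix_one]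

/-- The representation with prescribed unit quaternions at the first three loops. -/
noncomputable def quaternionRep (α β γ : unitary ℍ[ℝ]) : Rep :=
  unitQuaternionHom.comp (PresentedGroup.toGroup (f := ![α, β, γ, (α * β * γ)⁻¹]) (by
    rintro _ rfl
    simp [mul_assoc]))

theorem quaternionRep_loop (α β γ : unitary ℍ[ℝ]) (i : Fin 4) :
    quaternionRep α β γ (loop i) = unitQuaternionHom (![α, β, γ, (α * β * γ)⁻¹] i) := by
  simp only [quaternionRep, loop, MonoidHom.comp_apply, PresentedGroup.toGroup.of]

theorem isSU2_quaternionRep (α β γ : unitary ℍ[ℝ]) : IsSU2 (quaternionRep α β γ) :=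
  fun _ => unitQuaternionHom_mem _

theorem trace_unitQuaternionHom (q : unitary ℍ[ℝ]) :
    (unitQuaternionHom q : Matrix (Fin 2) (Fin 2) ℂ).trace = ((2 * (q : ℍ[ℝ]).re : ℝ) : ℂ) :=
  trace_quaternionMatrix _

theorem boundaryTraces_quaternionRep (α β γ : unitary ℍ[ℝ]) :
    boundaryTraces (quaternionRep α β γ) = (((2 * (α : ℍ[ℝ]).re : ℝ) : ℂ),
      ((2 * (β : ℍ[ℝ]).re : ℝ) : ℂ), ((2 * (γ : ℍ[ℝ]).re : ℝ) : ℂ),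
      ((2 * ((α : ℍ[ℝ]) * β * γ).re : ℝ) : ℂ)) := by
  simp only [boundaryTraces, tr, quaternionRep_loop, trace_unitQuaternionHom, Prod.mk.injEq]
  refine ⟨rfl, rfl, rfl, ?_⟩
  change ((2 * (star ((α : ℍ[ℝ]) * β * γ)).re : ℝ) : ℂ) = _
  rw [Quaternion.re_star]

theorem interiorTraces_quaternionRep (α β γ : unitary ℍ[ℝ]) :
    interiorTraces (quaternionRep α β γ) = toComplex (2 * ((α : ℍ[ℝ]) * β).re,
      2 * ((β : ℍ[ℝ]) * γ).re, 2 * ((γ : ℍ[ℝ]) * α).re) := by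
  simp only [interiorTraces, tr, map_mul, quaternionRep_loop, toComplex]
  simp only [← map_mul, trace_unitQuaternionHom]
  rfl

theorem abs_re_le_one (q : unitary ℍ[ℝ]) : |(q : ℍ[ℝ]).re| ≤ 1 := by
  have h := normSq_eq_one q
  rw [Quaternion.normSq_def'] at h
  rw [← sq_le_one_iff_abs_le_one]
  nlinarith [sq_nonneg (q : ℍ[ℝ]).imI, sq_nonneg (q : ℍ[ℝ]).imJ, sq_nonneg (q : ℍ[ℝ]).imK]

instance compactSpace_unitary : CompactSpace (unitary ℍ[ℝ]) := by
  have : ProperSpace ℍ[ℝ] := FiniteDimensional.proper_real _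
  refine isCompact_iff_compactSpace.1 (Metric.isCompact_of_isClosed_isBounded isClosed_unitary ?_)
  refine isBounded_iff_forall_norm_le.2 ⟨1, fun q hq => ?_⟩
  have h := normSq_eq_one ⟨q, hq⟩
  rw [Quaternion.normSq_eq_norm_mul_self] at h
  nlinarith [norm_nonneg q]

/-- The interior traces of the unitary representations with boundary traces `a, b, c, d`. -/
def unitaryTraces (a b c d : ℝ) : Set (ℝ × ℝ × ℝ) :=
  {q | ∃ α β γ : unitary ℍ[ℝ], 2 * (α : ℍ[ℝ]).re = a ∧ 2 * (β : ℍ[ℝ]).re = b ∧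
    2 * (γ : ℍ[ℝ]).re = c ∧ 2 * ((α : ℍ[ℝ]) * β * γ).re = d ∧
    q = (2 * ((α : ℍ[ℝ]) * β).re, 2 * ((β : ℍ[ℝ]) * γ).re, 2 * ((γ : ℍ[ℝ]) * α).re)}

/-- A continuous image of a compact set of triples of unit quaternions; closedness extends the
result from the slab to its closure. -/
theorem isClosed_unitaryTraces (a b c d : ℝ) : IsClosed (unitaryTraces a b c d) := by
  have hre : Continuous fun q : ℍ[ℝ] => q.re := continuous_re
  have h : unitaryTraces a b c d = (fun p : unitary ℍ[ℝ] × unitary ℍ[ℝ] × unitary ℍ[ℝ] =>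
      (2 * ((p.1 : ℍ[ℝ]) * p.2.1).re, 2 * ((p.2.1 : ℍ[ℝ]) * p.2.2).re,
        2 * ((p.2.2 : ℍ[ℝ]) * p.1).re)) '' {p | 2 * (p.1 : ℍ[ℝ]).re = a ∧
          2 * (p.2.1 : ℍ[ℝ]).re = b ∧ 2 * (p.2.2 : ℍ[ℝ]).re = c ∧
          2 * ((p.1 : ℍ[ℝ]) * p.2.1 * p.2.2).re = d} := by
    ext q
    constructor
    · rintro ⟨α, β, γ, h1, h2, h3, h4, rfl⟩
      exact ⟨(α, β, γ), ⟨h1, h2, h3, h4⟩, rfl⟩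
    · rintro ⟨⟨α, β, γ⟩, ⟨h1, h2, h3, h4⟩, rfl⟩
      exact ⟨α, β, γ, h1, h2, h3, h4, rfl⟩
  rw [h]
  refine (IsCompact.image ?_ (by fun_prop)).isClosed
  refine IsClosed.isCompact ?_
  exact (isClosed_eq (by fun_prop) (by fun_prop)).inter <|
    (isClosed_eq (by fun_prop) (by fun_prop)).inter <|
    (isClosed_eq (by fun_prop) (by fun_prop)).inter (isClosed_eq (by fun_prop) (by fun_prop))

theorem unitaryTraces_subset {a b c d : ℝ} {q : ℝ × ℝ × ℝ} (hq : q ∈ unitaryTraces a b c d) :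
    q ∈ (Icc (-2) 2 ×ˢ Icc (-2) 2 ×ˢ Icc (-2) 2 : Set (ℝ × ℝ × ℝ)) := by
  obtain ⟨α, β, γ, -, -, -, -, rfl⟩ := hq
  have key : ∀ p : unitary ℍ[ℝ], 2 * (p : ℍ[ℝ]).re ∈ Icc (-2 : ℝ) 2 := fun p => by
    have := abs_le.1 (abs_re_le_one p)
    constructor <;> linarith [this.1, this.2]
  exact ⟨key (α * β), key (β * γ), key (γ * α)⟩

theorem exists_rep_of_mem_unitaryTraces {a b c d : ℝ} {q : ℝ × ℝ × ℝ}
    (hq : q ∈ unitaryTraces a b c d) : ∃ ρ : Rep, IsSU2 ρ ∧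
      boundaryTraces ρ = ((a : ℂ), (b : ℂ), (c : ℂ), (d : ℂ)) ∧ interiorTraces ρ = toComplex q := by
  obtain ⟨α, β, γ, rfl, rfl, rfl, rfl, rfl⟩ := hq
  exact ⟨quaternionRep α β γ, isSU2_quaternionRep α β γ, boundaryTraces_quaternionRep α β γ,
    interiorTraces_quaternionRep α β γ⟩

/-- The relation between the traces of three matrices of determinants `u, v, n`. -/
theorem trace_relation (p0 p1 q0 q1 q2 g0 g1 g2 g3 u v n a b c d x y z : ℝ)
    (hu : u = p0 ^ 2 + p1 ^ 2) (hv : v = q0 ^ 2 + q1 ^ 2 + q2 ^ 2)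
    (hn : n = g0 ^ 2 + g1 ^ 2 + g2 ^ 2 + g3 ^ 2) (ha : a = 2 * p0) (hb : b = 2 * q0)
    (hc : c = 2 * g0) (hx : x = 2 * (p0 * q0 - p1 * q1))
    (hy : y = 2 * (q0 * g0 - q1 * g1 - q2 * g2)) (hz : z = 2 * (p0 * g0 - p1 * g1))
    (hd : d = 2 * ((p0 * q0 - p1 * q1) * g0 - (p0 * q1 + p1 * q0) * g1 - p0 * q2 * g2
      - p1 * q2 * g3)) :
    n * (x ^ 2 - a * b * x) + u * (y ^ 2 - b * c * y) + v * (z ^ 2 - a * c * z) + x * y * z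
      - c * d * x - a * d * y - b * d * z + a ^ 2 * v * n + b ^ 2 * u * n + c ^ 2 * u * v + d ^ 2
      + a * b * c * d - 4 * u * v * n = 0 := by
  subst hu hv hn ha hb hc hx hy hz hd
  ring

/-- Up to conjugation α may be taken in the span of 1, i and β in the span of 1, i, j, with positive
last coefficients. The values of c, y, z and d are then linear conditions that determine the four
coordinates of γ. In `trace_relation` the norm of γ enters linearly, with coefficient the quadratic
in `hκ`, which is nonzero; so the surface equation forces this norm to be 1. -/
theorem mem_unitaryTraces {a b c d : ℝ} {q : ℝ × ℝ × ℝ} (hx : q.1 ∈ Ioo (-2 : ℝ) 2)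
    (hκ : q.1 ^ 2 - a * b * q.1 + (a ^ 2 + b ^ 2 - 4) < 0)
    (hq : q ∈ surface (a * b + c * d) (b * c + a * d) (a * c + b * d)
      (4 - a ^ 2 - b ^ 2 - c ^ 2 - d ^ 2 - a * b * c * d)) :
    q ∈ unitaryTraces a b c d := by
  obtain ⟨x, y, z⟩ := q
  have h4 := four_sub_sq_pos hx
  simp only [surface, mem_ofPred_eq] at hx hκ hq h4
  have ha : 0 < 1 - a ^ 2 / 4 := by
    -- With κ the quadratic in `hκ`, the product equals -4κ + (2b - ax)².
    have h1 : 0 < (4 - a ^ 2) * (4 - x ^ 2) := by nlinarith [sq_nonneg (b - a * x / 2)]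
    have := pos_of_mul_pos_left h1 h4.le
    linarith
  obtain ⟨p1, hp1, hp⟩ : ∃ p1 : ℝ, 0 < p1 ∧ p1 ^ 2 = 1 - a ^ 2 / 4 :=
    ⟨_, Real.sqrt_pos.2 ha, Real.sq_sqrt ha.le⟩
  obtain ⟨q1, hq1⟩ : ∃ q1, q1 = (a * b / 4 - x / 2) / p1 := ⟨_, rfl⟩
  have hpq : p1 * q1 = a * b / 4 - x / 2 := by rw [hq1]; field_simp
  have hb : 0 < 1 - b ^ 2 / 4 - q1 ^ 2 := by
    have h1 : (1 - b ^ 2 / 4 - q1 ^ 2) * p1 ^ 2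
        = -(x ^ 2 - a * b * x + (a ^ 2 + b ^ 2 - 4)) / 4 := by
      have h2 : q1 ^ 2 * p1 ^ 2 = (a * b / 4 - x / 2) ^ 2 := by rw [← hpq]; ring
      rw [sub_mul, h2, hp]
      ring
    refine pos_of_mul_pos_left (b := p1 ^ 2) ?_ (by positivity)
    rw [h1]
    linarith
  obtain ⟨q2, hq2, hqq⟩ : ∃ q2 : ℝ, 0 < q2 ∧ q2 ^ 2 = 1 - b ^ 2 / 4 - q1 ^ 2 :=
    ⟨_, Real.sqrt_pos.2 hb, Real.sq_sqrt hb.le⟩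
  obtain ⟨g1, hg1⟩ : ∃ g1, g1 = (a * c / 4 - z / 2) / p1 := ⟨_, rfl⟩
  have hpg : p1 * g1 = a * c / 4 - z / 2 := by rw [hg1]; field_simp
  obtain ⟨g2, hg2⟩ : ∃ g2, g2 = (b * c / 4 - y / 2 - q1 * g1) / q2 := ⟨_, rfl⟩
  have hqg : q2 * g2 = b * c / 4 - y / 2 - q1 * g1 := by rw [hg2]; field_simp
  obtain ⟨g3, hg3⟩ : ∃ g3, g3 = ((a * b / 4 - p1 * q1) * (c / 2) - (a / 2 * q1 + p1 * (b / 2)) * g1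
    - a / 2 * q2 * g2 - d / 2) / (p1 * q2) := ⟨_, rfl⟩
  have hdg : p1 * q2 * g3 = (a * b / 4 - p1 * q1) * (c / 2) - (a / 2 * q1 + p1 * (b / 2)) * g1
    - a / 2 * q2 * g2 - d / 2 := by rw [hg3]; field_simp
  have hn : (c / 2) ^ 2 + g1 ^ 2 + g2 ^ 2 + g3 ^ 2 = 1 := by
    have h1 := trace_relation (a / 2) p1 (b / 2) q1 q2 (c / 2) g1 g2 g3 1 1 _ a b c d x y z
      (by linarith) (by linarith) rfl (by ring) (by ring) (by ring) (by linarith) (by linarith)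
      (by linarith) (by linarith)
    have h2 : ((c / 2) ^ 2 + g1 ^ 2 + g2 ^ 2 + g3 ^ 2 - 1)
        * (x ^ 2 - a * b * x + (a ^ 2 + b ^ 2 - 4)) = 0 := by
      linear_combination h1 - hq
    have := (mul_eq_zero.1 h2).resolve_right hκ.ne
    linarith
  obtain ⟨α, a0, a1, a2, a3⟩ := exists_unitary (x := a / 2) (y := p1) (z := 0) (w := 0) (by linarith)
  obtain ⟨β, b0, b1, b2, b3⟩ := exists_unitary (x := b / 2) (y := q1) (z := q2) (w := 0)
    (by linarith)
  obtain ⟨γ, c0, c1, c2, c3⟩ := exists_unitary hn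
  refine ⟨α, β, γ, by rw [a0]; ring, by rw [b0]; ring, by rw [c0]; ring, ?_, ?_⟩
  · simp only [Quaternion.re_mul, Quaternion.imI_mul, Quaternion.imJ_mul, Quaternion.imK_mul,
      a0, a1, a2, a3, b0, b1, b2, b3, c0, c1, c2, c3]
    linarith
  · simp only [Quaternion.re_mul, Prod.mk.injEq, a0, a1, a2, a3, b0, b1, b2, b3, c0, c1, c2, c3]
    refine ⟨?_, ?_, ?_⟩ <;> linarith

/-- The two numbers are the squares of a - b and a + b. They are the values at 2 and -2 of the
quadratic x² + βx + γ. -/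
theorem exists_mul_eq_and_sq_add_sq {β γ : ℝ} (h1 : 0 ≤ 4 + 2 * β + γ) (h2 : 0 ≤ 4 - 2 * β + γ) :
    ∃ a b : ℝ, a * b = -β ∧ a ^ 2 + b ^ 2 - 4 = γ := by
  have e1 := Real.sq_sqrt h1
  have e2 := Real.sq_sqrt h2
  refine ⟨(√(4 - 2 * β + γ) + √(4 + 2 * β + γ)) / 2, (√(4 - 2 * β + γ) - √(4 + 2 * β + γ)) / 2,
    ?_, ?_⟩
  · linear_combination (e2 - e1) / 4
  · linear_combination (e1 + e2) / 2

theorem eq_or_of_mul_eq {u v u' v' : ℝ} (h1 : u * v = u' * v') (h2 : u ^ 2 + v ^ 2 = u' ^ 2 + v' ^ 2) :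
    (u = u' ∧ v = v') ∨ (u = v' ∧ v = u') ∨ (u = -u' ∧ v = -v') ∨ (u = -v' ∧ v = -u') := by
  have h3 : (u + v) ^ 2 = (u' + v') ^ 2 := by linear_combination h2 + 2 * h1
  have h4 : (u - v) ^ 2 = (u' - v') ^ 2 := by linear_combination h2 - 2 * h1
  rcases sq_eq_sq_iff_eq_or_eq_neg.1 h3 with h | h <;>
  rcases sq_eq_sq_iff_eq_or_eq_neg.1 h4 with h' | h'
  · left; constructor <;> linarith
  · right; left; constructor <;> linarith
  · right; right; right; constructor <;> linarith
  · right; right; left; constructor <;> linarith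

/-- The compact component consists of traces of unitary representations. -/
theorem IsCompactInterval.exists_unitaryTraces {A B C D r s : ℝ}
    (h : IsCompactInterval A B C D r s) : ∃ a b c d : ℝ,
      (A = a * b + c * d ∧ B = b * c + a * d ∧ C = a * c + b * d ∧
        D = 4 - a ^ 2 - b ^ 2 - c ^ 2 - d ^ 2 - a * b * c * d) ∧
      closure (slab A B C D r s) ⊆ unitaryTraces a b c d := by
  obtain ⟨β, γ, -, hA, hD, hBC, hBC2, hTr, hTs, hp, hm⟩ := h.factor
  have hl := h.left
  have hr := h.right
  have hlt := h.lt
  obtain ⟨a, b, hab, hab2⟩ := exists_mul_eq_and_sq_add_sq hp hm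
  obtain ⟨c, d, hcd, hcd2⟩ := exists_mul_eq_and_sq_add_sq (β := -(r + s)) (γ := r * s)
    (by nlinarith) (by nlinarith)
  have hβ : β = -(a * b) := by linarith
  have hrs : r + s = c * d := by linarith
  -- The coefficients of the discriminant determine only BC and B² + C², hence (B, C) up to exchange
  -- and a common sign. Exchanging a and b, or negating both, corrects this without affecting ab and
  -- a² + b².
  have key : ∃ a b : ℝ, a * b = -β ∧ a ^ 2 + b ^ 2 - 4 = γ ∧ B = b * c + a * d ∧
      C = a * c + b * d := by
    rw [hrs, ← hcd2, ← hab2, hβ] at hD hBC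
    rw [← hcd2, ← hab2] at hBC2
    have hA2 : A = a * b + c * d := by linarith
    have h1 : B * C = (b * c + a * d) * (a * c + b * d) := by
      linear_combination hBC + 4 * hA2
    have h2 : B ^ 2 + C ^ 2 = (b * c + a * d) ^ 2 + (a * c + b * d) ^ 2 := by
      linear_combination -hBC2 - 4 * hD
    rcases eq_or_of_mul_eq h1 h2 with ⟨h3, h4⟩ | ⟨h3, h4⟩ | ⟨h3, h4⟩ | ⟨h3, h4⟩
    · exact ⟨a, b, hab, hab2, h3, h4⟩
    · exact ⟨b, a, by linarith, by linarith, by linarith, by linarith⟩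
    · exact ⟨-a, -b, by linarith, by linarith, by linarith, by linarith⟩
    · exact ⟨-b, -a, by linarith, by linarith, by linarith, by linarith⟩
  clear hβ hab hab2 a b
  obtain ⟨a, b, hab, hab2, hB, hC⟩ := key
  have hA' : A = a * b + c * d := by linarith
  have hD' : D = 4 - a ^ 2 - b ^ 2 - c ^ 2 - d ^ 2 - a * b * c * d := by
    rw [← hab2, ← hcd2, show β = -(a * b) by linarith, show r + s = c * d by linarith] at hD
    linear_combination hD
  refine ⟨a, b, c, d, ⟨hA', hB, hC, hD'⟩, closure_minimal ?_ (isClosed_unitaryTraces a b c d)⟩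
  rintro q ⟨hq, hI⟩
  refine mem_unitaryTraces (h.subset_Ioo hI) ?_ ?_
  · rw [hab2, hab]
    have e1 := sub_pos.2 hI.1
    have e2 := sub_pos.2 hI.2
    -- The cofactor is strictly convex and nonpositive at r and s, so it is negative in between.
    nlinarith [mul_pos e1 e2, mul_nonneg e1.le (neg_nonneg.2 hTs), mul_nonneg e2.le (neg_nonneg.2 hTr),
      mul_pos (mul_pos e1 e2) (sub_pos.2 hlt)]
  · rw [← hA', ← hB, ← hC, ← hD']
    exact hq

end UnitaryRepresentations


/-! ### Invariance of the bounded component and density of the orbit -/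

section Density

variable {A B C D r s : ℝ}

/-- A set that contains a whole nondegenerate elliptic slice of the surface. -/
def ContainsSlice (A B C D : ℝ) (K : Set (ℝ × ℝ × ℝ)) : Prop :=
  ∃ x ∈ Ioo (-2 : ℝ) 2, 0 < sliceDisc A B C D x ∧ ∀ q ∈ surface A B C D, q.1 = x → q ∈ K

theorem IsInvariant.containsSlice {K : Set (ℝ × ℝ × ℝ)} (hK : IsInvariant A B C K)
    (hc : IsCompact K) {q : ℝ × ℝ × ℝ} (hq : q ∈ K) (hS : q ∈ surface A B C D)
    (hfix : ¬ (sy B q = q ∧ sz C q = q)) (hirr : ¬ IsFiniteOrderTrace (q.1 : ℂ)) :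
    ContainsSlice A B C D K := by
  have hx := (hK.mem_Ioo_or_fixed hc hq).resolve_right hfix
  exact ⟨q.1, hx, (sliceDisc_pos_iff hS hx).2 hfix,
    fun q' hq' h => hK.slice_subset hc hq hS hfix hirr hq' h⟩

theorem isCompact_preimage_rot {K : Set (ℝ × ℝ × ℝ)} (hc : IsCompact K) :
    IsCompact (rot ⁻¹' K) := by
  have h : rot ⁻¹' K = (fun q : ℝ × ℝ × ℝ => rot (rot q)) '' K := by
    ext q
    constructor
    · exact fun h => ⟨rot q, h, rot_rot_rot q⟩
    · rintro ⟨q, hq, rfl⟩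
      exact (rot_rot_rot q).symm ▸ hq
  rw [h]
  exact hc.image (by unfold rot; fun_prop)

/-- A full slice at x contains a point whose irrational y-rotation moves it, hence K contains a full
slice in the next direction as well. -/
theorem IsInvariant.containsSlice_rot {K : Set (ℝ × ℝ × ℝ)} (hK : IsInvariant A B C K)
    (hc : IsCompact K) (h : ContainsSlice A B C D K) : ContainsSlice B C A D (CantatLoray.rot ⁻¹' K) := by
  obtain ⟨x, hx, hP, hsl⟩ := h
  obtain ⟨⟨x', y, z⟩, hq, h1, hirr, hz⟩ := exists_irrational_snd hx hP
  refine hK.rot.containsSlice (isCompact_preimage_rot hc) (q := (y, z, x')) ?_ ?_ ?_ hirr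
  · exact hsl _ hq h1
  · exact rot_mem_surface.1 hq
  · rw [fixed_iff]
    rintro ⟨h2, -⟩
    apply hz
    simp only at h2 ⊢
    linarith

theorem IsInvariant.closure {K : Set (ℝ × ℝ × ℝ)} (hK : IsInvariant A B C K) :
    IsInvariant A B C (closure K) where
  sx_mem _ hq := map_mem_closure (by simp only [sx, Equiv.coe_fn_mk]; fun_prop) hq hK.sx_mem
  sy_mem _ hq := map_mem_closure (by simp only [sy, Equiv.coe_fn_mk]; fun_prop) hq hK.sy_mem
  sz_mem _ hq := map_mem_closure (by simp only [sz, Equiv.coe_fn_mk]; fun_prop) hq hK.sz_mem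

/-- Each involution reverses the sign of one partial derivative. If the image is singular, that
derivative vanishes and the involution fixes the point, which would then itself be singular. -/
theorem isInvariant_smoothPart : IsInvariant A B C (smoothPart A B C D) where
  sx_mem := by
    rintro ⟨x, y, z⟩ ⟨hS, hn⟩
    refine ⟨?_, fun hs => hn ?_⟩
    · simp only [surface, sx_apply, mem_ofPred_eq] at hS ⊢
      linear_combination hS
    · have : sx A (x, y, z) = (x, y, z) := by
        have h1 := hs.2.1
        simp only [sx_apply] at h1 ⊢
        rw [Prod.mk.injEq]
        exact ⟨by linarith, rfl⟩
      rwa [this] at hs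
  sy_mem := by
    rintro ⟨x, y, z⟩ ⟨hS, hn⟩
    refine ⟨?_, fun hs => hn ?_⟩
    · simp only [surface, sy_apply, mem_ofPred_eq] at hS ⊢
      linear_combination hS
    · have : sy B (x, y, z) = (x, y, z) := by
        have h1 := hs.2.2.1
        simp only [sy_apply] at h1 ⊢
        rw [Prod.mk.injEq, Prod.mk.injEq]
        exact ⟨rfl, by linarith, rfl⟩
      rwa [this] at hs
  sz_mem := by
    rintro ⟨x, y, z⟩ ⟨hS, hn⟩
    refine ⟨?_, fun hs => hn ?_⟩
    · simp only [surface, sz_apply, mem_ofPred_eq] at hS ⊢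
      linear_combination hS
    · have : sz C (x, y, z) = (x, y, z) := by
        have h1 := hs.2.2.2
        simp only [sz_apply] at h1 ⊢
        rw [Prod.mk.injEq, Prod.mk.injEq]
        exact ⟨rfl, rfl, by linarith⟩
      rwa [this] at hs

/-- A continuous involution of E carries a bounded component to a bounded component, hence to the
only one. -/
theorem IsBoundedComponent.map_mem {E V : Set (ℝ × ℝ × ℝ)} (hV : IsBoundedComponent E V)
    (huniq : ∀ W, IsBoundedComponent E W → W = V) {g : ℝ × ℝ × ℝ → ℝ × ℝ × ℝ} (hg : Continuous g)
    (hgg : ∀ q, g (g q) = q) (hE : ∀ q ∈ E, g q ∈ E) : ∀ q ∈ V, g q ∈ V := by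
  intro q hq
  have hqE := hV.subset hq
  have hW : IsBoundedComponent E (connectedComponentIn E (g q)) := by
    refine ⟨⟨g q, hE q hqE, rfl⟩, ?_⟩
    have hb : Bornology.IsBounded (g '' closure V) :=
      ((Metric.isCompact_of_isClosed_isBounded isClosed_closure hV.2.closure).image hg).isBounded
    refine hb.subset fun w hw => ⟨g w, subset_closure ?_, hgg w⟩
    refine hV.subset_of_isPreconnected
      (isPreconnected_connectedComponentIn.image g hg.continuousOn) ?_
      ⟨q, ⟨g q, mem_connectedComponentIn (hE q hqE), hgg q⟩, hq⟩ ⟨w, hw, rfl⟩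
    rintro _ ⟨v, hv, rfl⟩
    exact hE _ (connectedComponentIn_subset _ _ hv)
  rw [← huniq _ hW]
  exact mem_connectedComponentIn (hE q hqE)

theorem IsBoundedComponent.isInvariant {V : Set (ℝ × ℝ × ℝ)}
    (hV : IsBoundedComponent (smoothPart A B C D) V)
    (huniq : ∀ W, IsBoundedComponent (smoothPart A B C D) W → W = V) : IsInvariant A B C V where
  sx_mem := hV.map_mem huniq (by simp only [sx, Equiv.coe_fn_mk]; fun_prop) (sx_sx A)
    isInvariant_smoothPart.sx_mem
  sy_mem := hV.map_mem huniq (by simp only [sy, Equiv.coe_fn_mk]; fun_prop) (sy_sy B)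
    isInvariant_smoothPart.sy_mem
  sz_mem := hV.map_mem huniq (by simp only [sz, Equiv.coe_fn_mk]; fun_prop) (sz_sz C)
    isInvariant_smoothPart.sz_mem

theorem isInvariant_preimage_orb (p : ℂ × ℂ × ℂ) :
    IsInvariant A B C (toComplex ⁻¹' orb (A : ℂ) (B : ℂ) (C : ℂ) p) where
  sx_mem q hq := by
    rw [mem_preimage, toComplex_sx]; exact (orb_isInvariant _ _ _ p).sx_mem _ hq
  sy_mem q hq := by
    rw [mem_preimage, toComplex_sy]; exact (orb_isInvariant _ _ _ p).sy_mem _ hq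
  sz_mem q hq := by
    rw [mem_preimage, toComplex_sz]; exact (orb_isInvariant _ _ _ p).sz_mem _ hq

theorem isBounded_preimage_toComplex {T : Set (ℂ × ℂ × ℂ)} (hb : Bornology.IsBounded T) :
    Bornology.IsBounded (toComplex ⁻¹' T) := by
  obtain ⟨M, hM⟩ := hb.exists_norm_le
  refine isBounded_iff_forall_norm_le.2 ⟨M, fun q hq => ?_⟩
  have := hM _ hq
  simpa only [toComplex, Prod.norm_def, Complex.norm_real] using this

/-- The closure of an infinite bounded real orbit contains the slab of a compact interval. -/
theorem exists_isCompactInterval {p : ℝ × ℝ × ℝ}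
    (hp : p ∈ surface A B C D)
    (hb : Bornology.IsBounded (orb (A : ℂ) (B : ℂ) (C : ℂ) (toComplex p)))
    (hinf : (orb (A : ℂ) (B : ℂ) (C : ℂ) (toComplex p)).Infinite)
    (hreal : orb (A : ℂ) (B : ℂ) (C : ℂ) (toComplex p) ⊆ range toComplex) :
    ∃ r s, IsCompactInterval A B C D r s ∧
      slab A B C D r s ⊆ closure (toComplex ⁻¹' orb (A : ℂ) (B : ℂ) (C : ℂ) (toComplex p)) := by
  set O := orb (A : ℂ) (B : ℂ) (C : ℂ) (toComplex p) with hO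
  set K := closure (toComplex ⁻¹' O) with hKdef
  have hK : IsInvariant A B C K := (isInvariant_preimage_orb _).closure
  have hc : IsCompact K := Metric.isCompact_of_isClosed_isBounded isClosed_closure
    (isBounded_preimage_toComplex hb).closure
  have hpC := toComplex_mem_surface.2 hp
  have hS : ∀ q, toComplex q ∈ O → q ∈ surface A B C D := fun q hq =>
    toComplex_mem_surface.1 (orb_subset_surface _ _ _ _ _ hpC hq)
  have hcs : ContainsSlice A B C D K := by
    by_contra hcon
    have h1 : ¬ ContainsSlice B C A D (rot ⁻¹' K) := fun h => hcon <| by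
      have := hK.rot.rot.containsSlice_rot (isCompact_preimage_rot (isCompact_preimage_rot hc))
        (hK.rot.containsSlice_rot (isCompact_preimage_rot hc) h)
      rwa [show rot ⁻¹' (rot ⁻¹' (rot ⁻¹' K)) = K from by
        ext q; simp only [mem_preimage, rot_rot_rot]] at this
    have h2 : ¬ ContainsSlice C A B D (rot ⁻¹' (rot ⁻¹' K)) := fun h => hcon <| by
      have := hK.rot.rot.containsSlice_rot (isCompact_preimage_rot (isCompact_preimage_rot hc)) h
      rwa [show rot ⁻¹' (rot ⁻¹' (rot ⁻¹' K)) = K from by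
        ext q; simp only [mem_preimage, rot_rot_rot]] at this
    -- Without a full slice in any of the three directions, every coordinate of infinite order would
    -- occur at a point fixed by the corresponding two involutions.
    refine not_controlled_of_infinite hpC hinf ⟨?_, ?_, ?_⟩
    · intro w hw hirr
      obtain ⟨⟨x, y, z⟩, rfl⟩ := hreal hw
      rw [← toComplex_sy, ← toComplex_sz, toComplex_injective.eq_iff, toComplex_injective.eq_iff]
      by_contra hfix
      exact hcon (hK.containsSlice hc (subset_closure hw) (hS _ hw) hfix hirr)
    · intro w hw hirr
      obtain ⟨⟨x, y, z⟩, rfl⟩ := hreal hw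
      rw [← toComplex_sx, ← toComplex_sz, toComplex_injective.eq_iff, toComplex_injective.eq_iff]
      by_contra hfix
      refine h1 (hK.rot.containsSlice (isCompact_preimage_rot hc) (q := (y, z, x))
        (subset_closure hw) (rot_mem_surface.1 (hS _ hw)) (fun h => hfix ?_) hirr)
      have e1 := congrArg rot h.1
      have e2 := congrArg rot h.2
      rw [rot_sz] at e1
      rw [rot_sx] at e2
      exact ⟨e2, e1⟩
    · intro w hw hirr
      obtain ⟨⟨x, y, z⟩, rfl⟩ := hreal hw
      rw [← toComplex_sx, ← toComplex_sy, toComplex_injective.eq_iff, toComplex_injective.eq_iff]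
      by_contra hfix
      refine h2 (hK.rot.rot.containsSlice (isCompact_preimage_rot (isCompact_preimage_rot hc))
        (q := (z, x, y)) (subset_closure hw) (rot_mem_surface.1 (rot_mem_surface.1 (hS _ hw)))
        (fun h => hfix ?_) hirr)
      have e1 := congrArg (fun q => rot (rot q)) h.1
      have e2 := congrArg (fun q => rot (rot q)) h.2
      simp only [rot_sy, rot_sz, rot_sx] at e1 e2
      exact ⟨e1, e2⟩
  obtain ⟨x, hx, hP, hsl⟩ := hcs
  obtain ⟨r, s, hm, hmem⟩ := exists_isMaximalInterval hx hP
  have hsub := hK.slab_subset hc hm.left hm.right hm.pos hmem hsl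
  exact ⟨r, s, hm.isCompactInterval (hc.isBounded.subset hsub), hsub⟩

/-- An infinite bounded real orbit is dense in the only bounded component. -/
theorem exists_dense_component {p : ℝ × ℝ × ℝ} (hp : p ∈ surface A B C D)
    (hb : Bornology.IsBounded (orb (A : ℂ) (B : ℂ) (C : ℂ) (toComplex p)))
    (hinf : (orb (A : ℂ) (B : ℂ) (C : ℂ) (toComplex p)).Infinite)
    (hreal : orb (A : ℂ) (B : ℂ) (C : ℂ) (toComplex p) ⊆ range toComplex) :
    ∃ r s U, IsCompactInterval A B C D r s ∧ IsBoundedComponent (smoothPart A B C D) U ∧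
      (∀ V, IsBoundedComponent (smoothPart A B C D) V → V = U) ∧
      orb (A : ℂ) (B : ℂ) (C : ℂ) (toComplex p) ⊆ toComplex '' U ∧
      U ⊆ closure (slab A B C D r s) ∧
      toComplex '' U ⊆ closure (orb (A : ℂ) (B : ℂ) (C : ℂ) (toComplex p)) := by
  obtain ⟨r, s, hI, hsub⟩ := exists_isCompactInterval hp hb hinf hreal
  set O := orb (A : ℂ) (B : ℂ) (C : ℂ) (toComplex p) with hO
  have hmid : (r + s) / 2 ∈ Ioo r s := by
    have := hI.lt
    constructor <;> linarith
  have hsp : slicePoint A B C D ((r + s) / 2) 0 ∈ slab A B C D r s :=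
    ⟨slicePoint_mem (hI.subset_Ioo hmid) (hI.pos _ hmid).le, hmid⟩
  -- The condition r < x < s is open, so the orbit itself, and not only its closure, meets the slab.
  obtain ⟨q, hq1, hq2⟩ := mem_closure_iff.1 (hsub hsp) {q | q.1 ∈ Ioo r s}
    (isOpen_Ioo.preimage continuous_fst) hmid
  have hqO : toComplex q ∈ O := hq2
  have hq : q ∈ slab A B C D r s := ⟨toComplex_mem_surface.1
    (orb_subset_surface _ _ _ _ _ (toComplex_mem_surface.2 hp) hqO), hq1⟩
  have hbs : Bornology.IsBounded (slab A B C D r s) :=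
    (isBounded_preimage_toComplex hb).closure.subset hsub
  have hU := hI.isBoundedComponent hbs hq
  have huniq := fun V hV => hI.eq_of_isBoundedComponent (V := V) hq hV
  have hUK := hI.component_subset hq
  refine ⟨r, s, _, hI, hU, huniq, ?_, hUK, ?_⟩
  · have h1 : orb (A : ℂ) (B : ℂ) (C : ℂ) (toComplex q) = O := MulAction.orbit_eq_iff.2 hqO
    rw [← h1]
    exact (hU.isInvariant huniq).image_toComplex.orb_subset
      ⟨q, mem_connectedComponentIn (hI.slab_subset_smoothPart hq), rfl⟩
  · have h1 : closure (slab A B C D r s) ⊆ closure (toComplex ⁻¹' O) :=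
      closure_minimal hsub isClosed_closure
    exact (image_mono (hUK.trans h1)).trans
      ((image_closure_subset_closure_image continuous_toComplex).trans
        (closure_mono (image_preimage_subset _ _)))

end Density

/-! ### Fields of definition -/

/-- Elliptic values are real, so the subfield ℝ of ℂ contains all coordinates; the parameters A, B,
C follow from these, and D from the equation of the surface. -/
theorem exists_real_of_isBounded {A B C D : ℂ} {p : ℂ × ℂ × ℂ} (hp : p ∈ surface A B C D)
    (hlength : 4 < (orb A B C p).encard) (hbounded : Bornology.IsBounded (orb A B C p)) :
    ∃ A' B' C' D' : ℝ, A = A' ∧ B = B' ∧ C = C' ∧ D = D' ∧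
      orb A B C p ⊆ toComplex '' surface A' B' C' D' := by
  have hT := IsLong.orb hlength
  have hc := (orb_isInvariant A B C p).controlled hbounded
  set F : Subfield ℂ := Complex.ofRealHom.fieldRange with hFdef
  have hF : ∀ t, IsElliptic t → t ∈ F := by
    rintro _ ⟨t, -, rfl⟩
    exact ⟨t, rfl⟩
  obtain ⟨⟨A', hA⟩, ⟨B', hB⟩, ⟨C', hC⟩⟩ := hT.param_mem hc F hF (mem_orb_self A B C p)
  have hco : ∀ q ∈ orb A B C p, ∃ q', toComplex q' = q := by
    intro q hq
    obtain ⟨⟨x, hx⟩, ⟨y, hy⟩, ⟨z, hz⟩⟩ := hT.coord_mem hc F hF hq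
    refine ⟨(x, y, z), ?_⟩
    simp only [toComplex]
    exact Prod.ext hx (Prod.ext hy hz)
  obtain ⟨⟨x, y, z⟩, rfl⟩ := hco p (mem_orb_self A B C p)
  obtain rfl : (A' : ℂ) = A := hA
  obtain rfl : (B' : ℂ) = B := hB
  obtain rfl : (C' : ℂ) = C := hC
  obtain ⟨D', rfl⟩ : ∃ D' : ℝ, (D' : ℂ) = D := by
    refine ⟨x ^ 2 + y ^ 2 + z ^ 2 + x * y * z - (A' * x + B' * y + C' * z), ?_⟩
    simp only [surface, toComplex, mem_ofPred_eq] at hp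
    push_cast
    linear_combination hp
  refine ⟨A', B', C', D', rfl, rfl, rfl, rfl, fun q hq => ?_⟩
  obtain ⟨q', rfl⟩ := hco q hq
  exact ⟨q', toComplex_mem_surface.1 (orb_subset_surface _ _ _ _ _ hp hq), rfl⟩

/-- In a finite orbit the rotations have finite order, so all coordinates are algebraic; a finite
set of algebraic numbers generates a finite extension of ℚ. -/
theorem exists_numberField_of_finite {A B C D : ℝ} {p : ℂ × ℂ × ℂ}
    (hlength : 4 < (orb (A : ℂ) (B : ℂ) (C : ℂ) p).encard)
    (hfin : (orb (A : ℂ) (B : ℂ) (C : ℂ) p).Finite)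
    (hS : orb (A : ℂ) (B : ℂ) (C : ℂ) p ⊆ toComplex '' surface A B C D) :
    ∃ K : IntermediateField ℚ ℝ, NumberField K ∧ A ∈ K ∧ B ∈ K ∧ C ∈ K ∧ D ∈ K ∧
      orb (A : ℂ) (B : ℂ) (C : ℂ) p ⊆ toComplex '' {q | q.1 ∈ K ∧ q.2.1 ∈ K ∧ q.2.2 ∈ K} := by
  have hT := IsLong.orb hlength
  have hc := (orb_isInvariant (A : ℂ) (B : ℂ) (C : ℂ) p).controlled_of_finite hfin
  have hF : ∀ t, IsFiniteOrderTrace t → t ∈ (algebraicClosure ℚ ℂ).toSubfield :=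
    fun t ht => mem_algebraicClosure_iff.2 ht.isAlgebraic
  have halg : ∀ {t : ℝ}, (t : ℂ) ∈ (algebraicClosure ℚ ℂ).toSubfield → IsIntegral ℚ t := by
    intro t ht
    have h1 : IsAlgebraic ℚ (algebraMap ℝ ℂ t) := mem_algebraicClosure_iff.1 ht
    exact ((isAlgebraic_algebraMap_iff (algebraMap ℝ ℂ).injective).1 h1).isIntegral
  set R := toComplex ⁻¹' orb (A : ℂ) (B : ℂ) (C : ℂ) p with hR
  have hRfin : R.Finite := hfin.preimage toComplex_injective.injOn
  obtain ⟨hA, hB, hC⟩ := hT.param_mem hc _ hF (mem_orb_self _ _ _ p)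
  set S : Set ℝ := {A, B, C} ∪ ((fun q => q.1) '' R ∪ ((fun q => q.2.1) '' R ∪
    (fun q => q.2.2) '' R)) with hSdef
  have hSfin : S.Finite := (by simp : ({A, B, C} : Set ℝ).Finite).union
    ((hRfin.image _).union ((hRfin.image _).union (hRfin.image _)))
  have hSint : ∀ t ∈ S, IsIntegral ℚ t := by
    rintro t ((rfl | rfl | rfl) | ⟨q, hq, rfl⟩ | ⟨q, hq, rfl⟩ | ⟨q, hq, rfl⟩)
    · exact halg hA
    · exact halg hB
    · exact halg hC
    · exact halg (hT.coord_mem hc _ hF hq).1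
    · exact halg (hT.coord_mem hc _ hF hq).2.1
    · exact halg (hT.coord_mem hc _ hF hq).2.2
  have : Finite S := hSfin
  have hfd := IntermediateField.finiteDimensional_adjoin hSint
  have hsub : S ⊆ IntermediateField.adjoin ℚ S := IntermediateField.subset_adjoin ℚ S
  have hAK : A ∈ IntermediateField.adjoin ℚ S := hsub (by simp [hSdef])
  have hBK : B ∈ IntermediateField.adjoin ℚ S := hsub (by simp [hSdef])
  have hCK : C ∈ IntermediateField.adjoin ℚ S := hsub (by simp [hSdef])
  have hcoord : ∀ q ∈ R, q.1 ∈ IntermediateField.adjoin ℚ S ∧ q.2.1 ∈ IntermediateField.adjoin ℚ S ∧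
      q.2.2 ∈ IntermediateField.adjoin ℚ S := fun q hq =>
    ⟨hsub (Or.inr (Or.inl ⟨q, hq, rfl⟩)), hsub (Or.inr (Or.inr (Or.inl ⟨q, hq, rfl⟩))),
      hsub (Or.inr (Or.inr (Or.inr ⟨q, hq, rfl⟩)))⟩
  refine ⟨IntermediateField.adjoin ℚ S, ⟨⟩, hAK, hBK, hCK, ?_, ?_⟩
  · obtain ⟨q, hq, hqp⟩ := hS (mem_orb_self _ _ _ p)
    obtain ⟨hx, hy, hz⟩ := hcoord q (by rw [hR, mem_preimage, hqp]; exact mem_orb_self _ _ _ p)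
    have hD : D = q.1 ^ 2 + q.2.1 ^ 2 + q.2.2 ^ 2 + q.1 * q.2.1 * q.2.2
        - (A * q.1 + B * q.2.1 + C * q.2.2) := by
      simp only [surface, mem_ofPred_eq] at hq
      linear_combination -hq
    rw [hD]
    exact sub_mem (add_mem (add_mem (add_mem (pow_mem hx 2) (pow_mem hy 2)) (pow_mem hz 2))
      (mul_mem (mul_mem hx hy) hz))
      (add_mem (add_mem (mul_mem hAK hx) (mul_mem hBK hy)) (mul_mem hCK hz))
  · intro w hw
    obtain ⟨q, -, rfl⟩ := hS hw
    exact ⟨q, hcoord q hw, rfl⟩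

end CantatLoray

/-! ### Conclusion -/

open CantatLoray in
theorem theoremC (A B C D : ℂ) (p : ℂ × ℂ × ℂ) (hp : p ∈ surface A B C D)
    (hlength : 4 < (orb A B C p).encard) (hbounded : Bornology.IsBounded (orb A B C p)) :
    ∃ A' B' C' D' : ℝ, A = A' ∧ B = B' ∧ C = C' ∧ D = D' ∧
      orb A B C p ⊆ toComplex '' surface A' B' C' D' ∧
      ((orb A B C p).Finite →
        ∃ K : IntermediateField ℚ ℝ, NumberField K ∧ A' ∈ K ∧ B' ∈ K ∧ C' ∈ K ∧ D' ∈ K ∧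
          orb A B C p ⊆ toComplex '' {q | q.1 ∈ K ∧ q.2.1 ∈ K ∧ q.2.2 ∈ K}) ∧
      ((orb A B C p).Infinite →
        orb A B C p ⊆ toComplex ''
          (Set.Icc (-2) 2 ×ˢ Set.Icc (-2) 2 ×ˢ Set.Icc (-2) 2 : Set (ℝ × ℝ × ℝ)) ∧
        (∃ a b c d : ℂ, Fits a b c d A B C D ∧ ∀ q ∈ orb A B C p,
          ∃ ρ : Rep, IsSU2 ρ ∧ boundaryTraces ρ = (a, b, c, d) ∧ interiorTraces ρ = q) ∧
        ∃ U : Set (ℝ × ℝ × ℝ), IsBoundedComponent (smoothPart A' B' C' D') U ∧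
          (∀ V, IsBoundedComponent (smoothPart A' B' C' D') V → V = U) ∧
          orb A B C p ⊆ toComplex '' U ∧ toComplex '' U ⊆ closure (orb A B C p)) := by
  obtain ⟨A', B', C', D', rfl, rfl, rfl, rfl, hreal⟩ := exists_real_of_isBounded hp hlength hbounded
  refine ⟨A', B', C', D', rfl, rfl, rfl, rfl, hreal,
    fun hfin => exists_numberField_of_finite hlength hfin hreal, fun hinf => ?_⟩
  obtain ⟨p, hp', rfl⟩ := hreal (mem_orb_self _ _ _ p)
  obtain ⟨r, s, U, hI, hU, huniq, hOU, hUs, hUO⟩ := exists_dense_component hp' hbounded hinf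
    (hreal.trans (Set.image_subset_range _ _))
  obtain ⟨a, b, c, d, ⟨hA, hB, hC, hD⟩, hcl⟩ := hI.exists_unitaryTraces
  refine ⟨?_, ⟨a, b, c, d, ⟨?_, ?_, ?_, ?_⟩, ?_⟩, U, hU, huniq, hOU, hUO⟩
  · exact hOU.trans (Set.image_mono fun q hq => unitaryTraces_subset (hcl (hUs hq)))
  · rw [hA]; push_cast; rfl
  · rw [hB]; push_cast; rfl
  · rw [hC]; push_cast; rfl
  · rw [hD]; push_cast; rfl
  · intro w hw
    obtain ⟨q, hq, rfl⟩ := hOU hw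
    exact exists_rep_of_mem_unitaryTraces (hcl (hUs hq))
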